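/- Let $A$ be a finite dimensional Frobenius algebra over a field $k$, with nondegenerate bilinear form $\langle ab,c\rangle=\langle a,bc\rangle$, a $k$-basis $(u_i)$ of $A$, the dual basis $(v_i)$ with $\langle v_i,u_j\rangle=\delta_{ij}$, and the Nakayama automorphism $\nu$, given by $\langle a,b\rangle=\langle b,\nu(a)\rangle$. Bimodules are $A$-bimodules on which $k$ acts centrally, i.e. left modules over $A^e=A\otimes_k A^{\circ}$; as a right $A^e$-module a bimodule $X$ has $x(a\otimes b^\circ)=bxa$. A complete resolution of $A$ is an exact complex $T=(T_i,d)_{i\in\mathbb Z}$ of finitely generated projective bimodules whose $A^e$-dual is exact, with a surjection $\varepsilon:T_0\to A$ of bimodules such that $\ker\varepsilon=\operatorname{im}(T_1\to T_0)$. It defines $\hat H^r(A,M)=H^r(\operatorname{Hom}_{A^e}(T,M))$, where the differential is $u\mapsto(-1)^{r+1}u\circ d$ on $\operatorname{Hom}_{A^e}(T_r,M)$, and $\hat H_s(A,N)=H_s(T\otimes_{A^e}N)$, for all bimodules $M,N$ and all $r,s\in\mathbb Z$. Let $\partial$ denote connecting homomorphisms of short exact sequences of bimodules. A diagonal approximation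 is a chain map of bimodules $\Delta:T\to T\,\hat\otimes_A T$ into the complete tensor product $(T\,\hat\otimes_AT)_n=\prod_{p+q=n}T_p\otimes_AT_q$, with differential $d(x\otimes y)=dx\otimes y+(-1)^{p}x\otimes dy$ for $x\in T_p$, such that $(\varepsilon\otimes\varepsilon)\Delta=\varepsilon$. Put $M^A=\{m: am=ma\ \forall a\in A\}$, $N_A(M)=\{\sum_i u_imv_i:m\in M\}$, let $[A,N]$ be the span of all $an-na$ $(a\in A,\ n\in N)$, and ${}_{N'}N=\{n\in N:\sum_i u_in\nu(v_i)=0\}$. There are isomorphisms $\hat H^0(A,M)\cong M^A/N_A(M)$, under which $m$ corresponds to the class of $x\mapsto\varepsilon(x)m$, and $\hat H_0(A,N)\cong{}_{N'}N/[A,N]$, under which the class of $\sum x\otimes y$ corresponds to that of $\sum\varepsilon(x)y$. A cap product for $T$ is a family of $k$-linear maps $\frown:\hat H^r(A,M)\otimes_k\hat H_s(A,N)\to\hat H_{s-r}(A,M\otimes_AN)$, for all bimodules $M,N$ and all $r,s\in\mathbb Z$, such that: (QI) for $r=s=0$, under the isomorphisms above, it is $(m+N_A(M))\otimes(n+[A,N])\mapsto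 m\otimes n+[A,M\otimes_AN]$; (QII$_1$) if $0\to M_1\to M_2\to M_3\to0$ is an exact sequence of bimodules and $0\to M_1\otimes_AN\to M_2\otimes_AN\to M_3\otimes_AN\to0$ is exact too, then $\partial(\gamma\frown\xi)=(\partial\gamma)\frown\xi$ for all $\gamma\in\hat H^r(A,M_3)$, $\xi\in\hat H_s(A,N)$; (QII$_2$) if $0\to N_1\to N_2\to N_3\to0$ is an exact sequence of bimodules and $0\to M\otimes_AN_1\to M\otimes_AN_2\to M\otimes_AN_3\to0$ is exact too, then $\partial(\gamma\frown\xi)=(-1)^r\gamma\frown(\partial\xi)$ for all $\gamma\in\hat H^r(A,M)$, $\xi\in\hat H_s(A,N_3)$. **Theorem.** $A$ has a complete resolution, and every complete resolution of $A$ has a diagonal approximation. For every complete resolution $T$ of $A$ there is exactly one cap product. For every diagonal approximation $\Delta$ on $T$, the formula $$u\frown(x\otimes n)=(-1)^{r(s-r)}\sum x'\otimes(u(x'')\otimes n)\qquad(u\in\operatorname{Hom}_{A^e}(T_r,M),\ x\in T_s,\ n\in N),$$ where $\sum x'\otimes x''$ is the component of $\Delta(x)$ in $T_{s-r}\otimes_AT_r$,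 induces a family of products in (co)homology, and this family is the cap product; so it does not depend on $\Delta$. Nor does it depend on $T$: if $T,T'$ are complete resolutions of $A$, then there are augmentation preserving chain maps $\varphi:T\to T'$, they all induce the same maps $\varphi^*:\hat H^r_{T'}(A,M)\to\hat H^r_T(A,M)$ and $\varphi_*:\hat H_s^T(A,N)\to\hat H_s^{T'}(A,N)$, these are isomorphisms, and $\varphi_*(\varphi^*\gamma\frown_T\xi)=\gamma\frown_{T'}\varphi_*\xi$ for all $\gamma\in\hat H^r_{T'}(A,M)$ and $\xi\in\hat H_s^T(A,N)$. -/

import Mathlib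

open scoped TensorProduct
open MulOpposite

universe v u

namespace TateHochschild

noncomputable section

/-- The enveloping algebra `Aᵉ = A ⊗ₖ Aᵒ`. -/
abbrev Env (k : Type v) (A : Type u) [Field k] [Ring A] [Algebra k A] : Type u :=
  A ⊗[k] Aᵐᵒᵖ

/-- An `A`-bimodule (on which `k` acts centrally), in its usual guise of a left `Aᵉ`-module:
`(a ⊗ₜ op b) • m` is `a m b`. -/
structure Bimodule (k : Type v) (A : Type u) [Field k] [Ring A] [Algebra k A] where
  carrier : Type u
  [addCommGroup : AddCommGroup carrier]
  [module : Module k carrier]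
  [envModule : Module (Env k A) carrier]
  [isScalarTower : IsScalarTower k (Env k A) carrier]

attribute [instance] Bimodule.addCommGroup Bimodule.module Bimodule.envModule
  Bimodule.isScalarTower

variable {k : Type v} {A : Type u} [Field k] [Ring A] [Algebra k A]

instance : CoeSort (Bimodule k A) (Type u) := ⟨Bimodule.carrier⟩

namespace Bimodule

/-- The bimodule given by a representation of `Aᵉ` on a vector space. -/
def ofRep (V : Type u) [AddCommGroup V] [Module k V] (φ : Env k A →ₐ[k] Module.End k V) :
    Bimodule k A :=
  letI : Module (Env k A) V := Module.compHom V φ.toRingHom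
  { carrier := V
    isScalarTower := ⟨fun c x m => by
      change φ (c • x) m = c • φ x m
      rw [map_smul, LinearMap.smul_apply]⟩ }

/-- `A` as a bimodule over itself: `(a ⊗ b) • x = a * x * b`. -/
def regular (k : Type v) (A : Type u) [Field k] [Ring A] [Algebra k A] : Bimodule k A :=
  ofRep A (AlgHom.mulLeftRight k A)

/-- An element of `A`, seen in the bimodule `A`. -/
def toRegular (a : A) : regular k A := a

/-- An element of the bimodule `A`, seen in the ring `A`. -/
def ofRegular : regular k A →ₗ[k] A := (LinearMap.id : A →ₗ[k] A)

lemma ofRegular_smul (a b : A) (x : regular k A) :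
    ofRegular ((a ⊗ₜ[k] op b : Env k A) • x) = a * ofRegular x * b :=
  AlgHom.mulLeftRight_apply k A a (op b) x

/-- The action of an element of `Aᵉ` as a `k`-linear map. -/
def act (M : Bimodule k A) (x : Env k A) : M →ₗ[k] M := Algebra.lsmul k k M x

@[simp] lemma act_apply (M : Bimodule k A) (x : Env k A) (m : M) : M.act x m = x • m := rfl

/-- Left multiplication `m ↦ a m`. -/
def left (M : Bimodule k A) (a : A) : M →ₗ[k] M := M.act (a ⊗ₜ[k] op 1)

/-- Right multiplication `m ↦ m a`. -/
def right (M : Bimodule k A) (a : A) : M →ₗ[k] M := M.act (1 ⊗ₜ[k] op a)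

lemma left_apply (M : Bimodule k A) (a : A) (m : M) :
    M.left a m = (a ⊗ₜ[k] op 1 : Env k A) • m := rfl

lemma right_apply (M : Bimodule k A) (a : A) (m : M) :
    M.right a m = (1 ⊗ₜ[k] op a : Env k A) • m := rfl

lemma left_right_apply (M : Bimodule k A) (a b : A) (m : M) :
    M.left a (M.right b m) = (a ⊗ₜ[k] op b : Env k A) • m := by
  rw [left_apply, right_apply, smul_smul, Algebra.TensorProduct.tmul_mul_tmul]
  simp

lemma left_right_comm (M : Bimodule k A) (a b : A) (m : M) :
    M.left a (M.right b m) = M.right b (M.left a m) := by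
  simp only [left_apply, right_apply, smul_smul, Algebra.TensorProduct.tmul_mul_tmul]
  simp

lemma left_mul (M : Bimodule k A) (a b : A) (m : M) :
    M.left (a * b) m = M.left a (M.left b m) := by
  simp only [left_apply, smul_smul, Algebra.TensorProduct.tmul_mul_tmul]
  simp

lemma right_mul (M : Bimodule k A) (a b : A) (m : M) :
    M.right (a * b) m = M.right b (M.right a m) := by
  simp only [right_apply, smul_smul, Algebra.TensorProduct.tmul_mul_tmul]
  simp

lemma left_add (M : Bimodule k A) (a b : A) : M.left (a + b) = M.left a + M.left b := by
  ext m
  simp [left_apply, TensorProduct.add_tmul, add_smul]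

lemma right_add (M : Bimodule k A) (a b : A) : M.right (a + b) = M.right a + M.right b := by
  ext m
  simp [right_apply, TensorProduct.tmul_add, add_smul]

lemma left_smul (M : Bimodule k A) (c : k) (a : A) : M.left (c • a) = c • M.left a := by
  ext m
  simp [left_apply, ← TensorProduct.smul_tmul', smul_assoc]

lemma right_smul (M : Bimodule k A) (c : k) (a : A) : M.right (c • a) = c • M.right a := by
  ext m
  simp [right_apply, smul_assoc]

lemma left_one (M : Bimodule k A) (m : M) : M.left 1 m = m := by
  rw [left_apply, op_one, ← Algebra.TensorProduct.one_def, one_smul]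

lemma right_one (M : Bimodule k A) (m : M) : M.right 1 m = m := by
  rw [right_apply, op_one, ← Algebra.TensorProduct.one_def, one_smul]

lemma map_left {M N : Bimodule k A} (f : M →ₗ[Env k A] N) (a : A) (m : M) :
    f (M.left a m) = N.left a (f m) := f.map_smul _ _

lemma map_right {M N : Bimodule k A} (f : M →ₗ[Env k A] N) (a : A) (m : M) :
    f (M.right a m) = N.right a (f m) := f.map_smul _ _

/-! ### The tensor product `M ⊗_A N` of bimodules -/

/-- The relations `m a ⊗ n = m ⊗ a n`. -/
def tensorRel (M N : Bimodule k A) : Submodule k (M ⊗[k] N) :=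
  Submodule.span k {z | ∃ (a : A) (m : M) (n : N), z = M.right a m ⊗ₜ[k] n - m ⊗ₜ[k] N.left a n}

/-- The vector space underlying `M ⊗_A N`. -/
abbrev TensorCarrier (M N : Bimodule k A) : Type u := (M ⊗[k] N) ⧸ tensorRel M N

/-- An endomorphism of `M ⊗_A N` induced by `f` and `g`. -/
def tensorMapAux {M N M' N' : Bimodule k A} (f : M →ₗ[k] M') (g : N →ₗ[k] N')
    (hf : ∀ a m, f (M.right a m) = M'.right a (f m))
    (hg : ∀ a n, g (N.left a n) = N'.left a (g n)) :
    TensorCarrier M N →ₗ[k] TensorCarrier M' N' :=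
  Submodule.mapQ _ _ (TensorProduct.map f g) (by
    rw [tensorRel, Submodule.span_le]
    rintro _ ⟨a, m, n, rfl⟩
    simp only [Submodule.comap_coe, Set.mem_preimage, map_sub, TensorProduct.map_tmul, hf, hg]
    exact Submodule.subset_span ⟨a, f m, g n, rfl⟩)

lemma tensor_hom_ext {M N : Bimodule k A} {V : Type*} [AddCommGroup V] [Module k V]
    {f g : TensorCarrier M N →ₗ[k] V}
    (h : ∀ m n, f (Submodule.Quotient.mk (m ⊗ₜ[k] n)) = g (Submodule.Quotient.mk (m ⊗ₜ[k] n))) :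
    f = g :=
  Submodule.linearMap_qext _ (TensorProduct.ext' h)

/-- `a (m ⊗ n) = (a m) ⊗ n`. -/
def tensorLeft (M N : Bimodule k A) : A →ₐ[k] Module.End k (TensorCarrier M N) :=
  AlgHom.ofLinearMap
    { toFun := fun a => tensorMapAux (M.left a) LinearMap.id
        (fun b m => M.left_right_comm a b m) (fun _ _ => rfl)
      map_add' := fun a b => tensor_hom_ext fun m n => by
        simp [tensorMapAux, left_add, TensorProduct.add_tmul]
      map_smul' := fun c a => tensor_hom_ext fun m n => by
        simp [tensorMapAux, left_smul, ← TensorProduct.smul_tmul'] }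
    (tensor_hom_ext fun m n => by simp [tensorMapAux, left_one])
    (fun a b => tensor_hom_ext fun m n => by simp [tensorMapAux, left_mul])

/-- `(m ⊗ n) b = m ⊗ (n b)`. -/
def tensorRight (M N : Bimodule k A) : Aᵐᵒᵖ →ₐ[k] Module.End k (TensorCarrier M N) :=
  AlgHom.ofLinearMap
    { toFun := fun b => tensorMapAux LinearMap.id (N.right b.unop)
        (fun _ _ => rfl) (fun a n => (N.left_right_comm a b.unop n).symm)
      map_add' := fun a b => tensor_hom_ext fun m n => by
        simp [tensorMapAux, right_add, TensorProduct.tmul_add]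
      map_smul' := fun c a => tensor_hom_ext fun m n => by
        simp [tensorMapAux, right_smul] }
    (tensor_hom_ext fun m n => by simp [tensorMapAux, right_one])
    (fun a b => tensor_hom_ext fun m n => by simp [tensorMapAux, right_mul])

/-- `a (m ⊗ n) b = (a m) ⊗ (n b)`. -/
def tensorRep (M N : Bimodule k A) : Env k A →ₐ[k] Module.End k (TensorCarrier M N) :=
  Algebra.TensorProduct.lift (tensorLeft M N) (tensorRight M N) fun a b =>
    tensor_hom_ext fun m n => by simp [tensorLeft, tensorRight, tensorMapAux]

/-- The bimodule `M ⊗_A N`, with `a (m ⊗ n) b = (a m) ⊗ (n b)`. -/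
def tensor (M N : Bimodule k A) : Bimodule k A := ofRep (TensorCarrier M N) (tensorRep M N)

/-- The pure tensor `m ⊗_A n`. -/
def tmul {M N : Bimodule k A} (m : M) (n : N) : tensor M N :=
  (Submodule.Quotient.mk (m ⊗ₜ[k] n) : TensorCarrier M N)

/-- The quotient map `M ⊗ₖ N → M ⊗_A N`. -/
def tensorMk (M N : Bimodule k A) : M ⊗[k] N →ₗ[k] tensor M N := (tensorRel M N).mkQ

lemma tensorMk_tmul {M N : Bimodule k A} (m : M) (n : N) :
    tensorMk M N (m ⊗ₜ[k] n) = tmul m n := rfl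

lemma tensor_ext {M N : Bimodule k A} {V : Type*} [AddCommGroup V] [Module k V]
    {f g : tensor M N →ₗ[k] V} (h : ∀ m n, f (tmul m n) = g (tmul m n)) : f = g :=
  tensor_hom_ext h

lemma smul_tmul {M N : Bimodule k A} (a b : A) (m : M) (n : N) :
    (a ⊗ₜ[k] op b : Env k A) • tmul m n = tmul (M.left a m) (N.right b n) := by
  change tensorRep M N (a ⊗ₜ[k] op b) (Submodule.Quotient.mk (m ⊗ₜ[k] n)) =
    Submodule.Quotient.mk (M.left a m ⊗ₜ[k] N.right b n)
  simp [tensorRep, tensorLeft, tensorRight, tensorMapAux]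

lemma tmul_left {M N : Bimodule k A} (a : A) (m : M) (n : N) :
    tmul m (N.left a n) = tmul (M.right a m) n :=
  ((Submodule.Quotient.eq (tensorRel M N)).2 (Submodule.subset_span ⟨a, m, n, rfl⟩)).symm

/-- A map out of `M ⊗_A N` from a balanced bilinear map. -/
def tensorLift {M N : Bimodule k A} {V : Type*} [AddCommGroup V] [Module k V]
    (f : M →ₗ[k] N →ₗ[k] V) (hf : ∀ a m n, f (M.right a m) n = f m (N.left a n)) :
    tensor M N →ₗ[k] V :=
  (tensorRel M N).liftQ (TensorProduct.lift f) (by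
    rw [tensorRel, Submodule.span_le]
    rintro _ ⟨a, m, n, rfl⟩
    simp [hf])

@[simp] lemma tensorLift_tmul {M N : Bimodule k A} {V : Type*} [AddCommGroup V] [Module k V]
    (f : M →ₗ[k] N →ₗ[k] V) (hf) (m : M) (n : N) :
    tensorLift f hf (tmul m n) = f m n := rfl

/-- The tensor product `f ⊗_A g` of two bimodule maps. -/
def tensorMap {M N M' N' : Bimodule k A} (f : M →ₗ[Env k A] M') (g : N →ₗ[Env k A] N') :
    tensor M N →ₗ[Env k A] tensor M' N' :=
  let F : tensor M N →ₗ[k] tensor M' N' :=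
    tensorMapAux (f.restrictScalars k) (g.restrictScalars k)
      (fun a m => map_right f a m) (fun a n => map_left g a n)
  { toFun := F
    map_add' := F.map_add
    map_smul' := fun x z => by
      change F (x • z) = x • F z
      induction x using TensorProduct.induction_on with
      | zero =>
        have h0 : ∀ (P : Bimodule k A) (y : P), (0 : Env k A) • y = 0 := fun P y =>
          zero_smul (Env k A) y
        exact (congrArg F (h0 _ z)).trans (F.map_zero.trans (h0 _ _).symm)
      | add x y hx hy => simp only [add_smul, map_add, hx, hy]
      | tmul a b =>
        change (F ∘ₗ (tensor M N).act (a ⊗ₜ b)) z = ((tensor M' N').act (a ⊗ₜ b) ∘ₗ F) z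
        refine LinearMap.congr_fun (tensor_ext fun m n => ?_) z
        have hF : ∀ (m : M) (n : N), F (tmul m n) = tmul (f m) (g n) := fun _ _ => rfl
        obtain ⟨b, rfl⟩ := op_surjective b
        simp only [LinearMap.comp_apply, act_apply, smul_tmul, hF, map_left, map_right] }

@[simp] lemma tensorMap_tmul {M N M' N' : Bimodule k A} (f : M →ₗ[Env k A] M')
    (g : N →ₗ[Env k A] N') (m : M) (n : N) :
    tensorMap f g (tmul m n) = tmul (f m) (g n) := rfl

/-! ### The vector space `X ⊗_{Aᵉ} N` -/

/-- The relations `x (a ⊗ b) ⊗ n = x ⊗ (a ⊗ b) n`, where `X` is viewed as a right `Aᵉ`-module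
by `x (a ⊗ b) = b x a`. -/
def envRel (X N : Bimodule k A) : Submodule k (X ⊗[k] N) :=
  Submodule.span k {z | ∃ (a b : A) (x : X) (n : N),
    z = X.left b (X.right a x) ⊗ₜ[k] n - x ⊗ₜ[k] N.left a (N.right b n)}

/-- `X ⊗_{Aᵉ} N`. -/
abbrev EnvTensor (X N : Bimodule k A) : Type u := (X ⊗[k] N) ⧸ envRel X N

/-- The pure tensor `x ⊗_{Aᵉ} n`. -/
def etmul {X N : Bimodule k A} (x : X) (n : N) : EnvTensor X N :=
  Submodule.Quotient.mk (x ⊗ₜ[k] n)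

lemma envTensor_ext {X N : Bimodule k A} {V : Type*} [AddCommGroup V] [Module k V]
    {f g : EnvTensor X N →ₗ[k] V} (h : ∀ x n, f (etmul x n) = g (etmul x n)) : f = g :=
  Submodule.linearMap_qext _ (TensorProduct.ext' h)

lemma etmul_balanced {X N : Bimodule k A} (a b : A) (x : X) (n : N) :
    etmul (X.left b (X.right a x)) n = etmul x (N.left a (N.right b n)) :=
  (Submodule.Quotient.eq _).2 (Submodule.subset_span ⟨a, b, x, n, rfl⟩)

/-- A map out of `X ⊗_{Aᵉ} N` from a balanced bilinear map. -/
def envLift {X N : Bimodule k A} {V : Type*} [AddCommGroup V] [Module k V]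
    (f : X →ₗ[k] N →ₗ[k] V)
    (hf : ∀ a b x n, f (X.left b (X.right a x)) n = f x (N.left a (N.right b n))) :
    EnvTensor X N →ₗ[k] V :=
  (envRel X N).liftQ (TensorProduct.lift f) (by
    rw [envRel, Submodule.span_le]
    rintro _ ⟨a, b, x, n, rfl⟩
    simp [hf])

@[simp] lemma envLift_etmul {X N : Bimodule k A} {V : Type*} [AddCommGroup V] [Module k V]
    (f : X →ₗ[k] N →ₗ[k] V) (hf) (x : X) (n : N) : envLift f hf (etmul x n) = f x n := rfl

/-- The map `f ⊗_{Aᵉ} g` induced by two bimodule maps. -/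
def envMap {X N X' N' : Bimodule k A} (f : X →ₗ[Env k A] X') (g : N →ₗ[Env k A] N') :
    EnvTensor X N →ₗ[k] EnvTensor X' N' :=
  Submodule.mapQ _ _ (TensorProduct.map (f.restrictScalars k) (g.restrictScalars k)) (by
    rw [envRel, Submodule.span_le]
    rintro _ ⟨a, b, x, n, rfl⟩
    simp only [Submodule.comap_coe, Set.mem_preimage, map_sub, TensorProduct.map_tmul,
      LinearMap.coe_restrictScalars, map_left, map_right]
    exact Submodule.subset_span ⟨a, b, f x, g n, rfl⟩)

@[simp] lemma envMap_etmul {X N X' N' : Bimodule k A} (f : X →ₗ[Env k A] X')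
    (g : N →ₗ[Env k A] N') (x : X) (n : N) :
    envMap f g (etmul x n) = etmul (f x) (g n) := rfl

/-- The canonical map `(X ⊗_A M) ⊗_{Aᵉ} N → X ⊗_{Aᵉ} (M ⊗_A N)`,
`(x ⊗ m) ⊗ n ↦ x ⊗ (m ⊗ n)`. -/
def envAssoc (X M N : Bimodule k A) :
    EnvTensor (tensor X M) N →ₗ[k] EnvTensor X (tensor M N) :=
  let q : X →ₗ[k] tensor M N →ₗ[k] EnvTensor X (tensor M N) :=
    (TensorProduct.mk k X (tensor M N)).compr₂ (envRel X (tensor M N)).mkQ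
  let t : M →ₗ[k] N →ₗ[k] tensor M N := (TensorProduct.mk k M N).compr₂ (tensorMk M N)
  let f : X →ₗ[k] M →ₗ[k] N →ₗ[k] EnvTensor X (tensor M N) :=
    LinearMap.mk₂ k (fun x m => q x ∘ₗ t m)
      (fun x y m => by ext n; simp) (fun c x m => by ext n; simp)
      (fun x m m' => by ext n; simp) (fun c x m => by ext n; simp)
  have hft : ∀ x m n, f x m n = etmul x (tmul m n) := fun _ _ _ => rfl
  have hf : ∀ a x m, f (X.right a x) m = f x (M.left a m) := fun a x m => by
    ext n
    have h := etmul_balanced a 1 x (tmul m n)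
    have h' : (tensor M N).left a ((tensor M N).right 1 (tmul m n)) = tmul (M.left a m) n := by
      rw [right_one, left_apply, smul_tmul, right_one]
    rw [left_one, h'] at h
    rw [hft, hft, h]
  envLift (tensorLift f hf) (fun a b z n => by
    have key : (tensorLift f hf).flip n ∘ₗ (tensor X M).left b ∘ₗ (tensor X M).right a =
        (tensorLift f hf).flip (N.left a (N.right b n)) := tensor_ext fun x m => by
      have e : (tensor X M).left b ((tensor X M).right a (tmul x m)) =
          tmul (X.left b x) (M.right a m) := by
        rw [left_right_apply, smul_tmul]
      have e' : (tensor M N).right b (tmul (M.right a m) n)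
          = tmul (M.right a m) (N.right b n) := by
        rw [right_apply, smul_tmul, left_one]
      have h := etmul_balanced 1 b x (tmul (M.right a m) n)
      rw [right_one, left_one, e'] at h
      simp only [LinearMap.comp_apply, LinearMap.flip_apply, e, tensorLift_tmul, hft]
      rw [h, tmul_left]
    exact LinearMap.congr_fun key z)

lemma envAssoc_etmul {X M N : Bimodule k A} (x : X) (m : M) (n : N) :
    envAssoc X M N (etmul (tmul x m) n) = etmul x (tmul m n) := rfl

/-- `0 → M₁ → M₂ → M₃ → 0` is a short exact sequence of bimodules. -/
def ShortExact {M₁ M₂ M₃ : Bimodule k A} (f : M₁ →ₗ[Env k A] M₂) (g : M₂ →ₗ[Env k A] M₃) : Prop :=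
  Function.Injective f ∧ Function.Exact f g ∧ Function.Surjective g

/-! ### Invariants and coinvariants -/

/-- `M^A = {m | a m = m a for all a}`. -/
def invariants (M : Bimodule k A) : Submodule k M :=
  ⨅ a : A, LinearMap.ker (M.left a - M.right a)

/-- The span of all `a m - m a`. -/
def commutators (M : Bimodule k A) : Submodule k M :=
  ⨆ a : A, LinearMap.range (M.left a - M.right a)

end Bimodule

open Bimodule

/-! ### Frobenius algebras -/

/-- A nondegenerate bilinear form on `A` with `⟨a b, c⟩ = ⟨a, b c⟩`; a finite dimensional algebra
is a Frobenius algebra if it has such a form. -/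
structure FrobeniusForm (k : Type v) (A : Type u) [Field k] [Ring A] [Algebra k A] where
  form : LinearMap.BilinForm k A
  nondegenerate : form.Nondegenerate
  assoc : ∀ a b c : A, form (a * b) c = form a (b * c)

namespace FrobeniusForm

variable [FiniteDimensional k A] (F : FrobeniusForm k A)

/-- The Nakayama automorphism `ν`, characterized by `⟨a, b⟩ = ⟨b, ν a⟩`. -/
def nakayama : A ≃ₗ[k] A :=
  (F.form.toDual F.nondegenerate).trans (F.form.flip.toDual F.nondegenerate.flip).symm

lemma form_nakayama (a b : A) : F.form b (F.nakayama a) = F.form a b := by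
  have h := LinearMap.BilinForm.apply_toDual_symm_apply (hB := F.nondegenerate.flip)
    (F.form.toDual F.nondegenerate a) b
  exact h

/-- A basis `u` of `A`. -/
def basis (k : Type v) (A : Type u) [Field k] [Ring A] [Algebra k A] [FiniteDimensional k A] :
    Module.Basis (Fin (Module.finrank k A)) k A := Module.finBasis k A

/-- The dual basis `v` of `u`: `⟨v i, u j⟩ = δ i j`. -/
def dualBasis : Module.Basis (Fin (Module.finrank k A)) k A :=
  F.form.dualBasis F.nondegenerate (basis k A)

/-- The norm map `m ↦ ∑ u i m v i` (it does not depend on the basis). -/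
def norm (M : Bimodule k A) : M →ₗ[k] M :=
  ∑ i, M.left (basis k A i) ∘ₗ M.right (F.dualBasis i)

/-- The twisted norm map `m ↦ ∑ u i m ν(v i)`, that is, the norm map of the twisted bimodule
`₁M_ν`. -/
def twistedNorm (M : Bimodule k A) : M →ₗ[k] M :=
  ∑ i, M.left (basis k A i) ∘ₗ M.right (F.nakayama (F.dualBasis i))

/-- `M^A / N_A(M)`, where `N_A(M)` is the image of the norm map. -/
abbrev InvModNorm (M : Bimodule k A) : Type u :=
  M.invariants ⧸ (LinearMap.range (F.norm M)).submoduleOf M.invariants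

/-- The kernel of the twisted norm map, modulo the span of all `a m - m a`. -/
abbrev NormKerMod (M : Bimodule k A) : Type u :=
  LinearMap.ker (F.twistedNorm M) ⧸ M.commutators.submoduleOf (LinearMap.ker (F.twistedNorm M))

end FrobeniusForm

/-! ### Complete resolutions and Tate-Hochschild (co)homology -/

/-- A complete resolution of `A` over `Aᵉ`: an exact complex `X` of finitely generated projective
bimodules, indexed by `ℤ`, whose `Aᵉ`-dual is exact, together with an augmentation
`ε : X 0 → A` that makes the part in nonnegative degrees a projective resolution of `A`. -/
structure CompleteResolution (k : Type v) (A : Type u) [Field k] [Ring A] [Algebra k A] where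
  X : ℤ → Bimodule k A
  d : ∀ i j : ℤ, j + 1 = i → (X i →ₗ[Env k A] X j)
  finite : ∀ i, Module.Finite (Env k A) (X i)
  projective : ∀ i, Module.Projective (Env k A) (X i)
  exact : ∀ (i j l : ℤ) (h : j + 1 = i) (h' : l + 1 = j), Function.Exact (d i j h) (d j l h')
  dual_exact : ∀ (i j l : ℤ) (h : j + 1 = i) (h' : l + 1 = j) (φ : X j →ₗ[Env k A] Env k A),
    φ ∘ₗ d i j h = 0 → ∃ ψ : X l →ₗ[Env k A] Env k A, ψ ∘ₗ d j l h' = φ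
  ε : X 0 →ₗ[Env k A] regular k A
  ε_surjective : Function.Surjective ε
  ε_exact : Function.Exact (d 1 0 (zero_add 1)) ε

namespace CompleteResolution

variable (T : CompleteResolution k A)

/-- The differential of the Hom complex `Hom_{Aᵉ}(X, M)` from cohomological degree `i` to
degree `j = i + 1`, with its usual sign: `u ↦ (-1)^(i+1) u ∘ d`. -/
def codiff (M : Bimodule k A) (i j : ℤ) (h : i + 1 = j) :
    (T.X i →ₗ[Env k A] M) →ₗ[k] (T.X j →ₗ[Env k A] M) where
  toFun u := ((-1 : k) ^ (i + 1)) • (u ∘ₗ T.d j i h)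
  map_add' u w := by rw [LinearMap.add_comp, smul_add]
  map_smul' c u := by rw [LinearMap.smul_comp, smul_comm, RingHom.id_apply]

/-- Cocycles of degree `r`. -/
abbrev cocycles (M : Bimodule k A) (r : ℤ) : Submodule k (T.X r →ₗ[Env k A] M) :=
  LinearMap.ker (T.codiff M r (r + 1) rfl)

/-- The Tate-Hochschild cohomology group `Ĥ^r(A, M)`. -/
abbrev Cohomology (M : Bimodule k A) (r : ℤ) : Type u :=
  T.cocycles M r ⧸
    (LinearMap.range (T.codiff M (r - 1) r (sub_add_cancel r 1))).submoduleOf (T.cocycles M r)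

/-- The class of a cocycle. -/
abbrev cohMk (M : Bimodule k A) (r : ℤ) : T.cocycles M r →ₗ[k] T.Cohomology M r := Submodule.mkQ _

/-- The differential of the complex `X ⊗_{Aᵉ} N`. -/
def diff (N : Bimodule k A) (i j : ℤ) (h : j + 1 = i) :
    EnvTensor (T.X i) N →ₗ[k] EnvTensor (T.X j) N :=
  envMap (T.d i j h) LinearMap.id

/-- Cycles of degree `s`. -/
abbrev cycles (N : Bimodule k A) (s : ℤ) : Submodule k (EnvTensor (T.X s) N) :=
  LinearMap.ker (T.diff N s (s - 1) (sub_add_cancel s 1))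

/-- The Tate-Hochschild homology group `Ĥ_s(A, N)`. -/
abbrev Homology (N : Bimodule k A) (s : ℤ) : Type u :=
  T.cycles N s ⧸ (LinearMap.range (T.diff N (s + 1) s rfl)).submoduleOf (T.cycles N s)

/-- The class of a cycle. -/
abbrev homMk (N : Bimodule k A) (s : ℤ) : T.cycles N s →ₗ[k] T.Homology N s := Submodule.mkQ _

/-! ### Connecting homomorphisms -/

/-- `∂ γ = γ'` for the connecting homomorphism `∂ : Ĥ^r(A, M₃) → Ĥ^(r+1)(A, M₁)` of the short
exact sequence `0 → M₁ → M₂ → M₃ → 0` given by `f` and `g`: some cocycle `u₃` representing `γ`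
lifts to a cochain `u₂` with values in `M₂`, and the coboundary of `u₂` comes from a cocycle
`u₁` with values in `M₁` representing `γ'`. -/
def IsCohConnecting {M₁ M₂ M₃ : Bimodule k A} (f : M₁ →ₗ[Env k A] M₂) (g : M₂ →ₗ[Env k A] M₃)
    (r : ℤ) (γ : T.Cohomology M₃ r) (γ' : T.Cohomology M₁ (r + 1)) : Prop :=
  ∃ (u₃ : T.cocycles M₃ r) (u₂ : T.X r →ₗ[Env k A] M₂) (u₁ : T.cocycles M₁ (r + 1)),
    T.cohMk M₃ r u₃ = γ ∧ T.cohMk M₁ (r + 1) u₁ = γ' ∧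
    g ∘ₗ u₂ = u₃.1 ∧ f ∘ₗ u₁.1 = T.codiff M₂ r (r + 1) rfl u₂

/-- `∂ ξ = ξ'` for the connecting homomorphism `∂ : Ĥ_i(A, N₃) → Ĥ_j(A, N₁)`, `j = i - 1`, of
the short exact sequence `0 → N₁ → N₂ → N₃ → 0` given by `f` and `g`. -/
def IsHomConnecting {N₁ N₂ N₃ : Bimodule k A} (f : N₁ →ₗ[Env k A] N₂) (g : N₂ →ₗ[Env k A] N₃)
    (i j : ℤ) (h : j + 1 = i) (ξ : T.Homology N₃ i) (ξ' : T.Homology N₁ j) : Prop :=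
  ∃ (z₃ : T.cycles N₃ i) (z₂ : EnvTensor (T.X i) N₂) (z₁ : T.cycles N₁ j),
    T.homMk N₃ i z₃ = ξ ∧ T.homMk N₁ j z₁ = ξ' ∧
    envMap LinearMap.id g z₂ = z₃.1 ∧ envMap LinearMap.id f z₁.1 = T.diff N₂ i j h z₂

/-! ### Degree zero -/

/-- The map `X_0 ⊗_{Aᵉ} N → N / [A, N]`, `x ⊗ n ↦ ε(x) n`. -/
def augHom (N : Bimodule k A) : EnvTensor (T.X 0) N →ₗ[k] N ⧸ N.commutators :=
  envLift
    (LinearMap.mk₂ k (fun x n => N.commutators.mkQ (N.left (ofRegular (T.ε x)) n))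
      (fun x y n => by
        rw [map_add, map_add, left_add, LinearMap.add_apply, map_add])
      (fun c x n => by
        have h : T.ε (c • x) = c • T.ε x := (T.ε.restrictScalars k).map_smul c x
        rw [h, map_smul, left_smul, LinearMap.smul_apply, map_smul])
      (fun x n n' => by rw [map_add, map_add]) (fun c x n => by rw [map_smul, map_smul]))
    (fun a b x n => by
      have h : ofRegular (T.ε ((T.X 0).left b ((T.X 0).right a x))) =
          b * ofRegular (T.ε x) * a := by
        rw [left_right_apply, T.ε.map_smul, ofRegular_smul]
      simp only [LinearMap.mk₂_apply, h]
      refine (Submodule.Quotient.eq _).2 ?_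
      rw [mul_assoc, left_mul, left_mul, left_right_comm N a b n, left_right_comm]
      exact Submodule.mem_iSup_of_mem b ⟨N.left (ofRegular (T.ε x)) (N.left a n), rfl⟩)

/-- The isomorphism `Ĥ^0(A, M) ≅ M^A / N_A(M)`, as a relation: the class of the cocycle
`x ↦ ε(x) m`, for `m ∈ M^A`, corresponds to `m + N_A(M)`. -/
def IsZeroCoh [FiniteDimensional k A] (F : FrobeniusForm k A) {M : Bimodule k A}
    (γ : T.Cohomology M 0) (q : F.InvModNorm M) : Prop :=
  ∃ (u : T.cocycles M 0) (m : M.invariants), T.cohMk M 0 u = γ ∧ Submodule.Quotient.mk m = q ∧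
    ∀ x, u.1 x = M.left (ofRegular (T.ε x)) m.1

/-- The isomorphism of `Ĥ_0(A, N)` with the kernel of the twisted norm map modulo `[A, N]`, as a
relation: the class of the cycle `∑ x ⊗ y` corresponds to the class of `∑ ε(x) y`. -/
def IsZeroHom [FiniteDimensional k A] (F : FrobeniusForm k A) {N : Bimodule k A}
    (ξ : T.Homology N 0) (q : F.NormKerMod N) : Prop :=
  ∃ (z : T.cycles N 0) (n : LinearMap.ker (F.twistedNorm N)), T.homMk N 0 z = ξ ∧
    Submodule.Quotient.mk n = q ∧ T.augHom N z.1 = Submodule.Quotient.mk n.1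

/-! ### Products -/

/-- A family of bilinear maps `Ĥ^r(A, M) ⊗ Ĥ_s(A, N) → Ĥ_{s-r}(A, M ⊗_A N)`, for all bimodules
`M`, `N` and all integers `r`, `s`. -/
abbrev Pairing : Type _ :=
  ∀ (M N : Bimodule k A) (r s : ℤ), T.Cohomology M r →ₗ[k] T.Homology N s →ₗ[k] T.Homology (tensor M N) (s - r)

/-- In degree zero, `c` is `(m + N_A(M)) ⊗ [n] ↦ [m ⊗ n]`. -/
def QI [FiniteDimensional k A] (F : FrobeniusForm k A) (c : T.Pairing) : Prop :=
  ∀ (M N : Bimodule k A) (γ : T.Cohomology M 0) (ξ : T.Homology N 0)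
    (m : M.invariants) (n : LinearMap.ker (F.twistedNorm N)),
    T.IsZeroCoh F γ (Submodule.Quotient.mk m) → T.IsZeroHom F ξ (Submodule.Quotient.mk n) →
    ∃ h : tmul m.1 n.1 ∈ LinearMap.ker (F.twistedNorm (tensor M N)),
      T.IsZeroHom F (c M N 0 0 γ ξ) (Submodule.Quotient.mk ⟨tmul m.1 n.1, h⟩)

/-- `∂(γ ⌢ ξ) = (∂ γ) ⌢ ξ`. -/
def QII₁ (c : T.Pairing) : Prop :=
  ∀ (M₁ M₂ M₃ N : Bimodule k A) (f : M₁ →ₗ[Env k A] M₂) (g : M₂ →ₗ[Env k A] M₃),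
    ShortExact f g →
    ShortExact (tensorMap f (LinearMap.id : N →ₗ[Env k A] N))
      (tensorMap g (LinearMap.id : N →ₗ[Env k A] N)) →
    ∀ (r s : ℤ) (γ : T.Cohomology M₃ r) (γ' : T.Cohomology M₁ (r + 1)) (ξ : T.Homology N s),
      T.IsCohConnecting f g r γ γ' →
      T.IsHomConnecting (tensorMap f (LinearMap.id : N →ₗ[Env k A] N))
        (tensorMap g (LinearMap.id : N →ₗ[Env k A] N)) (s - r) (s - (r + 1)) (by ring)
        (c M₃ N r s γ ξ) (c M₁ N (r + 1) s γ' ξ)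

/-- `∂(γ ⌢ ξ) = (-1)^r γ ⌢ (∂ ξ)`. -/
def QII₂ (c : T.Pairing) : Prop :=
  ∀ (M N₁ N₂ N₃ : Bimodule k A) (f : N₁ →ₗ[Env k A] N₂) (g : N₂ →ₗ[Env k A] N₃),
    ShortExact f g →
    ShortExact (tensorMap (LinearMap.id : M →ₗ[Env k A] M) f)
      (tensorMap (LinearMap.id : M →ₗ[Env k A] M) g) →
    ∀ (r s : ℤ) (γ : T.Cohomology M r) (ξ : T.Homology N₃ s) (ξ' : T.Homology N₁ (s - 1)),
      T.IsHomConnecting f g s (s - 1) (by ring) ξ ξ' →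
      T.IsHomConnecting (tensorMap (LinearMap.id : M →ₗ[Env k A] M) f)
        (tensorMap (LinearMap.id : M →ₗ[Env k A] M) g) (s - r) (s - 1 - r) (by ring)
        (c M N₃ r s γ ξ) (((-1 : k) ^ r) • c M N₁ r (s - 1) γ ξ')

/-- `c` has the three properties. -/
structure IsCapProduct [FiniteDimensional k A] (F : FrobeniusForm k A) (c : T.Pairing) : Prop where
  qI : T.QI F c
  qII₁ : T.QII₁ c
  qII₂ : T.QII₂ c

/-! ### Diagonal approximations -/

/-- The map `ε ⊗ ε : X_0 ⊗_A X_0 → A ⊗_A A = A`. -/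
def augAug : tensor (T.X 0) (T.X 0) →ₗ[k] A :=
  tensorLift
    ((LinearMap.mul k A).compl₁₂ (ofRegular ∘ₗ T.ε.restrictScalars k)
      (ofRegular ∘ₗ T.ε.restrictScalars k))
    (fun a x y => by
      have h₁ : ofRegular (T.ε ((T.X 0).right a x)) = ofRegular (T.ε x) * a := by
        rw [right_apply, T.ε.map_smul, ofRegular_smul, one_mul]
      have h₂ : ofRegular (T.ε ((T.X 0).left a y)) = a * ofRegular (T.ε y) := by
        rw [left_apply, T.ε.map_smul, ofRegular_smul, mul_one]
      simp [h₁, h₂, mul_assoc])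

/-- A diagonal approximation: an augmentation preserving chain map `Δ` from `X` to the complete
tensor product, whose term of degree `n` is the product of all `X_p ⊗_A X_q` with `p + q = n` and
whose differential is `d(x ⊗ y) = dx ⊗ y + (-1)^p x ⊗ dy`. A map to a product is given by its
components `Δ n p q : X_n → X_p ⊗_A X_q`. -/
structure DiagonalApproximation where
  app : ∀ n p q : ℤ, p + q = n → (T.X n →ₗ[Env k A] tensor (T.X p) (T.X q))
  comm : ∀ (n p q : ℤ) (h : p + q + 1 = n),
    tensorMap (T.d (p + 1) p rfl) LinearMap.id ∘ₗ app n (p + 1) q (by omega) +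
      ((-1 : k) ^ p) • tensorMap LinearMap.id (T.d (q + 1) q rfl) ∘ₗ app n p (q + 1) (by omega) =
    app (p + q) p q rfl ∘ₗ T.d n (p + q) h
  aug : ∀ x, T.augAug (app 0 0 0 (add_zero 0) x) = ofRegular (T.ε x)

variable {T}

/-- The cap product on chains, `u ⌢ (x ⊗ n) = (-1)^{|u| |x'|} ∑ x' ⊗ (u(x'') ⊗ n)` for a cochain
`u` of cohomological degree `r`, where `∑ x' ⊗ x''` is the component of `Δ x` in
`X_{s-r} ⊗_A X_r`. -/
def DiagonalApproximation.capChain (Δ : T.DiagonalApproximation) {M : Bimodule k A}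
    (N : Bimodule k A) {r : ℤ} (s : ℤ) (u : T.X r →ₗ[Env k A] M) :
    EnvTensor (T.X s) N →ₗ[k] EnvTensor (T.X (s - r)) (tensor M N) :=
  ((-1 : k) ^ (r * (s - r))) •
    (envAssoc (T.X (s - r)) M N ∘ₗ envMap (tensorMap LinearMap.id u) LinearMap.id ∘ₗ
      envMap (Δ.app s (s - r) r (sub_add_cancel s r)) LinearMap.id)

/-- `c` is induced by the cap product on chains that belongs to `Δ`. -/
def DiagonalApproximation.Induces (Δ : T.DiagonalApproximation) (c : T.Pairing) : Prop :=
  ∀ (M N : Bimodule k A) (r s : ℤ) (u : T.cocycles M r) (z : T.cycles N s),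
    ∃ h : Δ.capChain N s u.1 z.1 ∈ T.cycles (tensor M N) (s - r),
      c M N r s (T.cohMk M r u) (T.homMk N s z) =
        T.homMk (tensor M N) (s - r) ⟨Δ.capChain N s u.1 z.1, h⟩

variable (T)

/-! ### Change of the complete resolution -/

/-- An augmentation preserving chain map between complete resolutions of `A`. -/
structure AugMap (T T' : CompleteResolution k A) where
  app : ∀ i, T.X i →ₗ[Env k A] T'.X i
  comm : ∀ (i j : ℤ) (h : j + 1 = i), T'.d i j h ∘ₗ app i = app j ∘ₗ T.d i j h
  aug : T'.ε ∘ₗ app 0 = T.ε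

namespace AugMap

variable {T} {T' : CompleteResolution k A} (φ : AugMap T T')

/-- `φ^* : Ĥ^r(A, M) → Ĥ^r(A, M)`, from the group computed with `T'` to that computed
with `T`. -/
def cohMap (M : Bimodule k A) (r : ℤ) : T'.Cohomology M r →ₗ[k] T.Cohomology M r :=
  let p : ∀ i, (T'.X i →ₗ[Env k A] M) →ₗ[k] (T.X i →ₗ[Env k A] M) := fun i =>
    { toFun := fun u => u ∘ₗ φ.app i
      map_add' := fun u w => LinearMap.add_comp _ _ _
      map_smul' := fun c u => LinearMap.smul_comp _ _ _ }
  have hp : ∀ i j (h : i + 1 = j) (u : T'.X i →ₗ[Env k A] M),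
      T.codiff M i j h (p i u) = p j (T'.codiff M i j h u) := fun i j h u => by
    change ((-1 : k) ^ (i + 1)) • ((u ∘ₗ φ.app i) ∘ₗ T.d j i h) =
      (((-1 : k) ^ (i + 1)) • (u ∘ₗ T'.d j i h)) ∘ₗ φ.app j
    rw [LinearMap.smul_comp, LinearMap.comp_assoc, LinearMap.comp_assoc, φ.comm]
  Submodule.mapQ _ _
    ((p r).restrict fun u (hu : T'.codiff M r (r + 1) rfl u = 0) =>
      (show T.codiff M r (r + 1) rfl (p r u) = 0 by rw [hp, hu, map_zero]))
    (by
      rintro ⟨u, hu⟩ ⟨w, hw⟩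
      exact ⟨p (r - 1) w, (hp _ _ _ w).trans (congrArg (p r) hw)⟩)

/-- `φ_* : Ĥ_s(A, N) → Ĥ_s(A, N)`, from the group computed with `T` to that computed with `T'`. -/
def homMap (N : Bimodule k A) (s : ℤ) : T.Homology N s →ₗ[k] T'.Homology N s :=
  let p : ∀ i, EnvTensor (T.X i) N →ₗ[k] EnvTensor (T'.X i) N := fun i =>
    envMap (φ.app i) LinearMap.id
  have hp : ∀ i j (h : j + 1 = i) (z : EnvTensor (T.X i) N),
      T'.diff N i j h (p i z) = p j (T.diff N i j h z) := fun i j h z =>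
    LinearMap.congr_fun (f := T'.diff N i j h ∘ₗ p i) (g := p j ∘ₗ T.diff N i j h)
      (envTensor_ext fun x n => by
        change etmul ((T'.d i j h ∘ₗ φ.app i) x) n = etmul ((φ.app j ∘ₗ T.d i j h) x) n
        rw [φ.comm]) z
  Submodule.mapQ _ _
    ((p s).restrict fun z (hz : T.diff N s (s - 1) _ z = 0) =>
      (show T'.diff N s (s - 1) _ (p s z) = 0 by rw [hp, hz, map_zero]))
    (by
      rintro ⟨z, hz⟩ ⟨w, hw⟩
      exact ⟨p (s + 1) w, (hp _ _ _ w).trans (congrArg (p s) hw)⟩)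

end AugMap

end CompleteResolution

end

end TateHochschild

/-! ### One-sided linear maps -/

namespace TateHochschild

open Bimodule

/-! A Frobenius form makes averaging possible. The Casimir element satisfies `∑ a u_i ⊗ v_i = ∑ u_i
⊗ v_i a` (`FrobeniusForm.casimir`), so the trace `m ↦ ∑ u_i φ(v_i m)` of a `k`-linear map is linear
for the left action, and remains linear for the right action if `φ` was; the same holds with the
sides exchanged. By Higman's criterion, projectivity relative to one action means that the identity
is the trace of an endomorphism linear for that action, and this gives relative injectivity as well.
Over a field, a bimodule is projective exactly when it satisfies the criterion for both sides.

Hence every finite dimensional bimodule is a quotient and a subobject of a finite dimensional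
projective one, and splicing in both directions from `A` gives a complete resolution. As a one-sided
module `A` is projective and injective, so a complete resolution is contractible as a complex of
left or of right modules (`exists_contraction`). A one-sided contraction followed by a trace solves
lifting and extension problems for bimodule maps (`exists_lift`, `exists_extension`). Comparison
maps and homotopies follow, by lifting in the positive direction and extending in the negative one.

For the diagonal, each degree of the complete tensor product has infinitely many components. Those
of `Δ_0` are built outwards from `T_0 ⊗ T_0`; this starts because `d ⊗ d` on `T_0 ⊗ T_0` factors
through `ε ⊗ ε`. Then `σ ⊗ 1` contracts the whole product componentwise, which gives the positive
degrees, and extension along `d` gives the negative ones.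

On chains the cap product obeys a Leibniz rule (`diff_capChain`), which makes it descend to
(co)homology and implies QII₁ and QII₂; QI comes from `(ε ⊗ ε)Δ = ε`. Uniqueness is dimension
shifting: each bimodule fits into short exact sequences whose middle term is relatively projective,
hence has no Tate (co)homology, and which split on the side where the tensor product is formed.
Connecting homomorphisms thus reduce all degrees to `(0, 0)`. Independence of `Δ` and of `T` is a
consequence of uniqueness. -/

/-- A family indexed by `ℤ`, built in both directions from its member of index `0`. -/
theorem exists_int_seq {F : ℤ → Type*} (R : ∀ n, F n → F (n + 1) → Prop) (C : ∀ n, F n → Prop)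
    (x₀ : F 0) (h₀ : C 0 x₀) (up : ∀ n x, C n x → ∃ y, R n x y ∧ C (n + 1) y)
    (down : ∀ n y, C (n + 1) y → ∃ x, R n x y ∧ C n x) :
    ∃ x : ∀ n, F n, x 0 = x₀ ∧ ∀ n, R n (x n) (x (n + 1)) := by
  choose fu hu hu' using up
  choose fd hd hd' using down
  let a : ∀ n : ℕ, {x : F (n : ℤ) // C _ x} := fun n => Nat.rec (motive := fun n => {x : F (n : ℤ) // C _ x})
    ⟨x₀, h₀⟩ (fun n x => ⟨fu n x.1 x.2, hu' n x.1 x.2⟩) n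
  have ha : ∀ n : ℕ, R n (a n).1 (a (n + 1)).1 := fun n => hu n (a n).1 (a n).2
  -- Below zero, the index next to `Int.negSucc (n + 1)` is named `Int.negSucc n`, so the downward
  -- step is stated for any `m` with `n + 1 = m` and the relation passes through the transport `c`.
  let c : ∀ (n m : ℤ) (_ : n = m), {x : F n // C _ x} → {x : F m // C _ x} := fun n m h x => h ▸ x
  have hc : ∀ (n m : ℤ) (h : n + 1 = m) (x : {x : F m // C _ x}),
      ∃ y : {x : F n // C _ x}, ∀ h' : m = n + 1, R n y.1 (c m (n + 1) h' x).1 := by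
    rintro n m rfl x
    exact ⟨⟨fd n x.1 x.2, hd' n x.1 x.2⟩, fun _ => hd n x.1 x.2⟩
  choose fb hb using hc
  let b : ∀ n : ℕ, {x : F (Int.negSucc n) // C _ x} := fun n =>
    Nat.rec (motive := fun n => {x : F (Int.negSucc n) // C _ x})
    (fb (Int.negSucc 0) 0 rfl ⟨x₀, h₀⟩)
    (fun n x => fb (Int.negSucc (n + 1)) (Int.negSucc n) (by omega) x) n
  refine ⟨fun n => match n with
    | Int.ofNat n => (a n).1
    | Int.negSucc n => (b n).1, rfl, fun n => ?_⟩
  match n with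
  | Int.ofNat n => exact ha n
  | Int.negSucc 0 => exact hb (Int.negSucc 0) 0 rfl ⟨x₀, h₀⟩ rfl
  | Int.negSucc (n + 1) => exact hb (Int.negSucc (n + 1)) (Int.negSucc n) (by omega) (b n) rfl

variable {k : Type v} {A : Type u} [Field k] [Ring A] [Algebra k A]

/-- The product `a b` for `sd = true`, the product `b a` for `sd = false`. -/
def mulSide (sd : Bool) (a b : A) : A := cond sd (a * b) (b * a)

namespace Bimodule

/-- Left multiplication by `a` for `sd = true`, right multiplication for `sd = false`. -/
def ac (M : Bimodule k A) (sd : Bool) (a : A) : M →ₗ[k] M := cond sd (M.left a) (M.right a)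

lemma ac_mulSide (M : Bimodule k A) (sd : Bool) (a b : A) (m : M) :
    M.ac sd (mulSide sd a b) m = M.ac sd a (M.ac sd b m) := by
  cases sd
  · exact M.right_mul b a m
  · exact M.left_mul a b m

lemma ac_comm (M : Bimodule k A) (sd : Bool) (a b : A) (m : M) :
    M.ac sd a (M.ac (!sd) b m) = M.ac (!sd) b (M.ac sd a m) := by
  cases sd
  · exact (M.left_right_comm b a m).symm
  · exact M.left_right_comm a b m

lemma ac_add (M : Bimodule k A) (sd : Bool) (a b : A) : M.ac sd (a + b) = M.ac sd a + M.ac sd b := by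
  cases sd
  · exact M.right_add a b
  · exact M.left_add a b

lemma ac_smul (M : Bimodule k A) (sd : Bool) (c : k) (a : A) : M.ac sd (c • a) = c • M.ac sd a := by
  cases sd
  · exact M.right_smul c a
  · exact M.left_smul c a

lemma ac_one (M : Bimodule k A) (sd : Bool) (m : M) : M.ac sd 1 m = m := by
  cases sd
  · exact M.right_one m
  · exact M.left_one m

/-- The action as a bilinear map. -/
def acₗ (M : Bimodule k A) (sd : Bool) : A →ₗ[k] M →ₗ[k] M where
  toFun := M.ac sd
  map_add' := M.ac_add sd
  map_smul' := M.ac_smul sd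

@[simp] lemma acₗ_apply (M : Bimodule k A) (sd : Bool) (a : A) : M.acₗ sd a = M.ac sd a := rfl

/-- Linearity of a map with respect to one of the two actions of `A`. -/
def SideLinear {M N : Bimodule k A} (sd : Bool) (f : M →ₗ[k] N) : Prop :=
  ∀ a m, f (M.ac sd a m) = N.ac sd a (f m)

section

variable {M N P : Bimodule k A} {sd : Bool}

lemma sideLinear_of_hom (sd : Bool) (f : M →ₗ[Env k A] N) : SideLinear sd (f.restrictScalars k) := by
  cases sd
  · exact fun a m => map_right f a m
  · exact fun a m => map_left f a m

lemma map_ac (f : M →ₗ[Env k A] N) (sd : Bool) (a : A) (m : M) :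
    f (M.ac sd a m) = N.ac sd a (f m) := sideLinear_of_hom sd f a m

lemma SideLinear.comp {g : N →ₗ[k] P} {f : M →ₗ[k] N} (hg : SideLinear sd g) (hf : SideLinear sd f) :
    SideLinear sd (g ∘ₗ f) := fun a m => by
  rw [LinearMap.comp_apply, hf, hg, LinearMap.comp_apply]

lemma SideLinear.sub {g f : M →ₗ[k] N} (hg : SideLinear sd g) (hf : SideLinear sd f) :
    SideLinear sd (g - f) := fun a m => by
  rw [LinearMap.sub_apply, hg, hf, LinearMap.sub_apply, map_sub]

lemma SideLinear.id : SideLinear sd (LinearMap.id : M →ₗ[k] M) := fun _ _ => rfl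

lemma smul_eq_ac (M : Bimodule k A) (a b : A) (m : M) :
    (a ⊗ₜ[k] op b : Env k A) • m = M.ac true a (M.ac false b m) :=
  (M.left_right_apply a b m).symm

/-- A map that is linear with respect to both actions is a map of bimodules. -/
def homOfSides (f : M →ₗ[k] N) (h : ∀ sd, SideLinear sd f) : M →ₗ[Env k A] N where
  toFun := f
  map_add' := f.map_add
  map_smul' x m := by
    induction x using TensorProduct.induction_on with
    | zero => 
      have h₀ : ∀ (P : Bimodule k A) (p : P), (0 : Env k A) • p = 0 := fun P p =>
        zero_smul (Env k A) p
      exact (congrArg f (h₀ M m)).trans (f.map_zero.trans (h₀ N (f m)).symm)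
    | add x y hx hy =>
      rw [RingHom.id_apply] at *
      rw [add_smul, map_add, hx, hy, add_smul]
    | tmul a b =>
      obtain ⟨b, rfl⟩ := op_surjective b
      rw [RingHom.id_apply, smul_eq_ac M, smul_eq_ac N, h true, h false]

@[simp] lemma homOfSides_apply (f : M →ₗ[k] N) (h : ∀ sd, SideLinear sd f) (m : M) :
    homOfSides f h m = f m := rfl

lemma sideLinear_both (h : SideLinear sd (f : M →ₗ[k] N)) (h' : SideLinear (!sd) f) :
    ∀ sd, SideLinear sd f := by
  cases sd
  · exact fun s => by cases s <;> assumption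
  · exact fun s => by cases s <;> assumption

/-- A bimodule from commuting left and right actions. -/
lemma exists_bimodule_of_actions (V : Type u) [AddCommGroup V] [Module k V]
    (f : A →ₐ[k] Module.End k V) (g : Aᵐᵒᵖ →ₐ[k] Module.End k V) (h : ∀ a b, Commute (f a) (g b)) :
    ∃ (M : Bimodule k A) (e : V ≃ₗ[k] M), (∀ a x, M.ac true a (e x) = e (f a x)) ∧
      ∀ a x, M.ac false a (e x) = e (g (op a) x) := by
  refine ⟨ofRep V (Algebra.TensorProduct.lift f g h), LinearEquiv.refl k V, fun a x => ?_,
    fun a x => ?_⟩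
  · change Algebra.TensorProduct.lift f g h (a ⊗ₜ op 1) x = f a x
    simp
  · change Algebra.TensorProduct.lift f g h (1 ⊗ₜ op a) x = g (op a) x
    simp

end

lemma ofRegular_ac (sd : Bool) (a : A) (x : regular k A) :
    ofRegular ((regular k A).ac sd a x) = mulSide sd a (ofRegular x) := by
  cases sd
  · exact (ofRegular_smul 1 a x).trans (by rw [one_mul]; rfl)
  · exact (ofRegular_smul a 1 x).trans (by rw [mul_one]; rfl)

/-- `M` with one action of `A` as a representation of `A` or its opposite on `A ⊗ M`. -/
lemma exists_induced (sd : Bool) (M : Bimodule k A) :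
    ∃ (I : Bimodule k A) (t : A →ₗ[k] M →ₗ[k] I),
      (∀ a x m, I.ac sd a (t x m) = t (mulSide sd a x) m) ∧
      (∀ a x m, I.ac (!sd) a (t x m) = t x (M.ac (!sd) a m)) ∧
      (∀ (P : Bimodule k A) (f : A →ₗ[k] M →ₗ[k] P), ∃ F : I →ₗ[k] P, ∀ x m, F (t x m) = f x m) ∧
      (∀ (P : Bimodule k A) (f g : I →ₗ[k] P), (∀ x m, f (t x m) = g (t x m)) → f = g) ∧
      ∀ [Module.Finite k A] [Module.Finite k M], Module.Finite k I := by
  -- The space is `A ⊗ M`, induced from `M` with its other action: the chosen side multiplies in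
  -- `A`, the other acts on `M`. The two actions commute because they touch different factors.
  have key : ∃ (I : Bimodule k A) (e : (A ⊗[k] M) ≃ₗ[k] I),
      (∀ a x m, I.ac sd a (e (x ⊗ₜ m)) = e (mulSide sd a x ⊗ₜ m)) ∧
      (∀ a x m, I.ac (!sd) a (e (x ⊗ₜ m)) = e (x ⊗ₜ M.ac (!sd) a m)) := by
    have hcomm : ∀ (f : Module.End k A) (g : Module.End k M),
        Commute (Module.End.rTensorAlgHom k A M f) (Module.End.lTensorAlgHom k M A g) := fun f g =>
      (LinearMap.rTensor_comp_lTensor (M := A) f g).trans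
        (LinearMap.lTensor_comp_rTensor (M := A) f g).symm
    cases sd
    · obtain ⟨I, e, h₁, h₂⟩ := exists_bimodule_of_actions (k := k) (A := A) (A ⊗[k] M)
        ((Module.End.lTensorAlgHom k M A).comp
          ((Algebra.lsmul k k M).comp Algebra.TensorProduct.includeLeft))
        ((Module.End.rTensorAlgHom k A M).comp
          ((AlgHom.mulLeftRight k A).comp Algebra.TensorProduct.includeRight))
        (fun a b => hcomm (AlgHom.mulLeftRight k A (1 ⊗ₜ b)) (Algebra.lsmul k k M (a ⊗ₜ 1 : Env k A)) |>.symm)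
      refine ⟨I, e, fun a x m => ?_, fun a x m => ?_⟩
      · refine (h₂ _ _).trans (congrArg e ?_)
        change AlgHom.mulLeftRight k A (1 ⊗ₜ op a) x ⊗ₜ[k] m = _
        simp [mulSide]
      · exact h₁ _ _
    · obtain ⟨I, e, h₁, h₂⟩ := exists_bimodule_of_actions (k := k) (A := A) (A ⊗[k] M)
        ((Module.End.rTensorAlgHom k A M).comp (Algebra.lmul k A))
        ((Module.End.lTensorAlgHom k M A).comp
          ((Algebra.lsmul k k M).comp Algebra.TensorProduct.includeRight))
        (fun a b => hcomm (Algebra.lmul k A a) (Algebra.lsmul k k M (1 ⊗ₜ b : Env k A)))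
      refine ⟨I, e, fun a x m => ?_, fun a x m => ?_⟩
      · exact h₁ _ _
      · exact h₂ _ _
  obtain ⟨I, e, h₁, h₂⟩ := key
  refine ⟨I, (TensorProduct.mk k A M).compr₂ e.toLinearMap, h₁, h₂, fun P f =>
    ⟨TensorProduct.lift f ∘ₗ e.symm.toLinearMap, fun x m => by simp⟩, fun P f g h => ?_,
    Module.Finite.equiv e⟩
  have : f ∘ₗ e.toLinearMap = g ∘ₗ e.toLinearMap := TensorProduct.ext' h
  ext x
  obtain ⟨y, rfl⟩ := e.surjective x
  exact LinearMap.congr_fun this y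

end Bimodule

end TateHochschild

/-! ### Casimir elements and relative projectivity -/

namespace TateHochschild

open Bimodule

variable {k : Type v} {A : Type u} [Field k] [Ring A] [Algebra k A]

namespace FrobeniusForm

variable (F : FrobeniusForm k A)

/-- The linear form `⟨-, 1⟩`. -/
noncomputable def lam : A →ₗ[k] k := F.form.flip 1

lemma lam_mul (a b : A) : F.lam (a * b) = F.form a b := by
  change F.form (a * b) 1 = _
  rw [F.assoc, mul_one]

variable [FiniteDimensional k A]

lemma form_dualBasis (i j : Fin (Module.finrank k A)) :
    F.form (F.dualBasis i) (basis k A j) = if j = i then 1 else 0 :=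
  LinearMap.BilinForm.apply_dualBasis_left F.nondegenerate (basis k A) i j

/-- Pairing with `v_i` reads off the coefficient at `u_i`; the next lemma is the mirror image. -/
lemma sum_form_smul_basis (a : A) : ∑ i, F.form (F.dualBasis i) a • basis k A i = a := by
  conv_rhs => rw [← (basis k A).sum_repr a]
  refine Finset.sum_congr rfl fun i _ => congrArg (· • _) ?_
  conv_lhs => rw [← (basis k A).sum_repr a]
  simp only [map_sum, map_smul, form_dualBasis, smul_eq_mul, mul_ite, mul_one, mul_zero,
    Finset.sum_ite_eq', Finset.mem_univ, if_true]

lemma sum_form_smul_dualBasis (a : A) : ∑ i, F.form a (basis k A i) • F.dualBasis i = a := by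
  conv_rhs => rw [← F.dualBasis.sum_repr a]
  refine Finset.sum_congr rfl fun i _ => congrArg (· • _) ?_
  conv_lhs => rw [← F.dualBasis.sum_repr a]
  simp only [map_sum, map_smul, LinearMap.sum_apply, LinearMap.smul_apply, form_dualBasis,
    smul_eq_mul, mul_ite, mul_one, mul_zero, Finset.sum_ite_eq, Finset.mem_univ, if_true]

/-- The first factors of the Casimir element for the given side. -/
noncomputable def uu (sd : Bool) (i : Fin (Module.finrank k A)) : A := cond sd (basis k A i) (F.dualBasis i)

/-- The second factors of the Casimir element for the given side. -/
noncomputable def vv (sd : Bool) (i : Fin (Module.finrank k A)) : A := cond sd (F.dualBasis i) (basis k A i)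

lemma sum_lam_smul_uu (sd : Bool) (a : A) : ∑ i, F.lam (mulSide sd (F.vv sd i) a) • F.uu sd i = a := by
  cases sd
  · simpa [mulSide, vv, uu, lam_mul] using F.sum_form_smul_dualBasis a
  · simpa [mulSide, vv, uu, lam_mul] using F.sum_form_smul_basis a

lemma sum_lam_smul_vv (sd : Bool) (a : A) : ∑ i, F.lam (mulSide sd a (F.uu sd i)) • F.vv sd i = a := by
  cases sd
  · simpa [mulSide, vv, uu, lam_mul] using F.sum_form_smul_basis a
  · simpa [mulSide, vv, uu, lam_mul] using F.sum_form_smul_dualBasis a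

/-- Expand `a u_i` in the basis `u` and `v_i a` in the basis `v`. The coefficients `⟨v_j, a u_i⟩`
and `⟨v_j a, u_i⟩` agree by associativity of the form, so both sides are the same double sum. -/
lemma casimir_basis {V : Type*} [AddCommGroup V] [Module k V] (β : A →ₗ[k] A →ₗ[k] V) (a : A) :
    ∑ i, β (a * basis k A i) (F.dualBasis i) = ∑ i, β (basis k A i) (F.dualBasis i * a) := by
  have h₁ : ∀ i, β (a * basis k A i) (F.dualBasis i) = ∑ j,
      F.form (F.dualBasis j) (a * basis k A i) • β (basis k A j) (F.dualBasis i) := fun i => by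
    conv_lhs => rw [← F.sum_form_smul_basis (a * basis k A i)]
    simp
  have h₂ : ∀ i, β (basis k A i) (F.dualBasis i * a) = ∑ j,
      F.form (F.dualBasis i * a) (basis k A j) • β (basis k A i) (F.dualBasis j) := fun i => by
    conv_lhs => rw [← F.sum_form_smul_dualBasis (F.dualBasis i * a)]
    simp
  simp only [h₁, h₂, F.assoc]
  exact Finset.sum_comm

/-- On the right the dual bases exchange their roles, and the identity is the left one for the
flipped bilinear map. -/
lemma casimir (sd : Bool) {V : Type*} [AddCommGroup V] [Module k V] (β : A →ₗ[k] A →ₗ[k] V)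
    (a : A) : ∑ i, β (mulSide sd a (F.uu sd i)) (F.vv sd i) =
      ∑ i, β (F.uu sd i) (mulSide sd (F.vv sd i) a) := by
  cases sd
  · exact (F.casimir_basis β.flip a).symm
  · exact F.casimir_basis β a

variable {M N P Q : Bimodule k A} (sd : Bool)

/-- The trace `m ↦ ∑ u i φ(v i m)` of a linear map for the left action of `A`, and
`m ↦ ∑ φ(m u i) v i` for the right action. -/
noncomputable def tr (φ : M →ₗ[k] N) : M →ₗ[k] N := ∑ i, N.ac sd (F.uu sd i) ∘ₗ φ ∘ₗ M.ac sd (F.vv sd i)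

lemma tr_apply (φ : M →ₗ[k] N) (m : M) :
    F.tr sd φ m = ∑ i, N.ac sd (F.uu sd i) (φ (M.ac sd (F.vv sd i) m)) := by
  simp [tr, LinearMap.sum_apply]

/-- This is the Casimir identity for the bilinear map `(x, y) ↦ x φ(y m)`. -/
lemma sideLinear_tr (φ : M →ₗ[k] N) : SideLinear sd (F.tr sd φ) := fun a m => by
  have h := F.casimir sd (V := N) (LinearMap.mk₂ k (fun x y => N.ac sd x (φ (M.ac sd y m)))
    (fun x y z => by simp [ac_add]) (fun c x y => by simp [ac_smul])
    (fun x y z => by simp [ac_add]) (fun c x y => by simp [ac_smul])) a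
  simp only [LinearMap.mk₂_apply, ac_mulSide] at h
  rw [tr_apply, tr_apply, ← h, map_sum]

lemma sideLinear_not_tr {φ : M →ₗ[k] N} (h : SideLinear (!sd) φ) : SideLinear (!sd) (F.tr sd φ) :=
  fun a m => by
    simp only [tr_apply, map_sum]
    exact Finset.sum_congr rfl fun i _ => by rw [ac_comm, h, ac_comm]

/-- With `tr_comp`, this is the mechanism of every averaging argument below: a solution over `k`,
composed with a map of trace `1` and traced, becomes an `A`-linear solution. -/
lemma comp_tr {ψ : N →ₗ[k] P} (h : SideLinear sd ψ) (φ : M →ₗ[k] N) :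
    ψ ∘ₗ F.tr sd φ = F.tr sd (ψ ∘ₗ φ) := by
  ext m
  simp only [LinearMap.comp_apply, tr_apply, map_sum]
  exact Finset.sum_congr rfl fun i _ => h _ _

lemma tr_comp {ψ : P →ₗ[k] M} (h : SideLinear sd ψ) (φ : M →ₗ[k] N) :
    F.tr sd φ ∘ₗ ψ = F.tr sd (φ ∘ₗ ψ) := by
  ext m
  simp only [LinearMap.comp_apply, tr_apply]
  exact Finset.sum_congr rfl fun i _ => by rw [← h]

/-- The bimodule map given by the trace of a map that is linear for the other action. -/
noncomputable def trHom (φ : M →ₗ[k] N) (h : SideLinear (!sd) φ) : M →ₗ[Env k A] N :=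
  homOfSides (F.tr sd φ) (sideLinear_both (F.sideLinear_tr sd φ) (F.sideLinear_not_tr sd h))

/-- Projectivity relative to the other action, by Higman's criterion. -/
def RelProjective (M : Bimodule k A) : Prop :=
  ∃ h : M →ₗ[k] M, SideLinear (!sd) h ∧ F.tr sd h = LinearMap.id

variable {F sd}

/-- If `t` has trace the identity, then so does `p t j`. -/
lemma RelProjective.of_retract (hM : F.RelProjective sd M) (j : N →ₗ[Env k A] M)
    (p : M →ₗ[Env k A] N) (h : ∀ n, p (j n) = n) : F.RelProjective sd N := by
  obtain ⟨t, ht, ht'⟩ := hM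
  refine ⟨p.restrictScalars k ∘ₗ t ∘ₗ j.restrictScalars k,
    (sideLinear_of_hom _ p).comp (ht.comp (sideLinear_of_hom _ j)), ?_⟩
  rw [← F.comp_tr sd (sideLinear_of_hom _ p), ← F.tr_comp sd (sideLinear_of_hom _ j), ht']
  ext n
  exact h n

variable (F sd)

/-- The map `x ↦ ⟨x, 1⟩ 1` has trace `x ↦ ∑ λ(v_i x) u_i = x`. Thus `A` is projective and injective
as a one-sided module, which is what anchors the contraction at `ε`. -/
lemma exists_trace_regular : ∃ h : regular k A →ₗ[k] regular k A, F.tr sd h = LinearMap.id := by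
  refine ⟨(F.lam ∘ₗ ofRegular).smulRight (toRegular 1), ?_⟩
  ext x
  rw [tr_apply]
  change ∑ i, ((regular k A).ac sd (F.uu sd i)) (F.lam (ofRegular ((regular k A).ac sd (F.vv sd i) x)) • toRegular 1) = x
  have h : ∀ i, ((regular k A).ac sd (F.uu sd i))
      (F.lam (ofRegular ((regular k A).ac sd (F.vv sd i) x)) • toRegular 1) =
      (F.lam (mulSide sd (F.vv sd i) (ofRegular x)) • F.uu sd i : A) := fun i => by
    rw [ofRegular_ac, map_smul]
    have h₁ : (regular k A).ac sd (F.uu sd i) (toRegular 1) = F.uu sd i := by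
      refine (ofRegular_ac sd (F.uu sd i) (toRegular 1)).trans ?_
      cases sd
      · exact one_mul _
      · exact mul_one _
    rw [h₁]
    rfl
  simp only [h]
  exact F.sum_lam_smul_uu sd (ofRegular x)

/-- Each bimodule is a quotient and a subobject of a relatively projective bimodule, by maps that
split with respect to the other action. -/
lemma exists_relProjective (M : Bimodule k A) :
    ∃ (I : Bimodule k A) (p : I →ₗ[Env k A] M) (j : M →ₗ[Env k A] I) (s : M →ₗ[k] I)
      (q : I →ₗ[k] M), F.RelProjective sd I ∧ SideLinear (!sd) s ∧ SideLinear (!sd) q ∧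
      (∀ m, p (s m) = m) ∧ (∀ m, q (j m) = m) ∧ (Module.Finite k M → Module.Finite k I) ∧
      (F.RelProjective (!sd) M → F.RelProjective (!sd) I) := by
  obtain ⟨I, t, ht, ht', lift, ext, fin⟩ := exists_induced sd M
  obtain ⟨p, hp⟩ := lift M (M.acₗ sd)
  obtain ⟨q, hq⟩ := lift M (LinearMap.lsmul k M ∘ₗ F.lam)
  -- Here `p` multiplies, `q` applies `λ` to the first factor, and `h` sends `x ⊗ m` to `λ(x) (1 ⊗
  -- m)`; the dual basis expansion shows that `h` has trace the identity.
  obtain ⟨h, hh⟩ := lift I (((t 1).lcomp k I).flip.flip ∘ₗ LinearMap.lsmul k I ∘ₗ F.lam)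
  simp only [acₗ_apply] at hp
  replace hq : ∀ x m, q (t x m) = F.lam x • m := hq
  replace hh : ∀ x m, h (t x m) = F.lam x • t 1 m := hh
  have lin : ∀ (b : Bool) {P : Bimodule k A} (f : I →ₗ[k] P)
      (_ : ∀ a x m, f (I.ac b a (t x m)) = P.ac b a (f (t x m))), SideLinear b f :=
    fun b P f h a m => LinearMap.congr_fun (f := f ∘ₗ I.ac b a) (g := P.ac b a ∘ₗ f)
      (ext P _ _ fun x m => h a x m) m
  have hp' : SideLinear sd p := lin _ p fun a x m => by rw [ht, hp, hp, ac_mulSide]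
  have hp'' : SideLinear (!sd) p := lin _ p fun a x m => by rw [ht', hp, hp, ac_comm]
  -- The embedding inserts the Casimir element, whose symmetry makes it linear for the traced side.
  -- It is split by `q` because `∑ λ(u_i) v_i = 1`.
  let j : M →ₗ[k] I := ∑ i, t (F.uu sd i) ∘ₗ M.ac sd (F.vv sd i)
  have hj : ∀ m, j m = ∑ i, t (F.uu sd i) (M.ac sd (F.vv sd i) m) := fun m => by
    simp [j, LinearMap.sum_apply]
  have hj' : SideLinear sd j := fun a m => by
    have h := F.casimir sd (t.compl₂ ((M.acₗ sd).flip m)) a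
    simp only [LinearMap.compl₂_apply, LinearMap.flip_apply, acₗ_apply, ac_mulSide] at h
    simp only [hj, map_sum, ht, h]
  have hj'' : SideLinear (!sd) j := fun a m => by
    simp only [hj, map_sum, ht', ac_comm]
  refine ⟨I, homOfSides p (sideLinear_both hp' hp''), homOfSides j (sideLinear_both hj' hj''),
    t 1, q, ⟨h, lin _ h fun a x m => by rw [ht', hh, hh, map_smul, ht'], ?_⟩,
    fun a m => (ht' a 1 m).symm, lin _ q fun a x m => by rw [ht', hq, hq, map_smul],
    fun m => ?_, fun m => ?_, fun _ => fin, ?_⟩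
  · refine ext I _ _ fun x m => ?_
    have h₁ : ∀ a, t (mulSide sd a 1) = t a := fun a => by cases sd <;> simp [mulSide]
    simp only [tr_apply, ht, hh, map_smul, h₁]
    conv_rhs => rw [LinearMap.id_apply, ← F.sum_lam_smul_uu sd x]
    simp
  · rw [homOfSides_apply, hp, ac_one]
  · rw [homOfSides_apply, hj, map_sum]
    simp only [hq]
    have h := F.sum_lam_smul_vv sd 1
    have h₁ : ∀ a : A, mulSide sd 1 a = a := fun a => by cases sd <;> simp [mulSide]
    simp only [h₁] at h
    conv_rhs => rw [← M.ac_one sd m, ← h]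
    rw [← acₗ_apply, map_sum, LinearMap.sum_apply]
    simp
  -- A Higman endomorphism `g` of `M` for the other side induces `1 ⊗ g` on `A ⊗ M`.
  · rintro ⟨g, hg, hg'⟩
    rw [Bool.not_not] at hg
    obtain ⟨g₂, hg₂⟩ := lift I (t.compl₂ g)
    simp only [LinearMap.compl₂_apply] at hg₂
    refine ⟨g₂, ?_, ext I _ _ fun x m => ?_⟩
    · rw [Bool.not_not]
      exact lin _ g₂ fun a x m => by rw [ht, hg₂, hg₂, ht]
    · simp only [tr_apply, ht', hg₂]
      rw [← map_sum, ← tr_apply, hg']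
      rfl

/-- The surjection from the induced bimodule splits, so `M` is a retract of a relatively projective
bimodule. -/
lemma relProjective_of_projective (M : Bimodule k A) [Module.Projective (Env k A) M] :
    F.RelProjective sd M := by
  obtain ⟨I, p, j, s, q, hI, -, -, hp, -⟩ := F.exists_relProjective sd M
  obtain ⟨t, ht⟩ := Module.projective_lifting_property p LinearMap.id fun m => ⟨s m, hp m⟩
  exact hI.of_retract t p fun m => LinearMap.congr_fun ht m

variable {F}

/-- Start with a `k`-linear section of a free cover and average twice: the right trace, with `g`,
makes it right linear, and the left trace, with the right linear `h`, then makes it a bimodule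
section. -/
lemma projective_of_relProjective (hl : F.RelProjective true M) (hr : F.RelProjective false M) :
    Module.Projective (Env k A) M := by
  obtain ⟨h, hh, h1⟩ := hl
  obtain ⟨g, hg, g1⟩ := hr
  let p := Finsupp.linearCombination (Env k A) (id : M → M)
  obtain ⟨s, hs⟩ := LinearMap.exists_rightInverse_of_surjective (p.restrictScalars k)
    (LinearMap.range_eq_top.2 (Finsupp.linearCombination_id_surjective (Env k A) M))
  let I : Bimodule k A := ⟨M →₀ Env k A⟩
  let p' : I →ₗ[Env k A] M := p
  let s' : M →ₗ[k] I := s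
  have hs' : p'.restrictScalars k ∘ₗ s' = LinearMap.id := hs
  have e := F.sideLinear_tr false (s' ∘ₗ g)
  refine ⟨⟨F.trHom true (F.tr false (s' ∘ₗ g) ∘ₗ h) (e.comp hh), fun m => ?_⟩⟩
  have := F.comp_tr true (sideLinear_of_hom _ p') (F.tr false (s' ∘ₗ g) ∘ₗ h)
  rw [← LinearMap.comp_assoc, F.comp_tr false (sideLinear_of_hom _ p'), ← LinearMap.comp_assoc, hs',
    LinearMap.id_comp, g1, LinearMap.id_comp, h1] at this
  exact LinearMap.congr_fun this m

end FrobeniusForm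

end TateHochschild

/-! ### Existence of complete resolutions -/

namespace TateHochschild

open Bimodule

variable {k : Type v} {A : Type u} [Field k] [Ring A] [Algebra k A]

namespace Bimodule

lemma exists_kernel {P K : Bimodule k A} (f : P →ₗ[Env k A] K) :
    ∃ (K' : Bimodule k A) (i : K' →ₗ[Env k A] P), Function.Injective i ∧ Function.Exact i f ∧
      (Module.Finite k P → Module.Finite k K') := by
  refine ⟨⟨LinearMap.ker f⟩, (LinearMap.ker f).subtype, Subtype.val_injective,
    LinearMap.exact_subtype_ker_map f, fun h => ?_⟩
  exact Module.Finite.of_injective ((LinearMap.ker f).subtype.restrictScalars k)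
    Subtype.val_injective

lemma exists_cokernel {P K : Bimodule k A} (f : K →ₗ[Env k A] P) :
    ∃ (Q : Bimodule k A) (p : P →ₗ[Env k A] Q), Function.Surjective p ∧ Function.Exact f p ∧
      (Module.Finite k P → Module.Finite k Q) := by
  let R : Submodule (Env k A) P := LinearMap.range f
  let Q : Bimodule k A := ⟨P ⧸ R⟩
  let p : P →ₗ[Env k A] Q := R.mkQ
  have hp : Function.Surjective p := R.mkQ_surjective
  refine ⟨Q, p, hp, fun x => ?_, fun h => Module.Finite.of_surjective (p.restrictScalars k) hp⟩
  exact (Submodule.Quotient.mk_eq_zero R).trans LinearMap.mem_range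

end Bimodule

/-! ### Lifting and extending linear maps of vector spaces -/

section

variable {V W U : Type*} [AddCommGroup V] [Module k V] [AddCommGroup W] [Module k W]
  [AddCommGroup U] [Module k U]

lemma exists_linear_lift (g : V →ₗ[k] W) (f : U →ₗ[k] W) (h : ∀ x, ∃ y, g y = f x) :
    ∃ f' : U →ₗ[k] V, ∀ x, g (f' x) = f x := by
  obtain ⟨s, hs⟩ := LinearMap.exists_rightInverse_of_surjective g.rangeRestrict
    g.range_rangeRestrict
  refine ⟨s ∘ₗ f.codRestrict (LinearMap.range g) h, fun x => ?_⟩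
  exact congrArg Subtype.val (LinearMap.congr_fun hs (f.codRestrict (LinearMap.range g) h x))

lemma exists_linear_extension (g : V →ₗ[k] W) (f : V →ₗ[k] U) (h : ∀ x, g x = 0 → f x = 0) :
    ∃ f' : W →ₗ[k] U, ∀ x, f' (g x) = f x := by
  obtain ⟨s, hs⟩ := LinearMap.exists_rightInverse_of_surjective g.rangeRestrict
    g.range_rangeRestrict
  obtain ⟨f', hf'⟩ := LinearMap.exists_extend (f ∘ₗ s)
  refine ⟨f', fun x => ?_⟩
  have h₁ := LinearMap.congr_fun hf' (g.rangeRestrict x)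
  have h₂ : g (s (g.rangeRestrict x)) = g x :=
    congrArg Subtype.val (LinearMap.congr_fun hs (g.rangeRestrict x))
  refine h₁.trans (sub_eq_zero.1 ?_)
  rw [LinearMap.comp_apply, ← map_sub]
  exact h _ (by rw [map_sub, h₂, sub_self])

end

namespace CompleteResolution

variable (T : CompleteResolution k A)

lemma d_d (i j l : ℤ) (h : j + 1 = i) (h' : l + 1 = j) (x : T.X i) :
    T.d j l h' (T.d i j h x) = 0 := (T.exact i j l h h' _).2 ⟨x, rfl⟩

lemma d_comp_d (i j l : ℤ) (h : j + 1 = i) (h' : l + 1 = j) : T.d j l h' ∘ₗ T.d i j h = 0 :=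
  LinearMap.ext (T.d_d i j l h h')

lemma ε_d (x : T.X 1) : T.ε (T.d 1 0 (zero_add 1) x) = 0 := (T.ε_exact _).2 ⟨x, rfl⟩

/-- Both kernels are the image of `T_1`. So `A` embeds in `T_{-1}`, the fact that starts all
constructions in negative degrees. -/
lemma d_eq_zero_iff (x : T.X 0) : T.d 0 (-1) (by norm_num) x = 0 ↔ T.ε x = 0 := by
  rw [T.ε_exact x, T.exact 1 0 (-1) _ _ x]

end CompleteResolution

variable [FiniteDimensional k A]

namespace FrobeniusForm

variable (F : FrobeniusForm k A) (sd : Bool) {M N P : Bimodule k A}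

/-- One-sided projectivity: lift `f` to a `k`-linear `s` and take the trace of `s t`. Then `g tr(s
t) = tr(f t) = f tr(t) = f`. -/
lemma exists_sideLinear_lift (g : N →ₗ[Env k A] P) {f : M →ₗ[k] P} (hf : SideLinear sd f)
    (h : ∀ x, ∃ y, g y = f x) {t : M →ₗ[k] M} (ht : F.tr sd t = LinearMap.id) :
    ∃ f' : M →ₗ[k] N, SideLinear sd f' ∧ ∀ x, g (f' x) = f x := by
  obtain ⟨s, hs⟩ := exists_linear_lift (g.restrictScalars k) f h
  refine ⟨F.tr sd (s ∘ₗ t), F.sideLinear_tr sd _, fun x => ?_⟩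
  have h₁ : g.restrictScalars k ∘ₗ s = f := LinearMap.ext hs
  have := F.comp_tr sd (sideLinear_of_hom sd g) (s ∘ₗ t)
  rw [← LinearMap.comp_assoc, h₁, ← F.comp_tr sd hf, ht] at this
  exact LinearMap.congr_fun this x

/-- One-sided injectivity, by the dual computation with the trace of `t s`. -/
lemma exists_sideLinear_extension (g : N →ₗ[Env k A] P) {f : N →ₗ[k] M} (hf : SideLinear sd f)
    (h : ∀ x, g x = 0 → f x = 0) {t : M →ₗ[k] M} (ht : F.tr sd t = LinearMap.id) :
    ∃ f' : P →ₗ[k] M, SideLinear sd f' ∧ ∀ x, f' (g x) = f x := by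
  obtain ⟨s, hs⟩ := exists_linear_extension (g.restrictScalars k) f h
  refine ⟨F.tr sd (t ∘ₗ s), F.sideLinear_tr sd _, fun x => ?_⟩
  have h₁ : s ∘ₗ g.restrictScalars k = f := LinearMap.ext hs
  have := F.tr_comp sd (sideLinear_of_hom sd g) (t ∘ₗ s)
  rw [LinearMap.comp_assoc, h₁, ← F.tr_comp sd hf, ht] at this
  exact LinearMap.congr_fun this x

/-- An exact complex of relatively projective bimodules that contains a resolution of `A` is
contractible as a complex of one-sided modules. -/
theorem exists_contraction (X : ℤ → Bimodule k A) (d : ∀ i j : ℤ, j + 1 = i → (X i →ₗ[Env k A] X j))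
    (hX : ∀ i, F.RelProjective sd (X i))
    (exact : ∀ (i j l : ℤ) (h : j + 1 = i) (h' : l + 1 = j), Function.Exact (d i j h) (d j l h'))
    (ε : X 0 →ₗ[Env k A] regular k A) (hε : Function.Surjective ε)
    (hε' : Function.Exact (d 1 0 (zero_add 1)) ε) :
    ∃ σ : ∀ i j : ℤ, i + 1 = j → (X i →ₗ[k] X j), (∀ i j h, SideLinear sd (σ i j h)) ∧
      ∀ (i j l : ℤ) (h : j + 1 = i) (h' : l + 1 = j) (x : X j),
        d i j h (σ j i h x) + σ l j h' (d j l h' x) = x := by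
  choose t ht ht' using hX
  obtain ⟨t₀, ht₀⟩ := F.exists_trace_regular sd
  -- A one-sided section `s` of `ε`, and a one-sided `ρ : X_{-1} → A` with `ρ d = ε`; both exist
  -- because `A` is one-sidedly projective and injective.
  obtain ⟨s, hs, hs'⟩ := F.exists_sideLinear_lift sd ε (SideLinear.id (sd := sd))
    (fun x => hε x) ht₀
  obtain ⟨ρ, hρ, hρ'⟩ := F.exists_sideLinear_extension sd (d 0 (-1) (by norm_num))
    (sideLinear_of_hom sd ε) (fun x hx => (hε' x).2 ((exact 1 0 (-1) _ _ x).1 hx)) ht₀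
  have hdd : ∀ (i j l : ℤ) (h : j + 1 = i) (h' : l + 1 = j) x, d j l h' (d i j h x) = 0 :=
    fun i j l h h' x => (exact i j l h h' _).2 ⟨x, rfl⟩
  have up : ∀ n (f : {f : X n →ₗ[k] X (n + 1) // SideLinear sd f}),
      (∀ x : X (n + 1), d (n + 1) n rfl (f.1 (d (n + 1) n rfl x)) = d (n + 1) n rfl x) →
      ∃ g : {f : X (n + 1) →ₗ[k] X (n + 1 + 1) // SideLinear sd f},
        ∀ x, d (n + 1 + 1) (n + 1) rfl (g.1 x) + f.1 (d (n + 1) n rfl x) = x := by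
    intro n f hf
    obtain ⟨g, hg, hg'⟩ := F.exists_sideLinear_lift sd (d (n + 1 + 1) (n + 1) rfl)
      (f := LinearMap.id - f.1 ∘ₗ (d (n + 1) n rfl).restrictScalars k)
      (SideLinear.id.sub (f.2.comp (sideLinear_of_hom sd _))) (fun x => by
        refine (exact _ _ n rfl rfl _).1 ?_
        simp [hf]) (ht' (n + 1))
    exact ⟨⟨g, hg⟩, fun x => by simp [hg']⟩
  have cond : ∀ n (f : {f : X n →ₗ[k] X (n + 1) // SideLinear sd f})
      (g : {f : X (n + 1) →ₗ[k] X (n + 1 + 1) // SideLinear sd f}),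
      (∀ x, d (n + 1 + 1) (n + 1) rfl (g.1 x) + f.1 (d (n + 1) n rfl x) = x) →
      ∀ x, d (n + 1 + 1) (n + 1) rfl (g.1 (d (n + 1 + 1) (n + 1) rfl x)) =
        d (n + 1 + 1) (n + 1) rfl x := by
    intro n f g h x
    have := h (d (n + 1 + 1) (n + 1) rfl x)
    rwa [hdd, map_zero, add_zero] at this
  have start : ∃ x₀ : {f : X 0 →ₗ[k] X (0 + 1) // SideLinear sd f},
      ∀ x, d (0 + 1) 0 rfl (x₀.1 (d (0 + 1) 0 rfl x)) = d (0 + 1) 0 rfl x := by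
    -- The map `s ρ` from degree `-1` to degree `0` satisfies `d (s ρ) d = d`, since `s(ε x) - x`
    -- lies in `ker ε`. This invariant suffices for one step upwards, which provides the starting
    -- map in degree `0`.
    obtain ⟨g, hg⟩ := up (-1) ⟨s ∘ₗ ρ, hs.comp hρ⟩ (fun (x : X 0) => by
      have h₁ : ρ (d (-1 + 1) (-1) rfl x) = ε x := hρ' x
      rw [LinearMap.comp_apply, h₁]
      obtain ⟨y, hy⟩ := (hε' (s (ε x) - x)).1 (by rw [map_sub, hs', LinearMap.id_apply, sub_self])
      have h₂ := hdd 1 0 (-1) (zero_add 1) (by norm_num) y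
      rw [hy, map_sub] at h₂
      exact sub_eq_zero.1 h₂)
    exact ⟨g, cond (-1) _ g hg⟩
  obtain ⟨x₀, hx₀⟩ := start
  obtain ⟨σ, -, hσ⟩ := exists_int_seq (F := fun n => {f : X n →ₗ[k] X (n + 1) // SideLinear sd f})
    (fun n f g => ∀ x, d (n + 1 + 1) (n + 1) rfl (g.1 x) + f.1 (d (n + 1) n rfl x) = x)
    (fun n f => ∀ x, d (n + 1) n rfl (f.1 (d (n + 1) n rfl x)) = d (n + 1) n rfl x) x₀ hx₀
    (fun n f hf => by
      obtain ⟨g, hg⟩ := up n f hf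
      exact ⟨g, hg, cond n f g hg⟩)
    (fun n g hg => by
      -- By the invariant `d σ d = d` and exactness, `id - d σ` vanishes on `ker d`, so it factors
      -- through `d`. The factor inherits the invariant because `d d = 0`.
      obtain ⟨f, hf, hf'⟩ := F.exists_sideLinear_extension sd (d (n + 1) n rfl)
        (f := LinearMap.id - (d (n + 1 + 1) (n + 1) rfl).restrictScalars k ∘ₗ g.1)
        (SideLinear.id.sub ((sideLinear_of_hom sd _).comp g.2)) (fun x hx => by
          obtain ⟨y, rfl⟩ := (exact _ _ n rfl rfl _).1 hx
          simp [hg]) (ht' (n + 1))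
      refine ⟨⟨f, hf⟩, fun x => by simp [hf'], fun x => ?_⟩
      simp [hf', hdd])
  refine ⟨fun i j h => h ▸ (σ i).1, ?_, ?_⟩
  · rintro i j rfl
    exact (σ i).2
  · rintro i j l rfl rfl x
    exact hσ l x

/-- Extension of bimodule maps along the differential of a contractible complex. -/
lemma exists_extension {X Y Z M : Bimodule k A} (hM : F.RelProjective sd M) (d₁ : X →ₗ[Env k A] Y)
    (d₀ : Y →ₗ[Env k A] Z) {σ₁ : Y →ₗ[k] X} {σ₀ : Z →ₗ[k] Y} (h₀ : SideLinear (!sd) σ₀)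
    (h : ∀ y, d₁ (σ₁ y) + σ₀ (d₀ y) = y) (f : Y →ₗ[Env k A] M) (hf : f ∘ₗ d₁ = 0) :
    ∃ g : Z →ₗ[Env k A] M, g ∘ₗ d₀ = f := by
  obtain ⟨t, ht, ht'⟩ := hM
  -- As `f` kills the image of `d₁`, the contraction identity gives `f σ₀ d₀ = f`. The one-sided
  -- extension `f σ₀` is made a bimodule map by tracing it against `t`.
  refine ⟨F.trHom sd (t ∘ₗ f.restrictScalars k ∘ₗ σ₀)
    (ht.comp ((sideLinear_of_hom _ f).comp h₀)), ?_⟩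
  have h₁ : (f.restrictScalars k ∘ₗ σ₀) ∘ₗ d₀.restrictScalars k = f.restrictScalars k := by
    ext y
    have h₂ := congrArg f (h y)
    have h₃ : f (d₁ (σ₁ y)) = 0 := LinearMap.congr_fun hf (σ₁ y)
    rwa [map_add, h₃, zero_add] at h₂
  have := F.tr_comp sd (sideLinear_of_hom sd d₀) (t ∘ₗ f.restrictScalars k ∘ₗ σ₀)
  rw [LinearMap.comp_assoc, h₁, ← F.tr_comp sd (sideLinear_of_hom sd f), ht'] at this
  ext y
  exact LinearMap.congr_fun this y

/-- Lifting of bimodule maps along the differential of a contractible complex. -/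
lemma exists_lift {X Y Z M : Bimodule k A} (hM : F.RelProjective sd M) (d₁ : X →ₗ[Env k A] Y)
    (d₀ : Y →ₗ[Env k A] Z) {σ₁ : Y →ₗ[k] X} {σ₀ : Z →ₗ[k] Y} (h₁ : SideLinear (!sd) σ₁)
    (h : ∀ y, d₁ (σ₁ y) + σ₀ (d₀ y) = y) (f : M →ₗ[Env k A] Y) (hf : d₀ ∘ₗ f = 0) :
    ∃ g : M →ₗ[Env k A] X, d₁ ∘ₗ g = f := by
  obtain ⟨t, ht, ht'⟩ := hM
  -- Dually, `d₁ σ₁ f = f`, and the one-sided lift `σ₁ f` is traced against `t`.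
  refine ⟨F.trHom sd (σ₁ ∘ₗ f.restrictScalars k ∘ₗ t)
    (h₁.comp ((sideLinear_of_hom _ f).comp ht)), ?_⟩
  have h₁ : d₁.restrictScalars k ∘ₗ σ₁ ∘ₗ f.restrictScalars k = f.restrictScalars k := by
    ext y
    have h₂ := h (f y)
    have h₃ : d₀ (f y) = 0 := LinearMap.congr_fun hf y
    rwa [h₃, map_zero, add_zero] at h₂
  have := F.comp_tr sd (sideLinear_of_hom sd d₁) ((σ₁ ∘ₗ f.restrictScalars k) ∘ₗ t)
  simp only [← LinearMap.comp_assoc] at h₁ this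
  rw [h₁, ← F.comp_tr sd (sideLinear_of_hom sd f), ht'] at this
  ext y
  exact LinearMap.congr_fun this y

/-- Induce on one side, then on the other. The second induction preserves relative projectivity for
the first side, so the result is projective. -/
lemma exists_projective (F : FrobeniusForm k A) (M : Bimodule k A) [Module.Finite k M] :
    ∃ (P : Bimodule k A) (p : P →ₗ[Env k A] M) (j : M →ₗ[Env k A] P), Module.Finite k P ∧
      Module.Projective (Env k A) P ∧ Function.Surjective p ∧ Function.Injective j := by
  obtain ⟨I, p, j, s, q, h, -, -, hp, hj, hfin, -⟩ := F.exists_relProjective true M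
  obtain ⟨I', p', j', s', q', h', -, -, hp', hj', hfin', hI'⟩ := F.exists_relProjective false I
  exact ⟨I', p ∘ₗ p', j' ∘ₗ j, hfin' (hfin inferInstance), projective_of_relProjective (hI' h) h',
    fun m => ⟨s' (s m), by rw [LinearMap.comp_apply, hp', hp]⟩,
    (Function.LeftInverse.injective hj').comp (Function.LeftInverse.injective hj)⟩

/-- The `K n` are syzygies and cosyzygies of `A = K 0`, linked by exact sequences `0 → K (n+1) → X n
→ K n → 0`: kernels of projective covers upwards, cokernels of embeddings downwards. The
differential is `X (n+1) → K (n+1) → X n`. -/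
theorem nonempty_completeResolution (F : FrobeniusForm k A) : Nonempty (CompleteResolution k A) := by
  have finA : Module.Finite k (regular k A) := inferInstanceAs (Module.Finite k A)
  obtain ⟨K, hK₀, hK⟩ := exists_int_seq (F := fun _ => {K : Bimodule k A // Module.Finite k K})
    (fun _ K K' => ∃ (P : Bimodule k A) (p : P →ₗ[Env k A] K.1) (i : K'.1 →ₗ[Env k A] P),
      Module.Finite k P ∧ Module.Projective (Env k A) P ∧ Function.Surjective p ∧
        Function.Injective i ∧ Function.Exact i p) (fun _ _ => True) ⟨regular k A, finA⟩ trivial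
    (fun _ K _ => by
      have := K.2
      obtain ⟨P, p, j, hP, hP', hp, -⟩ := F.exists_projective K.1
      obtain ⟨K', i, hi, hex, hfin⟩ := exists_kernel p
      exact ⟨⟨K', hfin hP⟩, ⟨P, p, i, hP, hP', hp, hi, hex⟩, trivial⟩)
    (fun _ K _ => by
      have := K.2
      obtain ⟨P, p, j, hP, hP', -, hj⟩ := F.exists_projective K.1
      obtain ⟨K', q, hq, hex, hfin⟩ := exists_cokernel j
      exact ⟨⟨K', hfin hP⟩, ⟨P, q, j, hP, hP', hq, hj, hex⟩, trivial⟩)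
  choose X p i hX hX' hp hi hex using hK
  let d : ∀ a b : ℤ, b + 1 = a → (X a →ₗ[Env k A] X b) := fun a b h =>
    i b ∘ₗ (h ▸ p a : X a →ₗ[Env k A] (K (b + 1)).1)
  have hd : ∀ b x, d (b + 1) b rfl x = i b (p (b + 1) x) := fun _ _ => rfl
  have exact : ∀ (a b l : ℤ) (h : b + 1 = a) (h' : l + 1 = b),
      Function.Exact (d a b h) (d b l h') := by
    rintro a b l rfl rfl x
    rw [hd, ← map_zero (i l), (hi l).eq_iff, hex (l + 1) x]
    constructor
    · rintro ⟨y, rfl⟩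
      obtain ⟨z, rfl⟩ := hp _ y
      exact ⟨z, rfl⟩
    · rintro ⟨z, rfl⟩
      exact ⟨_, rfl⟩
  obtain ⟨e⟩ : Nonempty ((K 0).1 ≃ₗ[Env k A] regular k A) := by
    rw [hK₀]
    exact ⟨LinearEquiv.refl _ _⟩
  have hε' : Function.Exact (d 1 0 (zero_add 1)) (e.toLinearMap ∘ₗ p 0) := fun x => by
    rw [LinearMap.comp_apply, LinearEquiv.coe_coe, e.map_eq_zero_iff, hex 0 x]
    constructor
    · rintro ⟨y, rfl⟩
      obtain ⟨z, rfl⟩ := hp (0 + 1) y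
      exact ⟨z, rfl⟩
    · rintro ⟨z, rfl⟩
      exact ⟨_, rfl⟩
  have hε : Function.Surjective (e.toLinearMap ∘ₗ p 0) := e.surjective.comp (hp 0)
  have hrel : ∀ s a, F.RelProjective s (X a) := fun s a =>
    have := hX' a
    F.relProjective_of_projective s (X a)
  obtain ⟨σ, hσ, hσ'⟩ := F.exists_contraction false X d (hrel _) exact _ hε hε'
  -- Exactness of the dual is an extension problem with target `Aᵉ`, itself a projective bimodule.
  let B : Bimodule k A := ⟨Env k A⟩
  have hB : Module.Projective (Env k A) B := inferInstanceAs (Module.Projective (Env k A) (Env k A))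
  exact ⟨{
    X := X
    d := d
    finite := fun a => have := hX a; Module.Finite.of_restrictScalars_finite k _ _
    projective := hX'
    exact := exact
    dual_exact := fun a b l h h' φ hφ => F.exists_extension true
      (F.relProjective_of_projective true B) (d a b h) (d b l h') (hσ _ _ h') (hσ' a b l h h')
      (f := (φ : X b →ₗ[Env k A] B)) hφ
    ε := e.toLinearMap ∘ₗ p 0
    ε_surjective := hε
    ε_exact := hε' }⟩

end FrobeniusForm

namespace CompleteResolution

variable (T : CompleteResolution k A) (F : FrobeniusForm k A)

lemma relProjective (sd : Bool) (i : ℤ) : F.RelProjective sd (T.X i) :=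
  have := T.projective i
  F.relProjective_of_projective sd _

lemma exists_contraction (F : FrobeniusForm k A) (sd : Bool) :
    ∃ σ : ∀ i j : ℤ, i + 1 = j → (T.X i →ₗ[k] T.X j), (∀ i j h, SideLinear sd (σ i j h)) ∧
      ∀ (i j l : ℤ) (h : j + 1 = i) (h' : l + 1 = j) (x : T.X j),
        T.d i j h (σ j i h x) + σ l j h' (T.d j l h' x) = x :=
  F.exists_contraction sd T.X T.d (T.relProjective F sd) T.exact T.ε T.ε_surjective T.ε_exact

end CompleteResolution

end TateHochschild

/-! ### Comparison of complete resolutions -/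

namespace TateHochschild

open Bimodule

variable {k : Type v} {A : Type u} [Field k] [Ring A] [Algebra k A]

namespace Bimodule

/-- The pure tensor `x ⊗ n` as a bilinear map. -/
noncomputable def etmulₗ (X N : Bimodule k A) : X →ₗ[k] N →ₗ[k] EnvTensor X N :=
  (TensorProduct.mk k X N).compr₂ (envRel X N).mkQ

lemma etmulₗ_apply {X N : Bimodule k A} (x : X) (n : N) : etmulₗ X N x n = etmul x n := rfl

lemma envMap_comp {X N X' N' X'' N'' : Bimodule k A} (f : X →ₗ[Env k A] X')
    (g : N →ₗ[Env k A] N') (f' : X' →ₗ[Env k A] X'') (g' : N' →ₗ[Env k A] N'')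
    (z : EnvTensor X N) : envMap f' g' (envMap f g z) = envMap (f' ∘ₗ f) (g' ∘ₗ g) z :=
  LinearMap.congr_fun (f := envMap f' g' ∘ₗ envMap f g) (g := envMap (f' ∘ₗ f) (g' ∘ₗ g))
    (envTensor_ext fun _ _ => rfl) z

lemma envMap_id {X N : Bimodule k A} (z : EnvTensor X N) :
    envMap (LinearMap.id : X →ₗ[Env k A] X) (LinearMap.id : N →ₗ[Env k A] N) z = z :=
  LinearMap.congr_fun (f := envMap LinearMap.id LinearMap.id) (g := LinearMap.id)
    (envTensor_ext fun _ _ => rfl) z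

lemma envMap_add_left {X N X' N' : Bimodule k A} (f f' : X →ₗ[Env k A] X') (g : N →ₗ[Env k A] N')
    (z : EnvTensor X N) : envMap (f + f') g z = envMap f g z + envMap f' g z :=
  LinearMap.congr_fun (f := envMap (f + f') g) (g := envMap f g + envMap f' g)
    (envTensor_ext fun x n => (etmulₗ X' N').map_add₂ (f x) (f' x) (g n)) z

lemma envMap_smul_left {X N X' N' : Bimodule k A} (c : k) (f : X →ₗ[Env k A] X')
    (g : N →ₗ[Env k A] N') (z : EnvTensor X N) : envMap (c • f) g z = c • envMap f g z :=
  LinearMap.congr_fun (f := envMap (c • f) g) (g := c • envMap f g)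
    (envTensor_ext fun x n => (etmulₗ X' N').map_smul₂ c (f x) (g n)) z

lemma envMap_zero_left {X N X' N' : Bimodule k A} (g : N →ₗ[Env k A] N') (z : EnvTensor X N) :
    envMap (0 : X →ₗ[Env k A] X') g z = 0 := by
  have := envMap_smul_left (0 : k) (0 : X →ₗ[Env k A] X') g z
  rwa [zero_smul, zero_smul] at this

end Bimodule

namespace CompleteResolution

variable (T T' : CompleteResolution k A)

lemma neg_one_zpow_ne_zero (r : ℤ) : ((-1 : k) ^ r) ≠ 0 := zpow_ne_zero _ (by simp)

lemma codiff_eq_zero_iff {M : Bimodule k A} {i j : ℤ} (h : i + 1 = j) (u : T.X i →ₗ[Env k A] M) :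
    T.codiff M i j h u = 0 ↔ u ∘ₗ T.d j i h = 0 :=
  smul_eq_zero_iff_right (neg_one_zpow_ne_zero _)

lemma mem_cocycles {M : Bimodule k A} {r j : ℤ} (h : r + 1 = j) (u : T.X r →ₗ[Env k A] M) :
    u ∈ T.cocycles M r ↔ u ∘ₗ T.d j r h = 0 := by
  subst h
  exact T.codiff_eq_zero_iff rfl u

lemma mem_cycles {N : Bimodule k A} {s j : ℤ} (h : j + 1 = s) (z : EnvTensor (T.X s) N) :
    z ∈ T.cycles N s ↔ T.diff N s j h z = 0 := by
  obtain rfl : j = s - 1 := by omega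
  rfl

lemma diff_diff (N : Bimodule k A) {i j l : ℤ} (h : j + 1 = i) (h' : l + 1 = j)
    (z : EnvTensor (T.X i) N) : T.diff N j l h' (T.diff N i j h z) = 0 := by
  rw [diff, diff, envMap_comp, d_comp_d, envMap_zero_left]

lemma cohMk_eq_zero_iff {M : Bimodule k A} {r l : ℤ} (h : l + 1 = r) (u : T.cocycles M r) :
    T.cohMk M r u = 0 ↔ ∃ w : T.X l →ₗ[Env k A] M, w ∘ₗ T.d r l h = u.1 := by
  obtain rfl : l = r - 1 := by omega
  refine (Submodule.Quotient.mk_eq_zero _).trans ?_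
  constructor
  · rintro ⟨w, hw⟩
    exact ⟨((-1 : k) ^ (r - 1 + 1)) • w, by rw [LinearMap.smul_comp]; exact hw⟩
  · rintro ⟨w, hw⟩
    refine ⟨((-1 : k) ^ (r - 1 + 1))⁻¹ • w, ?_⟩
    rw [map_smul]
    change _ • ((-1 : k) ^ (r - 1 + 1)) • (w ∘ₗ _) = _
    rw [smul_smul, inv_mul_cancel₀ (neg_one_zpow_ne_zero _), one_smul, hw]
    rfl

lemma cohMk_eq_iff {M : Bimodule k A} {r l : ℤ} (h : l + 1 = r) (u u' : T.cocycles M r) :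
    T.cohMk M r u = T.cohMk M r u' ↔ ∃ w : T.X l →ₗ[Env k A] M, w ∘ₗ T.d r l h = u.1 - u'.1 := by
  rw [← sub_eq_zero, ← map_sub, T.cohMk_eq_zero_iff h]
  rfl

lemma homMk_eq_zero_iff {N : Bimodule k A} {s i : ℤ} (h : s + 1 = i) (z : T.cycles N s) :
    T.homMk N s z = 0 ↔ ∃ w : EnvTensor (T.X i) N, T.diff N i s h w = z.1 := by
  subst h
  exact Submodule.Quotient.mk_eq_zero _

lemma homMk_eq_iff {N : Bimodule k A} {s i : ℤ} (h : s + 1 = i) (z z' : T.cycles N s) :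
    T.homMk N s z = T.homMk N s z' ↔
      ∃ w : EnvTensor (T.X i) N, T.diff N i s h w = z.1 - z'.1 := by
  rw [← sub_eq_zero, ← map_sub, T.homMk_eq_zero_iff h]
  rfl

lemma exists_cocycle {M : Bimodule k A} {r : ℤ} (γ : T.Cohomology M r) : ∃ u, T.cohMk M r u = γ :=
  Submodule.mkQ_surjective _ γ

lemma exists_cycle {N : Bimodule k A} {s : ℤ} (ξ : T.Homology N s) : ∃ z, T.homMk N s z = ξ :=
  Submodule.mkQ_surjective _ ξ

variable {T T'}

namespace AugMap

lemma comp_mem_cocycles (φ : AugMap T T') {M : Bimodule k A} {r : ℤ} (u : T'.cocycles M r) :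
    u.1 ∘ₗ φ.app r ∈ T.cocycles M r := by
  rw [T.mem_cocycles rfl, LinearMap.comp_assoc, ← φ.comm, ← LinearMap.comp_assoc,
    (T'.mem_cocycles rfl _).1 u.2, LinearMap.zero_comp]

lemma cohMap_cohMk (φ : AugMap T T') {M : Bimodule k A} {r : ℤ} (u : T'.cocycles M r) :
    φ.cohMap M r (T'.cohMk M r u) = T.cohMk M r ⟨u.1 ∘ₗ φ.app r, φ.comp_mem_cocycles u⟩ := rfl

lemma diff_envMap (φ : AugMap T T') {N : Bimodule k A} {i j : ℤ} (h : j + 1 = i)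
    (z : EnvTensor (T.X i) N) : T'.diff N i j h (envMap (φ.app i) LinearMap.id z) =
      envMap (φ.app j) LinearMap.id (T.diff N i j h z) := by
  rw [diff, diff, envMap_comp, envMap_comp, φ.comm]

lemma envMap_mem_cycles (φ : AugMap T T') {N : Bimodule k A} {s : ℤ} (z : T.cycles N s) :
    envMap (φ.app s) LinearMap.id z.1 ∈ T'.cycles N s := by
  rw [T'.mem_cycles (sub_add_cancel s 1), φ.diff_envMap, (T.mem_cycles (sub_add_cancel s 1) _).1 z.2,
    map_zero]

lemma homMap_homMk (φ : AugMap T T') {N : Bimodule k A} {s : ℤ} (z : T.cycles N s) :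
    φ.homMap N s (T.homMk N s z) =
      T'.homMk N s ⟨envMap (φ.app s) LinearMap.id z.1, φ.envMap_mem_cycles z⟩ := rfl

/-- Composition of augmentation preserving chain maps. -/
def comp {T'' : CompleteResolution k A} (ψ : AugMap T' T'') (φ : AugMap T T') : AugMap T T'' where
  app i := ψ.app i ∘ₗ φ.app i
  comm i j h := by rw [← LinearMap.comp_assoc, ψ.comm, LinearMap.comp_assoc, φ.comm]; rfl
  aug := by rw [← LinearMap.comp_assoc, ψ.aug, φ.aug]

/-- The identity chain map. -/
def id (T : CompleteResolution k A) : AugMap T T where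
  app _ := LinearMap.id
  comm _ _ _ := rfl
  aug := rfl

lemma cohMap_comp {T'' : CompleteResolution k A} (ψ : AugMap T' T'') (φ : AugMap T T')
    {M : Bimodule k A} {r : ℤ} (γ : T''.Cohomology M r) :
    (ψ.comp φ).cohMap M r γ = φ.cohMap M r (ψ.cohMap M r γ) := by
  obtain ⟨u, rfl⟩ := T''.exists_cocycle γ
  rfl

lemma cohMap_id {M : Bimodule k A} {r : ℤ} (γ : T.Cohomology M r) : (id T).cohMap M r γ = γ := by
  obtain ⟨u, rfl⟩ := T.exists_cocycle γ
  rfl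

lemma homMap_comp {T'' : CompleteResolution k A} (ψ : AugMap T' T'') (φ : AugMap T T')
    {N : Bimodule k A} {s : ℤ} (ξ : T.Homology N s) :
    (ψ.comp φ).homMap N s ξ = ψ.homMap N s (φ.homMap N s ξ) := by
  obtain ⟨z, rfl⟩ := T.exists_cycle ξ
  rw [homMap_homMk, homMap_homMk, homMap_homMk]
  refine congrArg (T''.homMk N s) (Subtype.ext ?_)
  exact (envMap_comp (φ.app s) LinearMap.id (ψ.app s) LinearMap.id z.1).symm

lemma homMap_id {N : Bimodule k A} {s : ℤ} (ξ : T.Homology N s) : (id T).homMap N s ξ = ξ := by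
  obtain ⟨z, rfl⟩ := T.exists_cycle ξ
  rw [homMap_homMk]
  exact congrArg (T.homMk N s) (Subtype.ext (envMap_id z.1))

end AugMap

variable (T T')

/-- Upwards, `f d` is lifted through the exact complex `T'`; downwards, `d g` is extended along the
exact complex `T`, since the projective terms of `T'` are also relatively injective. The invariant
carried along is `d f d = 0`. -/
theorem nonempty_augMap [FiniteDimensional k A] (F : FrobeniusForm k A) : Nonempty (AugMap T T') := by
  obtain ⟨σ, hσ, hσ'⟩ := T.exists_contraction F false
  obtain ⟨τ, hτ, hτ'⟩ := T'.exists_contraction F false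
  have := T.projective 0
  obtain ⟨f₀, hf₀⟩ := Module.projective_lifting_property T'.ε T.ε T'.ε_surjective
  obtain ⟨f, hf, hR⟩ := exists_int_seq (F := fun n => T.X n →ₗ[Env k A] T'.X n)
    (fun n f g => T'.d (n + 1) n rfl ∘ₗ g = f ∘ₗ T.d (n + 1) n rfl)
    (fun n f => ∀ l (h : l + 1 = n), T'.d n l h ∘ₗ f ∘ₗ T.d (n + 1) n rfl = 0) f₀
    (fun l h => by
      obtain rfl : l = -1 := by omega
      -- The invariant in degree `0` is where preservation of the augmentation enters.
      refine LinearMap.ext fun x => (T'.d_eq_zero_iff _).2 ?_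
      exact (LinearMap.congr_fun hf₀ _).trans (T.ε_d x))
    (fun n f hf => by
      obtain ⟨g, hg⟩ := F.exists_lift true (T.relProjective F true (n + 1)) (T'.d (n + 1) n rfl)
        (T'.d n (n - 1) (by omega)) (hτ _ _ _) (hτ' _ _ _ rfl (by omega))
        (f ∘ₗ T.d (n + 1) n rfl) (hf _ _)
      refine ⟨g, hg, fun l h => ?_⟩
      obtain rfl : l = n := by omega
      rw [← LinearMap.comp_assoc, hg, LinearMap.comp_assoc, d_comp_d, LinearMap.comp_zero])
    (fun n g hg => by
      obtain ⟨f, hf⟩ := F.exists_extension true (T'.relProjective F true n)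
        (T.d (n + 1 + 1) (n + 1) rfl) (T.d (n + 1) n rfl) (hσ _ _ _) (hσ' _ _ _ rfl rfl)
        (T'.d (n + 1) n rfl ∘ₗ g) (hg n rfl)
      refine ⟨f, hf.symm, fun l h => ?_⟩
      rw [hf, ← LinearMap.comp_assoc, d_comp_d, LinearMap.zero_comp])
  refine ⟨⟨f, ?_, by rw [hf]; exact hf₀⟩⟩
  rintro i j rfl
  exact hR j

variable {T T'}

/-- The same two-way induction, applied to the difference `δ` of the two maps, with invariant `(δ -
d s) d = 0`. It starts because `ε δ = 0`, so that `d δ = 0` in degree `0` and `δ` lifts to degree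
`1`. -/
theorem AugMap.exists_homotopy [FiniteDimensional k A] (F : FrobeniusForm k A) (φ ψ : AugMap T T') :
    ∃ s : ∀ i j : ℤ, i + 1 = j → (T.X i →ₗ[Env k A] T'.X j),
      ∀ (i j l : ℤ) (h : j + 1 = i) (h' : l + 1 = j),
        φ.app j - ψ.app j = T'.d i j h ∘ₗ s j i h + s l j h' ∘ₗ T.d j l h' := by
  obtain ⟨σ, hσ, hσ'⟩ := T.exists_contraction F false
  obtain ⟨τ, hτ, hτ'⟩ := T'.exists_contraction F false
  let δ : ∀ i, T.X i →ₗ[Env k A] T'.X i := fun i => φ.app i - ψ.app i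
  have hδ : ∀ i j (h : j + 1 = i), T'.d i j h ∘ₗ δ i = δ j ∘ₗ T.d i j h := fun i j h => by
    simp only [δ, LinearMap.comp_sub, LinearMap.sub_comp, φ.comm, ψ.comm]
  obtain ⟨s₀, hs₀⟩ := F.exists_lift true (T.relProjective F true 0) (T'.d (0 + 1) 0 rfl)
    (T'.d 0 (-1) (by norm_num)) (hτ _ _ _) (hτ' _ _ _ rfl (by norm_num)) (δ 0) (by
      refine LinearMap.ext fun x => (T'.d_eq_zero_iff _).2 ?_
      have h₁ : T'.ε (φ.app 0 x) = T'.ε (ψ.app 0 x) :=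
        (LinearMap.congr_fun φ.aug x).trans (LinearMap.congr_fun ψ.aug x).symm
      rw [LinearMap.sub_apply, map_sub, h₁, sub_self])
  obtain ⟨s, -, hR⟩ := exists_int_seq (F := fun n => T.X n →ₗ[Env k A] T'.X (n + 1))
    (fun n s s' => δ (n + 1) = T'.d (n + 1 + 1) (n + 1) rfl ∘ₗ s' + s ∘ₗ T.d (n + 1) n rfl)
    (fun n s => (δ n - T'.d (n + 1) n rfl ∘ₗ s) ∘ₗ T.d (n + 1) n rfl = 0) s₀
    (by rw [hs₀, sub_self, LinearMap.zero_comp])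
    (fun n s hs => by
      obtain ⟨s', hs'⟩ := F.exists_lift true (T.relProjective F true (n + 1))
        (T'.d (n + 1 + 1) (n + 1) rfl) (T'.d (n + 1) n rfl) (hτ _ _ _) (hτ' _ _ _ rfl rfl)
        (δ (n + 1) - s ∘ₗ T.d (n + 1) n rfl) (by
          rw [LinearMap.comp_sub, hδ, ← LinearMap.comp_assoc, ← LinearMap.sub_comp, hs])
      refine ⟨s', by rw [hs', sub_add_cancel], ?_⟩
      rw [hs', sub_sub_cancel, LinearMap.comp_assoc, d_comp_d, LinearMap.comp_zero])
    (fun n s' hs' => by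
      obtain ⟨s, hs⟩ := F.exists_extension true (T'.relProjective F true (n + 1))
        (T.d (n + 1 + 1) (n + 1) rfl) (T.d (n + 1) n rfl) (hσ _ _ _) (hσ' _ _ _ rfl rfl)
        (δ (n + 1) - T'.d (n + 1 + 1) (n + 1) rfl ∘ₗ s') hs'
      refine ⟨s, by rw [hs, add_sub_cancel], ?_⟩
      rw [LinearMap.sub_comp, LinearMap.comp_assoc, hs, LinearMap.comp_sub, hδ,
        ← LinearMap.comp_assoc, d_comp_d, LinearMap.zero_comp, sub_zero, sub_self])
  refine ⟨fun i j h => h ▸ s i, ?_⟩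
  rintro i j l rfl rfl
  exact hR l

theorem AugMap.cohMap_eq [FiniteDimensional k A] (F : FrobeniusForm k A) (φ ψ : AugMap T T') :
    φ.cohMap = ψ.cohMap := by
  obtain ⟨s, hs⟩ := φ.exists_homotopy F ψ
  refine funext fun M => funext fun r => LinearMap.ext fun γ => ?_
  obtain ⟨u, rfl⟩ := T'.exists_cocycle γ
  rw [cohMap_cohMk, cohMap_cohMk, T.cohMk_eq_iff (sub_add_cancel r 1)]
  refine ⟨u.1 ∘ₗ s (r - 1) r (sub_add_cancel r 1), ?_⟩
  change _ = u.1 ∘ₗ φ.app r - u.1 ∘ₗ ψ.app r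
  rw [← LinearMap.comp_sub, hs (r + 1) r (r - 1) rfl (sub_add_cancel r 1), LinearMap.comp_add,
    ← LinearMap.comp_assoc, (T'.mem_cocycles rfl _).1 u.2, LinearMap.zero_comp, zero_add,
    LinearMap.comp_assoc]

theorem AugMap.homMap_eq [FiniteDimensional k A] (F : FrobeniusForm k A) (φ ψ : AugMap T T') :
    φ.homMap = ψ.homMap := by
  obtain ⟨s, hs⟩ := φ.exists_homotopy F ψ
  refine funext fun N => funext fun r => LinearMap.ext fun ξ => ?_
  obtain ⟨z, rfl⟩ := T.exists_cycle ξ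
  rw [homMap_homMk, homMap_homMk, T'.homMk_eq_iff rfl]
  refine ⟨envMap (s r (r + 1) rfl) LinearMap.id z.1, ?_⟩
  change _ = envMap (φ.app r) LinearMap.id z.1 - envMap (ψ.app r) LinearMap.id z.1
  rw [eq_sub_iff_add_eq]
  have h₀ : envMap (T.d r (r - 1) (sub_add_cancel r 1)) LinearMap.id z.1 = 0 :=
    (T.mem_cycles (sub_add_cancel r 1) _).1 z.2
  have h₁ := eq_add_of_sub_eq (hs (r + 1) r (r - 1) rfl (sub_add_cancel r 1))
  rw [h₁, envMap_add_left, envMap_add_left, diff, envMap_comp, LinearMap.id_comp]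
  have h₂ := envMap_comp (T.d r (r - 1) (sub_add_cancel r 1)) (LinearMap.id : N →ₗ[Env k A] N)
    (s (r - 1) r (sub_add_cancel r 1)) LinearMap.id z.1
  rw [h₀, map_zero, LinearMap.id_comp] at h₂
  rw [← h₂, add_zero]

/-- Any comparison map in the other direction works: both composites are augmentation preserving
self-maps, hence act as the identity on (co)homology. -/
theorem AugMap.exists_inverse [FiniteDimensional k A] (F : FrobeniusForm k A) (φ : AugMap T T') :
    ∃ ψ : AugMap T' T,
      (∀ M r γ, φ.cohMap M r (ψ.cohMap M r γ) = γ) ∧ (∀ M r γ, ψ.cohMap M r (φ.cohMap M r γ) = γ) ∧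
      (∀ N s ξ, φ.homMap N s (ψ.homMap N s ξ) = ξ) ∧ ∀ N s ξ, ψ.homMap N s (φ.homMap N s ξ) = ξ := by
  obtain ⟨ψ⟩ := T'.nonempty_augMap T F
  refine ⟨ψ, fun M r γ => ?_, fun M r γ => ?_, fun N s ξ => ?_, fun N s ξ => ?_⟩
  · rw [← cohMap_comp, cohMap_eq F _ (AugMap.id T), cohMap_id]
  · rw [← cohMap_comp, cohMap_eq F _ (AugMap.id T'), cohMap_id]
  · rw [← homMap_comp, homMap_eq F _ (AugMap.id T'), homMap_id]
  · rw [← homMap_comp, homMap_eq F _ (AugMap.id T), homMap_id]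

end CompleteResolution

end TateHochschild

/-! ### Tensor products and one-sided contractions -/

namespace TateHochschild

open Bimodule

variable {k : Type v} {A : Type u} [Field k] [Ring A] [Algebra k A]

namespace Bimodule

variable {M N M' N' M'' N'' : Bimodule k A}

/-- The pure tensor `m ⊗ n` as a bilinear map. -/
noncomputable def tmulₗ (M N : Bimodule k A) : M →ₗ[k] N →ₗ[k] tensor M N :=
  (TensorProduct.mk k M N).compr₂ (tensorMk M N)

lemma tmulₗ_apply (m : M) (n : N) : tmulₗ M N m n = tmul m n := rfl

lemma ac_true_false (a b : A) (m : M) : M.ac true a (M.ac false b m) = M.ac false b (M.ac true a m) :=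
  M.ac_comm true a b m

lemma tensor_ac_true (a : A) (m : M) (n : N) :
    (tensor M N).ac true a (tmul m n) = tmul (M.ac true a m) n := by
  change (tensor M N).left a (tmul m n) = tmul (M.left a m) n
  rw [left_apply, smul_tmul, right_one]

lemma tensor_ac_false (a : A) (m : M) (n : N) :
    (tensor M N).ac false a (tmul m n) = tmul m (N.ac false a n) := by
  change (tensor M N).right a (tmul m n) = tmul m (N.right a n)
  rw [right_apply, smul_tmul, left_one]

lemma tmul_ac (a : A) (m : M) (n : N) : tmul m (N.ac true a n) = tmul (M.ac false a m) n :=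
  tmul_left a m n

lemma tensor_congr {V : Type*} [AddCommGroup V] [Module k V] (f g : tensor M N →ₗ[k] V)
    (h : ∀ m n, f (tmul m n) = g (tmul m n)) (z : tensor M N) : f z = g z :=
  LinearMap.congr_fun (tensor_ext h) z

/-- The tensor product of a right linear and a left linear map. -/
def tmap (f : M →ₗ[k] M') (g : N →ₗ[k] N') (hf : SideLinear false f) (hg : SideLinear true g) :
    tensor M N →ₗ[k] tensor M' N' := tensorMapAux f g hf hg

@[simp] lemma tmap_tmul (f : M →ₗ[k] M') (g : N →ₗ[k] N') (hf : SideLinear false f)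
    (hg : SideLinear true g) (m : M) (n : N) : tmap f g hf hg (tmul m n) = tmul (f m) (g n) := rfl

lemma sideLinear_tmap_true {f : M →ₗ[k] M'} {g : N →ₗ[k] N'} (hf : SideLinear false f)
    (hg : SideLinear true g) (h : SideLinear true f) : SideLinear true (tmap f g hf hg) :=
  fun a z => tensor_congr (tmap f g hf hg ∘ₗ (tensor M N).ac true a)
    ((tensor M' N').ac true a ∘ₗ tmap f g hf hg) (fun m n => by
      simp only [LinearMap.comp_apply, tensor_ac_true, tmap_tmul, h a m]) z

lemma sideLinear_tmap_false {f : M →ₗ[k] M'} {g : N →ₗ[k] N'} (hf : SideLinear false f)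
    (hg : SideLinear true g) (h : SideLinear false g) : SideLinear false (tmap f g hf hg) :=
  fun a z => tensor_congr (tmap f g hf hg ∘ₗ (tensor M N).ac false a)
    ((tensor M' N').ac false a ∘ₗ tmap f g hf hg) (fun m n => by
      simp only [LinearMap.comp_apply, tensor_ac_false, tmap_tmul, h a n]) z

lemma tensorMap_comp (f : M →ₗ[Env k A] M') (g : N →ₗ[Env k A] N') (f' : M' →ₗ[Env k A] M'')
    (g' : N' →ₗ[Env k A] N'') (z : tensor M N) :
    tensorMap f' g' (tensorMap f g z) = tensorMap (f' ∘ₗ f) (g' ∘ₗ g) z :=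
  tensor_congr ((tensorMap f' g').restrictScalars k ∘ₗ (tensorMap f g).restrictScalars k)
    ((tensorMap (f' ∘ₗ f) (g' ∘ₗ g)).restrictScalars k) (fun _ _ => rfl) z

lemma tensorMap_zero_left (g : N →ₗ[Env k A] N') (z : tensor M N) :
    tensorMap (0 : M →ₗ[Env k A] M') g z = 0 :=
  tensor_congr ((tensorMap (0 : M →ₗ[Env k A] M') g).restrictScalars k) 0
    (fun _ n => (tmulₗ M' N').map_zero₂ (g n)) z

lemma tensorMap_zero_right (f : M →ₗ[Env k A] M') (z : tensor M N) :
    tensorMap f (0 : N →ₗ[Env k A] N') z = 0 :=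
  tensor_congr ((tensorMap f (0 : N →ₗ[Env k A] N')).restrictScalars k) 0
    (fun m _ => (tmulₗ M' N' (f m)).map_zero) z

end Bimodule

namespace CompleteResolution

variable (T : CompleteResolution k A)

section

variable {T} {M M' : Bimodule k A} {n : ℤ}

/-- The components of `D ∘ f` for a bimodule map `f` into the term of degree `n` of the complete
tensor product of `T` with itself. -/
def totalDiff (f : ∀ p q : ℤ, p + q = n → (M →ₗ[Env k A] tensor (T.X p) (T.X q))) (p q : ℤ)
    (h : p + q + 1 = n) : M →ₗ[Env k A] tensor (T.X p) (T.X q) :=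
  tensorMap (T.d (p + 1) p rfl) LinearMap.id ∘ₗ f (p + 1) q (by omega) +
    ((-1 : k) ^ p) • tensorMap LinearMap.id (T.d (q + 1) q rfl) ∘ₗ f p (q + 1) (by omega)

lemma totalDiff_apply (f : ∀ p q : ℤ, p + q = n → (M →ₗ[Env k A] tensor (T.X p) (T.X q)))
    (p q : ℤ) (h : p + q + 1 = n) (x : M) : totalDiff f p q h x =
      tensorMap (T.d (p + 1) p rfl) LinearMap.id (f (p + 1) q (by omega) x) +
    ((-1 : k) ^ p) • tensorMap LinearMap.id (T.d (q + 1) q rfl) (f p (q + 1) (by omega) x) := rfl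

lemma tensorMap_d_d_left {N N' : Bimodule k A} (g : N →ₗ[Env k A] N')
    {N'' : Bimodule k A} (g' : N' →ₗ[Env k A] N'') {i j l : ℤ} (h : j + 1 = i) (h' : l + 1 = j)
    (z : tensor (T.X i) N) : tensorMap (T.d j l h') g' (tensorMap (T.d i j h) g z) = 0 := by
  rw [tensorMap_comp, d_comp_d, tensorMap_zero_left]

lemma tensorMap_d_d_right {N N' : Bimodule k A} (g : N →ₗ[Env k A] N')
    {N'' : Bimodule k A} (g' : N' →ₗ[Env k A] N'') {i j l : ℤ} (h : j + 1 = i) (h' : l + 1 = j)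
    (z : tensor N (T.X i)) : tensorMap g' (T.d j l h') (tensorMap g (T.d i j h) z) = 0 := by
  rw [tensorMap_comp, d_comp_d, tensorMap_zero_right]

lemma tensorMap_d_comm {i i' j j' : ℤ} (h : i' + 1 = i) (h' : j' + 1 = j)
    (z : tensor (T.X i) (T.X j)) :
    tensorMap (T.d i i' h) LinearMap.id (tensorMap LinearMap.id (T.d j j' h') z) =
      tensorMap LinearMap.id (T.d j j' h') (tensorMap (T.d i i' h) LinearMap.id z) := by
  simp only [tensorMap_comp, LinearMap.comp_id, LinearMap.id_comp]

/-- The total differential squares to zero: the two mixed terms have opposite signs `(-1)^p` and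
`(-1)^(p+1)`. -/
lemma totalDiff_totalDiff (f : ∀ p q : ℤ, p + q = n → (M →ₗ[Env k A] tensor (T.X p) (T.X q)))
    (p q : ℤ) (h : p + q + 1 + 1 = n) (x : M) :
    tensorMap (T.d (p + 1) p rfl) LinearMap.id (totalDiff f (p + 1) q (by omega) x) +
    ((-1 : k) ^ p) • tensorMap LinearMap.id (T.d (q + 1) q rfl)
      (totalDiff f p (q + 1) (by omega) x) = 0 := by
  have hs : ∀ (c : k) {P Q : Bimodule k A} (g : P →ₗ[Env k A] Q) (z : P), g (c • z) = c • g z :=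
    fun c P Q g z => (g.restrictScalars k).map_smul c z
  rw [totalDiff_apply, totalDiff_apply, map_add, map_add, hs, hs, tensorMap_d_d_left,
    tensorMap_d_d_right, tensorMap_d_comm, zpow_add_one₀ (by simp)]
  simp

/-- `d ⊗ d` on `T_0 ⊗ T_0` factors through `ε ⊗ ε`. -/
lemma tensorMap_d_d_eq_zero {z : tensor (T.X 0) (T.X 0)} (hz : T.augAug z = 0) :
    tensorMap (T.d 0 (-1) (by norm_num)) (T.d 0 (-1) (by norm_num)) z = 0 := by
  obtain ⟨x₀, hx₀⟩ := T.ε_surjective (toRegular 1)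
  -- With `y = d x₀` and `ε x₀ = 1`, exactness gives `d x = ε(x) y = y ε(x)` and `a y = y a`.
  -- Therefore `d x ⊗ d x' = ε(x) ε(x') (y ⊗ y)`.
  have hd : ∀ (sd : Bool) (x : T.X 0), T.d 0 (-1) (by norm_num) x =
      (T.X (-1)).ac sd (ofRegular (T.ε x)) (T.d 0 (-1) (by norm_num) x₀) := fun sd x => by
    rw [← map_ac, ← sub_eq_zero, ← map_sub, T.d_eq_zero_iff, map_sub, map_ac, hx₀, sub_eq_zero]
    refine Eq.symm ((ofRegular_ac sd (ofRegular (T.ε x)) (toRegular 1)).trans ?_)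
    cases sd
    · exact one_mul _
    · exact mul_one _
  set y := T.d 0 (-1) (by norm_num) x₀ with hy
  have hc : ∀ a, (T.X (-1)).ac true a y = (T.X (-1)).ac false a y := fun a => by
    rw [hy, ← map_ac, ← map_ac, ← sub_eq_zero, ← map_sub, T.d_eq_zero_iff, map_sub, map_ac, map_ac,
      hx₀, sub_eq_zero]
    refine (ofRegular_ac true a (toRegular 1)).trans
      (Eq.trans ?_ (ofRegular_ac false a (toRegular 1)).symm)
    exact (mul_one a).trans (one_mul a).symm
  have key := tensor_congr ((tensorMap (T.d 0 (-1) (by norm_num))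
      (T.d 0 (-1) (by norm_num))).restrictScalars k)
    (((tensor (T.X (-1)) (T.X (-1))).acₗ true).flip (tmul y y) ∘ₗ T.augAug) (fun x x' => by
      have h₁ : T.augAug (tmul x x') = ofRegular (T.ε x) * ofRegular (T.ε x') := rfl
      change tmul (T.d 0 (-1) _ x) (T.d 0 (-1) _ x') =
        (tensor (T.X (-1)) (T.X (-1))).ac true (T.augAug (tmul x x')) (tmul y y)
      rw [hd true x, hd true x', h₁, tensor_ac_true, tmul_ac, ← ac_true_false, ← hc]
      exact congrArg (fun w => tmul w y) ((T.X (-1)).left_mul _ _ y).symm) z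
  refine key.trans ?_
  rw [LinearMap.comp_apply, hz, map_zero]

end

end CompleteResolution

variable [FiniteDimensional k A]

namespace FrobeniusForm

variable {F : FrobeniusForm k A} {M N M' N' : Bimodule k A}

/-- The left action on `M ⊗ N` involves `M` only, so the left trace of `h ⊗ 1` is the trace of `h`,
tensored with `1`. Right linearity of `h` is what makes `h ⊗ 1` defined over `A`. -/
lemma RelProjective.tensor_true (hM : F.RelProjective true M) (N : Bimodule k A) :
    F.RelProjective true (tensor M N) := by
  obtain ⟨h, hh, h1⟩ := hM
  refine ⟨tmap h LinearMap.id hh SideLinear.id, sideLinear_tmap_false _ _ SideLinear.id,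
    tensor_ext fun m n => ?_⟩
  simp only [tr_apply, tensor_ac_true, tmap_tmul, LinearMap.id_apply]
  simp only [← tmulₗ_apply, ← LinearMap.sum_apply, ← map_sum]
  rw [← tr_apply, h1, LinearMap.id_apply]

lemma RelProjective.tensor_false (hN : F.RelProjective false N) (M : Bimodule k A) :
    F.RelProjective false (tensor M N) := by
  obtain ⟨h, hh, h1⟩ := hN
  refine ⟨tmap LinearMap.id h SideLinear.id hh, sideLinear_tmap_true _ _ SideLinear.id,
    tensor_ext fun m n => ?_⟩
  simp only [tr_apply, tensor_ac_false, tmap_tmul, LinearMap.id_apply]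
  simp only [← tmulₗ_apply, ← map_sum]
  rw [← tr_apply, h1, LinearMap.id_apply]

variable (F)

/-- The bimodule map `x ⊗ y ↦ ∑ α(x u i) ⊗ β(v i y)` for a left linear map `α` and a right linear
map `β`. -/
noncomputable def mid (α : M →ₗ[k] M') (β : N →ₗ[k] N') (hα : SideLinear true α) (hβ : SideLinear false β) :
    tensor M N →ₗ[Env k A] tensor M' N' :=
  let f : M →ₗ[k] N →ₗ[k] tensor M' N' := ∑ i, (tmulₗ M' N').compl₁₂
    (α ∘ₗ M.ac false (F.uu true i)) (β ∘ₗ N.ac true (F.vv true i))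
  have hf : ∀ m n, f m n = ∑ i, tmul (α (M.ac false (F.uu true i) m)) (β (N.ac true (F.vv true i) n)) :=
    fun m n => by simp [f, LinearMap.sum_apply, tmulₗ_apply]
  -- The Casimir element placed between the factors makes the expression balanced although `α` need
  -- not be right linear nor `β` left linear.
  have hf' : ∀ a m n, f (M.ac false a m) n = f m (N.ac true a n) := fun a m n => by
    have h := F.casimir true ((tmulₗ M' N').compl₁₂ (α ∘ₗ (M.acₗ false).flip m)
      (β ∘ₗ (N.acₗ true).flip n)) a
    simp only [LinearMap.compl₁₂_apply, LinearMap.comp_apply, LinearMap.flip_apply, acₗ_apply,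
      tmulₗ_apply, ac_mulSide] at h
    simp only [hf, ← h]
    exact Finset.sum_congr rfl fun i _ => by rw [← ac_mulSide]; rfl
  let L : tensor M N →ₗ[k] tensor M' N' := tensorLift f hf'
  have hL : ∀ m n, L (tmul m n) = ∑ i, tmul (α (M.ac false (F.uu true i) m)) (β (N.ac true (F.vv true i) n)) :=
    fun m n => hf m n
  homOfSides L (sideLinear_both (sd := true)
    (fun a z => tensor_congr (L ∘ₗ (tensor M N).ac true a)
      ((tensor M' N').ac true a ∘ₗ L) (fun m n => by
        rw [LinearMap.comp_apply, LinearMap.comp_apply, tensor_ac_true, hL, hL, map_sum]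
        exact Finset.sum_congr rfl fun i _ => by
          rw [tensor_ac_true, ← hα, ac_true_false]) z)
    (fun a z => tensor_congr (L ∘ₗ (tensor M N).ac false a)
      ((tensor M' N').ac false a ∘ₗ L) (fun m n => by
        rw [LinearMap.comp_apply, LinearMap.comp_apply, tensor_ac_false, hL, hL, map_sum]
        exact Finset.sum_congr rfl fun i _ => by
          rw [tensor_ac_false, ← hβ, ac_true_false]) z))

lemma mid_tmul (α : M →ₗ[k] M') (β : N →ₗ[k] N') (hα : SideLinear true α) (hβ : SideLinear false β)
    (m : M) (n : N) : F.mid α β hα hβ (tmul m n) =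
      ∑ i, tmul (α (M.ac false (F.uu true i) m)) (β (N.ac true (F.vv true i) n)) := by
  change (∑ i, (tmulₗ M' N').compl₁₂ (α ∘ₗ M.ac false (F.uu true i))
    (β ∘ₗ N.ac true (F.vv true i))) m n = _
  rw [LinearMap.sum_apply, LinearMap.sum_apply]
  rfl

/-- Tensoring a complex that is contractible over `A` with a relatively projective bimodule on the
right gives a contractible complex of bimodules. -/
lemma mid_contraction_left {X Y Z : Bimodule k A} (d₁ : X →ₗ[Env k A] Y) (d₀ : Y →ₗ[Env k A] Z)
    {σ₁ : Y →ₗ[k] X} {σ₀ : Z →ₗ[k] Y} (h₁ : SideLinear true σ₁) (h₀ : SideLinear true σ₀)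
    (h : ∀ y, d₁ (σ₁ y) + σ₀ (d₀ y) = y) {t : N →ₗ[k] N} (ht : SideLinear false t)
    (ht' : F.tr true t = LinearMap.id) (z : tensor Y N) :
    tensorMap d₁ LinearMap.id (F.mid σ₁ t h₁ ht z) + F.mid σ₀ t h₀ ht (tensorMap d₀ LinearMap.id z)
      = z := by
  refine tensor_congr ((tensorMap d₁ LinearMap.id).restrictScalars k ∘ₗ
    (F.mid σ₁ t h₁ ht).restrictScalars k + (F.mid σ₀ t h₀ ht).restrictScalars k ∘ₗ
    (tensorMap d₀ LinearMap.id).restrictScalars k) LinearMap.id (fun y n => ?_) z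
  simp only [LinearMap.add_apply, LinearMap.comp_apply, LinearMap.coe_restrictScalars, mid_tmul,
    map_sum, tensorMap_tmul, LinearMap.id_apply, ← Finset.sum_add_distrib]
  -- For each `i` the contraction identity leaves `y u_i ⊗ t(v_i n) = y ⊗ u_i t(v_i n)`, and the sum
  -- over `i` is `y` tensored with the trace of `t` at `n`.
  have : ∀ i, tmul (d₁ (σ₁ (Y.ac false (F.uu true i) y))) (t (N.ac true (F.vv true i) n)) +
      tmul (σ₀ (Z.ac false (F.uu true i) (d₀ y))) (t (N.ac true (F.vv true i) n)) =
      tmul y (N.ac true (F.uu true i) (t (N.ac true (F.vv true i) n))) := fun i => by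
    rw [← map_ac d₀, tmul_ac]
    exact ((tmulₗ Y N).map_add₂ _ _ _).symm.trans (by rw [h, tmulₗ_apply])
  simp only [this]
  simp only [← tmulₗ_apply, ← map_sum]
  rw [← tr_apply, ht', LinearMap.id_apply]

/-- Tensoring a complex that is contractible over `A` with a relatively projective bimodule on the
left gives a contractible complex of bimodules. -/
lemma mid_contraction_right {X Y Z : Bimodule k A} (d₁ : X →ₗ[Env k A] Y) (d₀ : Y →ₗ[Env k A] Z)
    {σ₁ : Y →ₗ[k] X} {σ₀ : Z →ₗ[k] Y} (h₁ : SideLinear false σ₁) (h₀ : SideLinear false σ₀)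
    (h : ∀ y, d₁ (σ₁ y) + σ₀ (d₀ y) = y) {t : M →ₗ[k] M} (ht : SideLinear true t)
    (ht' : F.tr false t = LinearMap.id) (z : tensor M Y) :
    tensorMap LinearMap.id d₁ (F.mid t σ₁ ht h₁ z) + F.mid t σ₀ ht h₀ (tensorMap LinearMap.id d₀ z)
      = z := by
  refine tensor_congr ((tensorMap LinearMap.id d₁).restrictScalars k ∘ₗ
    (F.mid t σ₁ ht h₁).restrictScalars k + (F.mid t σ₀ ht h₀).restrictScalars k ∘ₗ
    (tensorMap LinearMap.id d₀).restrictScalars k) LinearMap.id (fun m y => ?_) z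
  simp only [LinearMap.add_apply, LinearMap.comp_apply, LinearMap.coe_restrictScalars, mid_tmul,
    map_sum, tensorMap_tmul, LinearMap.id_apply, ← Finset.sum_add_distrib]
  -- Here `v_i` moves to the left factor; as `F.vv true` and `F.uu false` are both the dual basis,
  -- the sum is the right trace of `t`.
  have : ∀ i, tmul (t (M.ac false (F.uu true i) m)) (d₁ (σ₁ (Y.ac true (F.vv true i) y))) +
      tmul (t (M.ac false (F.uu true i) m)) (σ₀ (Z.ac true (F.vv true i) (d₀ y))) =
      tmul (M.ac false (F.uu false i) (t (M.ac false (F.vv false i) m))) y := fun i => by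
    rw [← map_ac d₀, ← tmul_ac]
    exact ((tmulₗ M Y _).map_add _ _).symm.trans (by rw [h, tmulₗ_apply]; rfl)
  simp only [this]
  simp only [← tmulₗ_apply, ← LinearMap.sum_apply, ← map_sum]
  rw [← tr_apply, ht', LinearMap.id_apply]

end FrobeniusForm

namespace CompleteResolution

variable (T : CompleteResolution k A)

/-- The right linear map `x ↦ x₀ ⊗ x₀ ε(x)` with `ε x₀ = 1` has the required augmentation.
Precomposing it with `t` and taking the left trace gives a bimodule map, and preserves the
augmentation because `ε ⊗ ε` is left linear. -/
lemma exists_diagonal_zero (F : FrobeniusForm k A) :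
    ∃ Δ : T.X 0 →ₗ[Env k A] tensor (T.X 0) (T.X 0), ∀ x, T.augAug (Δ x) = ofRegular (T.ε x) := by
  obtain ⟨x₀, hx₀⟩ := T.ε_surjective (toRegular 1)
  obtain ⟨t, ht, ht'⟩ := T.relProjective F true 0
  let s : T.X 0 →ₗ[k] tensor (T.X 0) (T.X 0) := tmulₗ _ _ x₀ ∘ₗ ((T.X 0).acₗ false).flip x₀ ∘ₗ
    ofRegular ∘ₗ T.ε.restrictScalars k
  have hs : ∀ x, s x = tmul x₀ ((T.X 0).ac false (ofRegular (T.ε x)) x₀) := fun _ => rfl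
  have hs' : SideLinear false s := fun a x => by
    rw [hs, hs, tensor_ac_false, ← ac_mulSide, map_ac, ofRegular_ac]
  have haug : ∀ (a : A) z, T.augAug ((tensor (T.X 0) (T.X 0)).ac true a z) = a * T.augAug z :=
    fun a z => tensor_congr (T.augAug ∘ₗ (tensor (T.X 0) (T.X 0)).ac true a)
      (LinearMap.mulLeft k a ∘ₗ T.augAug) (fun x y => by
        rw [LinearMap.comp_apply, LinearMap.comp_apply, tensor_ac_true]
        change ofRegular (T.ε ((T.X 0).ac true a x)) * ofRegular (T.ε y) =
          a * (ofRegular (T.ε x) * ofRegular (T.ε y))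
        rw [map_ac, ofRegular_ac]
        exact mul_assoc _ _ _) z
  refine ⟨F.trHom true (s ∘ₗ t) (hs'.comp ht), fun x => ?_⟩
  have h₁ : ∀ y, T.augAug (s y) = ofRegular (T.ε y) := fun y => by
    rw [hs]
    change ofRegular (T.ε x₀) * ofRegular (T.ε _) = _
    rw [map_ac, hx₀, ofRegular_ac]
    exact (one_mul _).trans (one_mul _)
  change T.augAug (F.tr true (s ∘ₗ t) x) = _
  conv_rhs => rw [← LinearMap.id_apply (R := k) x, ← ht']
  simp only [FrobeniusForm.tr_apply, map_sum, haug, LinearMap.comp_apply, h₁, map_ac, ofRegular_ac]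
  rfl

end CompleteResolution

end TateHochschild

/-! ### Existence of diagonal approximations -/

namespace TateHochschild

open Bimodule

variable {k : Type v} {A : Type u} [Field k] [Ring A] [Algebra k A] [FiniteDimensional k A]

namespace CompleteResolution

variable (T : CompleteResolution k A)

/-- The degree zero part of a diagonal approximation. -/
lemma exists_diagonal_degree_zero (F : FrobeniusForm k A) :
    ∃ Δ : ∀ p q : ℤ, p + q = 0 → (T.X 0 →ₗ[Env k A] tensor (T.X p) (T.X q)),
      (∀ x, T.augAug (Δ 0 0 (add_zero 0) x) = ofRegular (T.ε x)) ∧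
      ∀ p q h, totalDiff Δ p q h ∘ₗ T.d (0 + 1) 0 rfl = 0 := by
  obtain ⟨σl, hσl, hσl'⟩ := T.exists_contraction F true
  obtain ⟨σr, hσr, hσr'⟩ := T.exists_contraction F false
  choose tl htl htl' using fun i => T.relProjective F true i
  choose tr htr htr' using fun i => T.relProjective F false i
  obtain ⟨Δ₀, hΔ₀⟩ := T.exists_diagonal_zero F
  have hs : ∀ (c : k) {P Q : Bimodule k A} (g : P →ₗ[Env k A] Q) (z : P), g (c • z) = c • g z :=
    fun c P Q g z => (g.restrictScalars k).map_smul c z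
  have hsign : ∀ p : ℤ, ((-1 : k) ^ p) * ((-1 : k) ^ p) = 1 := fun p => by
    rw [← mul_zpow, neg_one_mul, neg_neg, one_zpow]
  let G : ℤ → Type _ := fun p => ∀ q : ℤ, p + q = 0 → (T.X 0 →ₗ[Env k A] tensor (T.X p) (T.X q))
  -- The index is `p`, along the antidiagonal `p + q = 0`. Neighbouring components must cancel in
  -- the total differential after composition with `d`, and the invariant that permits the next step
  -- is `(d ⊗ d) f d = 0`; at `p = 0` it holds because `ε d = 0`.
  obtain ⟨Δ, h0, hR⟩ := exists_int_seq (F := G)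
    (fun p f g => ∀ q q' (hq : q + 1 = q') (h : p + q' = 0) (x : T.X (0 + 1)),
      tensorMap (T.d (p + 1) p rfl) LinearMap.id (g q (by omega) (T.d (0 + 1) 0 rfl x)) +
      ((-1 : k) ^ p) • tensorMap LinearMap.id (T.d q' q hq) (f q' h (T.d (0 + 1) 0 rfl x)) = 0)
    (fun p f => ∀ l q q' (hl : l + 1 = p) (hq : q + 1 = q') (h : p + q' = 0) (x : T.X (0 + 1)),
      tensorMap (T.d p l hl) LinearMap.id (tensorMap LinearMap.id (T.d q' q hq)
        (f q' h (T.d (0 + 1) 0 rfl x))) = 0)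
    (fun q h => by
      obtain rfl : q = 0 := by omega
      exact Δ₀)
    (fun l q q' hl hq h x => by
      obtain rfl : q' = 0 := by omega
      obtain rfl : q = -1 := by omega
      obtain rfl : l = -1 := by omega
      rw [tensorMap_comp]
      refine tensorMap_d_d_eq_zero ?_
      refine (hΔ₀ _).trans ?_
      exact (congrArg ofRegular (T.ε_d x)).trans (map_zero _))
    (fun p f hf => by
      -- To raise `p`, the first factor is contracted: the invariant says that `(1 ⊗ d) f d` is
      -- killed by `d ⊗ 1`, hence is recovered by applying `d ⊗ 1` to its image under the
      -- contraction.
      refine ⟨fun q h => (-((-1 : k) ^ p)) • (F.mid (σl p (p + 1) rfl) (tl q) (hσl _ _ _) (htl q) ∘ₗ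
        tensorMap LinearMap.id (T.d (q + 1) q rfl) ∘ₗ f (q + 1) (by omega)), ?_, ?_⟩
      · rintro q _ rfl h x
        have h₁ := F.mid_contraction_left (T.d (p + 1) p rfl) (T.d p (p - 1) (by omega))
          (hσl _ _ rfl) (hσl _ _ (by omega)) (hσl' _ _ _ rfl (by omega)) (htl q) (htl' q)
          (tensorMap LinearMap.id (T.d (q + 1) q rfl) (f (q + 1) h (T.d (0 + 1) 0 rfl x)))
        rw [hf, map_zero, add_zero] at h₁
        simp only [LinearMap.smul_apply, LinearMap.comp_apply, hs, h₁]
        rw [← add_smul, neg_add_cancel, zero_smul]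
      · rintro l q _ hl rfl h x
        obtain rfl : l = p := by omega
        have h₁ := F.mid_contraction_left (T.d (l + 1) l rfl) (T.d l (l - 1) (by omega))
          (hσl _ _ rfl) (hσl _ _ (by omega)) (hσl' _ _ _ rfl (by omega)) (htl (q + 1)) (htl' (q + 1))
          (tensorMap LinearMap.id (T.d (q + 1 + 1) (q + 1) rfl) (f (q + 1 + 1) (by omega) (T.d (0 + 1) 0 rfl x)))
        rw [hf, map_zero, add_zero] at h₁
        simp only [LinearMap.smul_apply, LinearMap.comp_apply, hs, tensorMap_d_comm, h₁,
          tensorMap_d_d_right, smul_zero])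
    (fun p g hg => by
      -- To lower `p`, the second factor is contracted instead.
      refine ⟨fun q h => (-((-1 : k) ^ p)) • (F.mid (tr p) (σr (q - 1) q (by omega)) (htr p) (hσr _ _ _) ∘ₗ
        tensorMap (T.d (p + 1) p rfl) LinearMap.id ∘ₗ g (q - 1) (by omega)), ?_, ?_⟩
      · rintro q _ rfl h x
        have h₀ := hg p (q - 1) q rfl (by omega) (by omega) x
        rw [tensorMap_d_comm] at h₀
        have h₁ := F.mid_contraction_right (T.d (q + 1) q rfl) (T.d q (q - 1) (by omega))
          (hσr _ _ rfl) (hσr _ _ (by omega)) (hσr' _ _ _ rfl (by omega)) (htr p) (htr' p)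
          (tensorMap (T.d (p + 1) p rfl) LinearMap.id (g q (by omega) (T.d (0 + 1) 0 rfl x)))
        rw [h₀, map_zero, add_zero] at h₁
        -- This only identifies the index `q + 1 - 1`, produced by the definition of the new
        -- component, with `q`.
        have h₂ : ∀ l (hl : l = q) (h' : p + 1 + l = 0) (h'' : l + 1 = q + 1),
            F.mid (tr p) (σr l (q + 1) h'') (htr p) (hσr _ _ _)
              (tensorMap (T.d (p + 1) p rfl) LinearMap.id (g l h' (T.d (0 + 1) 0 rfl x))) =
            F.mid (tr p) (σr q (q + 1) rfl) (htr p) (hσr _ _ _)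
              (tensorMap (T.d (p + 1) p rfl) LinearMap.id (g q (by omega) (T.d (0 + 1) 0 rfl x))) := by
          rintro _ rfl _ _
          rfl
        simp only [LinearMap.smul_apply, LinearMap.comp_apply, hs, smul_smul, mul_neg, hsign]
        rw [h₂ (q + 1 - 1) (by omega), h₁, neg_smul, one_smul, add_neg_cancel]
      · rintro l q q' rfl hq h x
        obtain ⟨i, rfl⟩ : ∃ i, q' = i := ⟨q', rfl⟩
        simp only [LinearMap.smul_apply, LinearMap.comp_apply, hs]
        obtain rfl : q = q' - 1 := by omega
        have h₀ := hg (l + 1) (q' - 1 - 1) (q' - 1) rfl (by omega) (by omega) x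
        rw [tensorMap_d_comm] at h₀
        have h₁ := F.mid_contraction_right (T.d q' (q' - 1) hq) (T.d (q' - 1) (q' - 1 - 1) (by omega))
          (hσr _ _ hq) (hσr _ _ (by omega)) (hσr' _ _ _ hq (by omega)) (htr (l + 1)) (htr' (l + 1))
          (tensorMap (T.d (l + 1 + 1) (l + 1) rfl) LinearMap.id (g (q' - 1) (by omega) (T.d (0 + 1) 0 rfl x)))
        rw [h₀, map_zero, add_zero] at h₁
        rw [h₁, tensorMap_d_d_left, smul_zero])
  refine ⟨Δ, fun x => ?_, fun p q h => LinearMap.ext fun x => ?_⟩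
  · rw [h0]
    exact hΔ₀ x
  · exact hR p q (q + 1) rfl (by omega) x

/-- The induction runs over `n` from the degree zero part, with invariant `D f d = 0` for the total
differential `D`. -/
theorem nonempty_diagonalApproximation (F : FrobeniusForm k A) : Nonempty T.DiagonalApproximation := by
  obtain ⟨σ, hσ, hσ'⟩ := T.exists_contraction F false
  choose t ht ht' using fun i => T.relProjective F true i
  obtain ⟨Δ₀, haug, hΔ₀⟩ := T.exists_diagonal_degree_zero F
  have hs : ∀ (c : k) {P Q : Bimodule k A} (g : P →ₗ[Env k A] Q) (z : P), g (c • z) = c • g z :=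
    fun c P Q g z => (g.restrictScalars k).map_smul c z
  -- `S = σ ⊗ 1` needs no sign: the terms containing `1 ⊗ d` in `D S + S D` cancel, since raising
  -- `p` changes `(-1)^p`. It acts component by component, so it contracts the product complex with
  -- no convergence question.
  let S : ∀ (i j : ℤ) (h : i + 1 = j) (N : Bimodule k A), tensor (T.X i) N →ₗ[k] tensor (T.X j) N :=
    fun i j h N => tmap (σ i j h) LinearMap.id (hσ i j h) SideLinear.id
  have hS : ∀ i j h N, SideLinear false (S i j h N) := fun i j h N =>
    sideLinear_tmap_false _ _ SideLinear.id
  have hSd : ∀ (i j l : ℤ) (h : j + 1 = i) (h' : l + 1 = j) (N : Bimodule k A)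
      (z : tensor (T.X j) N), tensorMap (T.d i j h) LinearMap.id (S j i h N z) +
        S l j h' N (tensorMap (T.d j l h') LinearMap.id z) = z := fun i j l h h' N z =>
    tensor_congr ((tensorMap (T.d i j h) LinearMap.id).restrictScalars k ∘ₗ S j i h N +
      S l j h' N ∘ₗ (tensorMap (T.d j l h') LinearMap.id).restrictScalars k) LinearMap.id
      (fun x n => ((tmulₗ _ N).map_add₂ _ _ n).symm.trans
        (congrArg (fun y => tmul y n) (hσ' i j l h h' x))) z
  have hSR : ∀ (i j : ℤ) (h : i + 1 = j) {N N' : Bimodule k A} (g : N →ₗ[Env k A] N')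
      (z : tensor (T.X i) N), tensorMap LinearMap.id g (S i j h N z) =
        S i j h N' (tensorMap LinearMap.id g z) := fun i j h N N' g z =>
    tensor_congr ((tensorMap LinearMap.id g).restrictScalars k ∘ₗ S i j h N)
      (S i j h N' ∘ₗ (tensorMap LinearMap.id g).restrictScalars k) (fun _ _ => rfl) z
  let G : ℤ → Type _ := fun n => ∀ p q : ℤ, p + q = n → (T.X n →ₗ[Env k A] tensor (T.X p) (T.X q))
  obtain ⟨Δ, h0, hR⟩ := exists_int_seq (F := G)
    (fun n f g => ∀ p q (h : p + q = n), totalDiff g p q (by omega) = f p q h ∘ₗ T.d (n + 1) n rfl)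
    (fun n f => ∀ p q (h : p + q + 1 = n), totalDiff f p q h ∘ₗ T.d (n + 1) n rfl = 0) Δ₀ hΔ₀
    (fun n f hf => by
      -- The right linear lift `S f d` is precomposed with `t`, and its left trace is the bimodule
      -- map of degree `n + 1`.
      let a : ∀ l p q : ℤ, l + 1 = p → l + q = n → (T.X (n + 1) →ₗ[k] tensor (T.X p) (T.X q)) :=
        fun l p q h h' => S l p h (T.X q) ∘ₗ
          (f l q h').restrictScalars k ∘ₗ (T.d (n + 1) n rfl).restrictScalars k ∘ₗ t (n + 1)
      have ha : ∀ l p q h h', SideLinear false (a l p q h h') := fun l p q h h' =>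
        (hS _ _ _ _).comp ((sideLinear_of_hom _ _).comp ((sideLinear_of_hom _ _).comp (ht _)))
      let g : G (n + 1) := fun p q h => F.trHom true (a (p - 1) p q (by omega) (by omega)) (ha _ _ _ _ _)
      have hg : ∀ l p q (h : l + 1 = p) (h' : l + q = n) x, g p q (by omega) x =
          F.tr true (a l p q h h') x := fun l p q h h' x => by
        obtain rfl : l = p - 1 := by omega
        rfl
      have hg' : ∀ p q (h : p + q = n), totalDiff g p q (by omega) = f p q h ∘ₗ T.d (n + 1) n rfl := by
        intro p q h
        obtain ⟨l, rfl⟩ : ∃ l, p = l + 1 := ⟨p - 1, by omega⟩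
        ext x
        rw [totalDiff_apply, hg (l + 1) (l + 1 + 1) q rfl h, hg l (l + 1) (q + 1) rfl (by omega)]
        conv_rhs => rw [← LinearMap.id_apply (R := k) x, ← ht' (n + 1)]
        simp only [FrobeniusForm.tr_apply, map_sum, map_ac, LinearMap.comp_apply]
        rw [Finset.smul_sum, ← Finset.sum_add_distrib]
        refine Finset.sum_congr rfl fun i _ => ?_
        rw [← map_smul, ← map_add]
        refine congrArg _ ?_
        set y := t (n + 1) ((T.X (n + 1)).ac true (F.vv true i) x)
        have h₁ := LinearMap.congr_fun (hf l q (by omega)) y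
        rw [LinearMap.comp_apply, totalDiff_apply, LinearMap.zero_apply] at h₁
        have h₂ := hSd (l + 1 + 1) (l + 1) l rfl rfl (T.X q) (f (l + 1) q h (T.d (n + 1) n rfl y))
        rw [eq_neg_of_add_eq_zero_left h₁, map_neg, map_smul, ← hSR] at h₂
        rw [zpow_add_one₀ (by simp), mul_neg_one, neg_smul]
        exact h₂
      refine ⟨g, hg', fun p q h => ?_⟩
      rw [hg' p q (by omega), LinearMap.comp_assoc, d_comp_d, LinearMap.comp_zero])
    (fun n g hg => by
      -- Downwards each component of `D g` is extended separately along `d`, as `T_p ⊗_A T_q` is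
      -- relatively projective for the left side. The invariant is then `D D = 0`.
      choose f hf using fun p q (h : p + q = n) => F.exists_extension true
        ((T.relProjective F true p).tensor_true (T.X q))
        (T.d (n + 1 + 1) (n + 1) rfl) (T.d (n + 1) n rfl) (hσ _ _ _) (hσ' _ _ _ rfl rfl)
        (totalDiff g p q (by omega)) (hg p q (by omega))
      refine ⟨f, fun p q h => (hf p q h).symm, fun p q h => LinearMap.ext fun x => ?_⟩
      have hf' : ∀ p q (h : p + q = n) x, f p q h (T.d (n + 1) n rfl x) =
        totalDiff g p q (by omega) x := fun p q h x => LinearMap.congr_fun (hf p q h) x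
      rw [LinearMap.comp_apply, totalDiff_apply, hf', hf']
      exact totalDiff_totalDiff g p q (by omega) x)
  refine ⟨⟨Δ, ?_, by rw [h0]; exact haug⟩⟩
  rintro n p q rfl
  exact hR (p + q) p q rfl

end CompleteResolution

end TateHochschild

/-! ### The product induced by a diagonal approximation -/

namespace TateHochschild

open Bimodule

variable {k : Type v} {A : Type u} [Field k] [Ring A] [Algebra k A]

/-- A bilinear map that vanishes on submodules descends to the quotients. -/
lemma exists_bilinear_of_quotients {V W U : Type*} [AddCommGroup V] [Module k V] [AddCommGroup W]
    [Module k W] [AddCommGroup U] [Module k U] (p : Submodule k V) (q : Submodule k W)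
    (B : V →ₗ[k] W →ₗ[k] U) (hp : ∀ v ∈ p, ∀ w, B v w = 0) (hq : ∀ v, ∀ w ∈ q, B v w = 0) :
    ∃ C : V ⧸ p →ₗ[k] W ⧸ q →ₗ[k] U, ∀ v w, C (p.mkQ v) (q.mkQ w) = B v w :=
  ⟨p.liftQ
    { toFun := fun v => q.liftQ (B v) fun w hw => hq v w hw
      map_add' := fun v v' => Submodule.linearMap_qext _ (LinearMap.ext fun w => B.map_add₂ v v' w)
      map_smul' := fun c v => Submodule.linearMap_qext _ (LinearMap.ext fun w => B.map_smul₂ c v w) }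
    fun v hv => Submodule.linearMap_qext _ (LinearMap.ext fun w => hp v hv w), fun _ _ => rfl⟩

namespace Bimodule

lemma tensorMap_comp_hom {M N M' N' M'' N'' : Bimodule k A} (f : M →ₗ[Env k A] M')
    (g : N →ₗ[Env k A] N') (f' : M' →ₗ[Env k A] M'') (g' : N' →ₗ[Env k A] N'') :
    tensorMap f' g' ∘ₗ tensorMap f g = tensorMap (f' ∘ₗ f) (g' ∘ₗ g) :=
  LinearMap.ext fun z => tensorMap_comp f g f' g' z

lemma tensorMap_id {M N : Bimodule k A} :
    tensorMap (LinearMap.id : M →ₗ[Env k A] M) (LinearMap.id : N →ₗ[Env k A] N) = LinearMap.id :=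
  LinearMap.ext fun z => tensor_congr ((tensorMap LinearMap.id LinearMap.id).restrictScalars k)
    LinearMap.id (fun _ _ => rfl) z

lemma envTensor_tensor_congr {X M N : Bimodule k A} {V : Type*} [AddCommGroup V] [Module k V]
    (f g : EnvTensor (tensor X M) N →ₗ[k] V)
    (h : ∀ x m n, f (etmul (tmul x m) n) = g (etmul (tmul x m) n)) (z : EnvTensor (tensor X M) N) :
    f z = g z :=
  LinearMap.congr_fun (envTensor_ext fun w n => tensor_congr (f ∘ₗ (etmulₗ _ N).flip n)
    (g ∘ₗ (etmulₗ _ N).flip n) (fun x m => h x m n) w) z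

lemma envMap_envAssoc {X M N X' M' N' : Bimodule k A} (f : X →ₗ[Env k A] X')
    (g : M →ₗ[Env k A] M') (h : N →ₗ[Env k A] N') (z : EnvTensor (tensor X M) N) :
    envMap f (tensorMap g h) (envAssoc X M N z) =
      envAssoc X' M' N' (envMap (tensorMap f g) h z) :=
  envTensor_tensor_congr (envMap f (tensorMap g h) ∘ₗ envAssoc X M N)
    (envAssoc X' M' N' ∘ₗ envMap (tensorMap f g) h) (fun _ _ _ => rfl) z

lemma tensorMap_add_right {X M M' : Bimodule k A} (g g' : M →ₗ[Env k A] M') :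
    tensorMap (LinearMap.id : X →ₗ[Env k A] X) (g + g') =
      tensorMap LinearMap.id g + tensorMap LinearMap.id g' :=
  LinearMap.ext fun z => by
    rw [LinearMap.add_apply]
    exact tensor_congr ((tensorMap LinearMap.id (g + g')).restrictScalars k)
      ((tensorMap LinearMap.id g).restrictScalars k + (tensorMap LinearMap.id g').restrictScalars k)
      (fun x m => by rw [LinearMap.add_apply]; exact (tmulₗ X M' x).map_add (g m) (g' m)) z

lemma hom_comp_smul {P Q R : Bimodule k A} (c : k) (f : Q →ₗ[Env k A] R) (g : P →ₗ[Env k A] Q) :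
    f ∘ₗ (c • g) = c • (f ∘ₗ g) :=
  LinearMap.ext fun x => (f.restrictScalars k).map_smul c (g x)

lemma tensorMap_smul_right {X M M' : Bimodule k A} (c : k) (g : M →ₗ[Env k A] M') :
    tensorMap (LinearMap.id : X →ₗ[Env k A] X) (c • g) = c • tensorMap LinearMap.id g :=
  LinearMap.ext fun z => tensor_congr ((tensorMap LinearMap.id (c • g)).restrictScalars k)
    (c • (tensorMap LinearMap.id g).restrictScalars k)
    (fun x m => (tmulₗ X M' x).map_smul c (g m)) z

lemma mem_invariants {M : Bimodule k A} {m : M} :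
    m ∈ M.invariants ↔ ∀ a, M.ac true a m = M.ac false a m := by
  simp only [invariants, Submodule.mem_iInf, LinearMap.mem_ker, LinearMap.sub_apply, sub_eq_zero]
  rfl

lemma ac_sub_ac_mem_commutators {M : Bimodule k A} (a : A) (m : M) :
    M.ac true a m - M.ac false a m ∈ M.commutators :=
  Submodule.mem_iSup_of_mem a ⟨m, rfl⟩

lemma commutators_le {M : Bimodule k A} {p : Submodule k M}
    (h : ∀ a m, M.ac true a m - M.ac false a m ∈ p) : M.commutators ≤ p :=
  iSup_le fun a => by
    rintro _ ⟨m, rfl⟩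
    exact h a m

/-- Tensoring with an invariant element on the left, on coinvariants. -/
lemma tmul_mem_commutators {M N : Bimodule k A} {m : M} (hm : m ∈ M.invariants) {n : N}
    (hn : n ∈ N.commutators) : tmul m n ∈ (tensor M N).commutators := by
  have h : N.commutators ≤ (tensor M N).commutators.comap (tmulₗ M N m) := commutators_le fun a n => by
    rw [Submodule.mem_comap, map_sub, tmulₗ_apply, tmulₗ_apply, tmul_ac, ← mem_invariants.1 hm,
      ← tensor_ac_true, ← tensor_ac_false]
    exact ac_sub_ac_mem_commutators a _
  exact h hn

end Bimodule

/-! ### The norm and the twisted norm on tensor products -/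

namespace FrobeniusForm

variable [FiniteDimensional k A] (F : FrobeniusForm k A)

/-- This rewrites `∑ u_i ⊗ ν(v_i)` as `∑ v_i ⊗ u_i`, so the twisted norm becomes `n ↦ ∑ v_i n u_i`
and the Nakayama automorphism is not needed afterwards. Expand `u_i` in the dual basis and use
`⟨u_i, u_j⟩ = ⟨ν⁻¹ u_j, u_i⟩`. -/
lemma sum_basis_nakayama {V : Type*} [AddCommGroup V] [Module k V] (β : A →ₗ[k] A →ₗ[k] V) :
    ∑ i, β (basis k A i) (F.nakayama (F.dualBasis i)) = ∑ i, β (F.dualBasis i) (basis k A i) := by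
  have h₁ : ∀ i, β (basis k A i) (F.nakayama (F.dualBasis i)) = ∑ j,
      F.form (basis k A i) (basis k A j) • β (F.dualBasis j) (F.nakayama (F.dualBasis i)) := fun i => by
    conv_lhs => rw [← F.sum_form_smul_dualBasis (basis k A i)]
    simp
  have h₂ : ∀ j, ∑ i, F.form (basis k A i) (basis k A j) • F.nakayama (F.dualBasis i) =
      basis k A j := fun j => by
    have h₃ : ∀ i, F.form (basis k A i) (basis k A j) =
        F.form (F.nakayama.symm (basis k A j)) (basis k A i) := fun i => by
      rw [← F.form_nakayama (F.nakayama.symm _), LinearEquiv.apply_symm_apply]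
    simp only [h₃, ← map_smul]
    rw [← map_sum, F.sum_form_smul_dualBasis, LinearEquiv.apply_symm_apply]
  simp only [h₁]
  rw [Finset.sum_comm]
  refine Finset.sum_congr rfl fun j _ => ?_
  conv_rhs => rw [← h₂ j]
  simp

variable {M N : Bimodule k A}

lemma twistedNorm_apply (m : M) :
    F.twistedNorm M m = ∑ i, M.ac true (F.dualBasis i) (M.ac false (basis k A i) m) := by
  have h := F.sum_basis_nakayama (LinearMap.mk₂ k (fun x y => M.ac true x (M.ac false y m))
    (fun x y z => by simp [ac_add]) (fun c x y => by simp [ac_smul])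
    (fun x y z => by simp [ac_add]) (fun c x y => by simp [ac_smul]))
  simp only [LinearMap.mk₂_apply] at h
  rw [← h, twistedNorm, LinearMap.sum_apply]
  rfl

lemma norm_apply (m : M) :
    F.norm M m = ∑ i, M.ac true (basis k A i) (M.ac false (F.dualBasis i) m) := by
  rw [norm, LinearMap.sum_apply]
  rfl

/-- Invariance gives `v_i m ⊗ n u_i = m v_i ⊗ n u_i = m ⊗ v_i n u_i`. -/
lemma twistedNorm_tmul {m : M} (hm : m ∈ M.invariants) (n : N) :
    F.twistedNorm (tensor M N) (tmul m n) = tmul m (F.twistedNorm N n) := by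
  rw [twistedNorm_apply, twistedNorm_apply]
  refine Eq.trans ?_ (map_sum (tmulₗ M N m) _ _).symm
  refine Finset.sum_congr rfl fun i _ => ?_
  rw [tmulₗ_apply, tensor_ac_false, tensor_ac_true, mem_invariants.1 hm, tmul_ac]

/-- One has `∑ u_i m v_i ⊗ n = ∑ u_i (m ⊗ v_i n)`, while `∑ (m ⊗ v_i n) u_i = m ⊗ ∑ v_i n u_i = 0`;
the difference is a sum of commutators. -/
lemma norm_tmul_mem_commutators (m : M) {n : N} (hn : F.twistedNorm N n = 0) :
    tmul (F.norm M m) n ∈ (tensor M N).commutators := by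
  have h : tmul (F.norm M m) n = ∑ i, ((tensor M N).ac true (basis k A i) (tmul m (N.ac true (F.dualBasis i) n))
      - (tensor M N).ac false (basis k A i) (tmul m (N.ac true (F.dualBasis i) n))) := by
    have h₁ : tmul m (F.twistedNorm N n) = 0 := by rw [hn, ← tmulₗ_apply, map_zero]
    rw [twistedNorm_apply, ← tmulₗ_apply, map_sum] at h₁
    simp only [tensor_ac_false, ← ac_true_false]
    rw [Finset.sum_sub_distrib]
    refine Eq.trans ?_ (sub_eq_self.2 h₁).symm
    rw [norm_apply, ← tmulₗ_apply, map_sum, LinearMap.sum_apply]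
    refine Finset.sum_congr rfl fun i _ => ?_
    rw [tmulₗ_apply, tensor_ac_true, tmul_ac, ac_true_false]
  rw [h]
  exact Submodule.sum_mem _ fun i _ => ac_sub_ac_mem_commutators _ _

end FrobeniusForm

/-! ### The cap product on chains -/

namespace CompleteResolution

variable {T : CompleteResolution k A}

namespace DiagonalApproximation

variable (Δ : T.DiagonalApproximation) {M N : Bimodule k A}

/-- The cap product on chains without its sign. -/
def capRaw (N : Bimodule k A) {p r s : ℤ} (h : p + r = s) (u : T.X r →ₗ[Env k A] M) :
    EnvTensor (T.X s) N →ₗ[k] EnvTensor (T.X p) (tensor M N) :=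
  envAssoc (T.X p) M N ∘ₗ envMap (tensorMap LinearMap.id u) LinearMap.id ∘ₗ
    envMap (Δ.app s p r h) LinearMap.id

lemma capChain_eq {r : ℤ} (s : ℤ) (u : T.X r →ₗ[Env k A] M) (z : EnvTensor (T.X s) N) :
    Δ.capChain N s u z = ((-1 : k) ^ (r * (s - r))) • Δ.capRaw N (sub_add_cancel s r) u z := rfl

lemma capRaw_eq {p r s : ℤ} (h : p + r = s) (u : T.X r →ₗ[Env k A] M) (z : EnvTensor (T.X s) N) :
    Δ.capRaw N h u z =
      envAssoc (T.X p) M N (envMap (tensorMap LinearMap.id u ∘ₗ Δ.app s p r h) LinearMap.id z) := by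
  rw [capRaw, LinearMap.comp_apply, LinearMap.comp_apply, envMap_comp, LinearMap.id_comp]

lemma capRaw_add {p r s : ℤ} (h : p + r = s) (u u' : T.X r →ₗ[Env k A] M)
    (z : EnvTensor (T.X s) N) :
    Δ.capRaw N h (u + u') z = Δ.capRaw N h u z + Δ.capRaw N h u' z := by
  simp only [capRaw_eq, tensorMap_add_right, LinearMap.add_comp, envMap_add_left, map_add]

lemma capRaw_smul {p r s : ℤ} (h : p + r = s) (c : k) (u : T.X r →ₗ[Env k A] M)
    (z : EnvTensor (T.X s) N) : Δ.capRaw N h (c • u) z = c • Δ.capRaw N h u z := by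
  simp only [capRaw_eq, tensorMap_smul_right, LinearMap.smul_comp, envMap_smul_left, map_smul]

lemma capRaw_zero {p r s : ℤ} (h : p + r = s) (z : EnvTensor (T.X s) N) :
    Δ.capRaw N h (0 : T.X r →ₗ[Env k A] M) z = 0 := by
  have := Δ.capRaw_smul h (0 : k) (0 : T.X r →ₗ[Env k A] M) z
  rwa [zero_smul, zero_smul] at this

lemma envMap_capRaw {p r s : ℤ} (h : p + r = s) {M' N' : Bimodule k A} (f : M →ₗ[Env k A] M')
    (g : N →ₗ[Env k A] N') (u : T.X r →ₗ[Env k A] M) (z : EnvTensor (T.X s) N) :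
    envMap LinearMap.id (tensorMap f g) (Δ.capRaw N h u z) =
      Δ.capRaw N' h (f ∘ₗ u) (envMap LinearMap.id g z) := by
  rw [capRaw_eq, capRaw_eq, envMap_envAssoc, envMap_comp, envMap_comp, ← LinearMap.comp_assoc,
    tensorMap_comp_hom]
  simp only [LinearMap.comp_id, LinearMap.id_comp]

/-- This is the component of `D Δ = Δ d` in `T_p ⊗ T_r`, with `u` applied to the second factor. -/
lemma diff_capRaw {p p' r r' s s' : ℤ} (hp : p + 1 = p') (hr : r + 1 = r') (hs : s' + 1 = s)
    (h : p' + r = s) (u : T.X r →ₗ[Env k A] M) (z : EnvTensor (T.X s) N) :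
    T.diff (tensor M N) p' p hp (Δ.capRaw N h u z) =
      Δ.capRaw N (by omega) u (T.diff N s s' hs z) -
        ((-1 : k) ^ p) • Δ.capRaw N (by omega : p + r' = s) (u ∘ₗ T.d r' r hr) z := by
  subst hp hr
  obtain rfl : s' = p + r := by omega
  have e : envMap (T.d (p + 1) p rfl) LinearMap.id ∘ₗ envAssoc (T.X (p + 1)) M N =
      envAssoc (T.X p) M N ∘ₗ envMap (tensorMap (T.d (p + 1) p rfl) LinearMap.id) LinearMap.id :=
    LinearMap.ext fun w => by
      have := envMap_envAssoc (T.d (p + 1) p rfl) (LinearMap.id : M →ₗ[Env k A] M)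
        (LinearMap.id : N →ₗ[Env k A] N) w
      rwa [tensorMap_id] at this
  rw [eq_sub_iff_add_eq, diff, capRaw_eq, ← LinearMap.comp_apply, e, LinearMap.comp_apply,
    envMap_comp, ← LinearMap.comp_assoc, tensorMap_comp_hom, capRaw_eq, capRaw_eq, diff,
    envMap_comp, ← map_smul, ← map_add, ← envMap_smul_left]
  simp only [LinearMap.comp_id, LinearMap.id_comp]
  rw [← envMap_add_left, LinearMap.comp_assoc, ← Δ.comm s p r hs, LinearMap.comp_add, hom_comp_smul,
    ← LinearMap.comp_assoc, ← LinearMap.comp_assoc, tensorMap_comp_hom, tensorMap_comp_hom]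
  rfl

/-- The Leibniz rule `d(u ⌢ z) = (-1)^r u ⌢ dz + δu ⌢ z`. The sign in the chain-level product and
that in `codiff` are what leave the last term without a sign. -/
lemma diff_capChain {r s j : ℤ} (h : j + 1 = s - r) (u : T.X r →ₗ[Env k A] M)
    (z : EnvTensor (T.X s) N) :
    T.diff (tensor M N) (s - r) j h (Δ.capChain N s u z) =
      ((-1 : k) ^ r) • ((-1 : k) ^ (r * j)) •
        Δ.capRaw N (by omega) u (T.diff N s (s - 1) (sub_add_cancel s 1) z) +
      ((-1 : k) ^ ((r + 1) * j)) • Δ.capRaw N (by omega) (T.codiff M r (r + 1) rfl u) z := by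
  have hne : (-1 : k) ≠ 0 := by simp
  have hc : T.codiff M r (r + 1) rfl u = ((-1 : k) ^ (r + 1)) • (u ∘ₗ T.d (r + 1) r rfl) := rfl
  have hz : ((-1 : k) ^ (r * (s - r))) = (-1) ^ (r * j) * (-1) ^ r := by
    rw [← h, mul_add, mul_one, zpow_add₀ hne]
  rw [capChain_eq, map_smul, Δ.diff_capRaw h rfl (sub_add_cancel s 1), hc, capRaw_smul, hz,
    add_mul, one_mul, zpow_add₀ hne, zpow_add_one₀ hne]
  module

variable {r s : ℤ}

lemma capChain_mem_cycles (u : T.cocycles M r) (z : T.cycles N s) :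
    Δ.capChain N s u.1 z.1 ∈ T.cycles (tensor M N) (s - r) := by
  rw [T.mem_cycles (sub_add_cancel (s - r) 1), diff_capChain, (T.mem_cycles _ z.1).1 z.2,
    (show T.codiff M r (r + 1) rfl u.1 = 0 from u.2), capRaw_zero, map_zero]
  simp

/-- The product in (co)homology induced by a diagonal approximation. -/
lemma exists_induces : ∃ c : T.Pairing, Δ.Induces c := by
  have key : ∀ (M N : Bimodule k A) (r s : ℤ),
      ∃ C : T.Cohomology M r →ₗ[k] T.Homology N s →ₗ[k] T.Homology (tensor M N) (s - r),
        ∀ (u : T.cocycles M r) (z : T.cycles N s), C (T.cohMk M r u) (T.homMk N s z) =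
          T.homMk (tensor M N) (s - r) ⟨Δ.capChain N s u.1 z.1, Δ.capChain_mem_cycles u z⟩ := by
    intro M N r s
    let B : T.cocycles M r →ₗ[k] T.cycles N s →ₗ[k] T.Homology (tensor M N) (s - r) :=
      LinearMap.mk₂ k (fun u z => T.homMk (tensor M N) (s - r)
        ⟨Δ.capChain N s u.1 z.1, Δ.capChain_mem_cycles u z⟩)
        (fun u u' z => by
          rw [← map_add]
          refine congrArg _ (Subtype.ext ?_)
          change Δ.capChain N s (u.1 + u'.1) z.1 = Δ.capChain N s u.1 z.1 + Δ.capChain N s u'.1 z.1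
          rw [capChain_eq, capRaw_add, smul_add]
          rfl)
        (fun c u z => by
          rw [← map_smul]
          refine congrArg _ (Subtype.ext ?_)
          change Δ.capChain N s (c • u.1) z.1 = c • Δ.capChain N s u.1 z.1
          rw [capChain_eq, capRaw_smul, smul_comm]
          rfl)
        (fun u z z' => by
          rw [← map_add]
          exact congrArg _ (Subtype.ext (map_add (Δ.capChain N s u.1) z.1 z'.1)))
        (fun c u z => by
          rw [← map_smul]
          exact congrArg _ (Subtype.ext (map_smul (Δ.capChain N s u.1) c z.1)))
    refine exists_bilinear_of_quotients _ _ B ?_ ?_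
    · intro u hu z
      obtain ⟨w, hw⟩ := (T.cohMk_eq_zero_iff (sub_add_cancel r 1) u).1
        ((Submodule.Quotient.mk_eq_zero _).2 hu)
      refine (T.homMk_eq_zero_iff rfl _).2 ?_
      have h := Δ.diff_capRaw (N := N) (p := s - r) rfl (sub_add_cancel r 1) (sub_add_cancel s 1) (by ring) w z.1
      rw [(T.mem_cycles _ z.1).1 z.2, map_zero, zero_sub, hw] at h
      -- For a cycle `z`, the unsigned rule reads `d(w ⌢ z) = -(-1)^(s-r) (w d) ⌢ z`; the scalars
      -- undo this sign and insert that of the product.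
      refine ⟨((-1 : k) ^ (r * (s - r))) • (-((-1 : k) ^ (s - r))⁻¹) •
        Δ.capRaw N (by ring : s - r + 1 + (r - 1) = s) w z.1, ?_⟩
      rw [map_smul, map_smul, h, smul_neg, neg_smul, neg_neg, smul_smul _ _ (Δ.capRaw _ _ _ _),
        inv_mul_cancel₀ (neg_one_zpow_ne_zero _), one_smul]
      rfl
    · intro u z hz
      obtain ⟨w, hw⟩ := (T.homMk_eq_zero_iff rfl z).1 ((Submodule.Quotient.mk_eq_zero _).2 hz)
      refine (T.homMk_eq_zero_iff rfl _).2 ?_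
      have h := Δ.diff_capRaw (N := N) (p := s - r) (r := r) rfl rfl (rfl : s + 1 = s + 1) (by ring) u.1 w
      rw [(T.mem_cocycles rfl u.1).1 u.2, capRaw_zero, smul_zero, sub_zero, hw] at h
      exact ⟨((-1 : k) ^ (r * (s - r))) • Δ.capRaw N (by ring : s - r + 1 + r = s + 1) u.1 w, by
        rw [map_smul, h]; rfl⟩
  choose c hc using key
  exact ⟨c, fun M N r s u z => ⟨Δ.capChain_mem_cycles u z, hc M N r s u z⟩⟩

variable {Δ} {c : T.Pairing}

/-- If `u₂` lifts `u₃`, then `u₂ ⌢ z` lifts `u₃ ⌢ z`, and its boundary is `δu₂ ⌢ z`, which comes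
from `u₁ ⌢ z`. -/
lemma Induces.qII₁ (hc : Δ.Induces c) : T.QII₁ c := by
  rintro M₁ M₂ M₃ N f g hfg - r s γ γ' ξ ⟨u₃, u₂, u₁, rfl, rfl, h₃, h₁⟩
  obtain ⟨z, rfl⟩ := T.exists_cycle ξ
  obtain ⟨k₃, e₃⟩ := hc M₃ N r s u₃ z
  obtain ⟨k₁, e₁⟩ := hc M₁ N (r + 1) s u₁ z
  refine ⟨⟨_, k₃⟩, Δ.capChain N s u₂ z.1, ⟨_, k₁⟩, e₃.symm, e₁.symm, ?_, ?_⟩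
  · change envMap _ _ _ = Δ.capChain N s u₃.1 z.1
    rw [capChain_eq, map_smul, envMap_capRaw, h₃, envMap_id]
    rfl
  · change envMap _ _ (Δ.capChain N s u₁.1 z.1) = _
    rw [diff_capChain, (T.mem_cycles _ z.1).1 z.2, map_zero, smul_zero, smul_zero, zero_add,
      capChain_eq, map_smul, envMap_capRaw, h₁, envMap_id]

/-- Here the lift is `u ⌢ z₂`; as `δu = 0`, its boundary is `(-1)^r u ⌢ dz₂`, the source of the
sign. -/
lemma Induces.qII₂ (hc : Δ.Induces c) : T.QII₂ c := by
  rintro M N₁ N₂ N₃ f g hfg - r s γ ξ ξ' ⟨z₃, z₂, z₁, rfl, rfl, h₃, h₁⟩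
  obtain ⟨u, rfl⟩ := T.exists_cocycle γ
  obtain ⟨k₃, e₃⟩ := hc M N₃ r s u z₃
  obtain ⟨k₁, e₁⟩ := hc M N₁ r (s - 1) u z₁
  refine ⟨⟨_, k₃⟩, Δ.capChain N₂ s u.1 z₂, ((-1 : k) ^ r) • ⟨_, k₁⟩, e₃.symm,
    by rw [map_smul, e₁], ?_, ?_⟩
  · change envMap _ _ _ = Δ.capChain N₃ s u.1 z₃.1
    rw [capChain_eq, map_smul, envMap_capRaw, h₃, LinearMap.id_comp]
    rfl
  · change envMap _ _ (((-1 : k) ^ r) • Δ.capChain N₁ (s - 1) u.1 z₁.1) = _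
    rw [diff_capChain, (show T.codiff M r (r + 1) rfl u.1 = 0 from u.2), capRaw_zero, smul_zero,
      add_zero, map_smul, capChain_eq, map_smul, envMap_capRaw, h₁, LinearMap.id_comp]

end DiagonalApproximation

end CompleteResolution

end TateHochschild

/-! ### Exactness and vanishing -/

namespace TateHochschild

open Bimodule

variable {k : Type v} {A : Type u} [Field k] [Ring A] [Algebra k A]

namespace Bimodule

variable {X N N' : Bimodule k A} {V : Type*} [AddCommGroup V] [Module k V]

/-- Compatibility of a bilinear map with one half of the relations of `X ⊗_{Aᵉ} N`. -/
def Balanced (sd : Bool) (B : X →ₗ[k] N →ₗ[k] V) : Prop :=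
  ∀ a x n, B (X.ac (!sd) a x) n = B x (N.ac sd a n)

lemma etmul_ac (sd : Bool) (a : A) (x : X) (n : N) :
    etmul (X.ac (!sd) a x) n = etmul x (N.ac sd a n) := by
  cases sd
  · have := etmul_balanced 1 a x n
    rwa [right_one, left_one] at this
  · have := etmul_balanced a 1 x n
    rwa [right_one, left_one] at this

lemma exists_envLift (B : X →ₗ[k] N →ₗ[k] V) {sd : Bool} (h : Balanced sd B)
    (h' : Balanced (!sd) B) : ∃ G : EnvTensor X N →ₗ[k] V, ∀ x n, G (etmul x n) = B x n := by
  have key : ∀ s, Balanced s B := by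
    cases sd
    · exact fun s => by cases s <;> assumption
    · exact fun s => by cases s <;> assumption
  refine ⟨envLift B fun a b x n => ?_, fun _ _ => rfl⟩
  change B (X.ac true b (X.ac false a x)) n = B x (N.ac true a (N.ac false b n))
  exact (key false b _ n).trans (key true a x _)

end Bimodule

namespace FrobeniusForm

variable [FiniteDimensional k A] (F : FrobeniusForm k A) (sd : Bool)
variable {X N N' : Bimodule k A} {V : Type*} [AddCommGroup V] [Module k V]

/-- The average of a bilinear map over the Casimir element. -/
noncomputable def avg (B : X →ₗ[k] N →ₗ[k] V) : X →ₗ[k] N →ₗ[k] V :=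
  ∑ i, B.compl₁₂ (X.ac (!sd) (F.uu sd i)) (N.ac sd (F.vv sd i))

lemma avg_apply (B : X →ₗ[k] N →ₗ[k] V) (x : X) (n : N) :
    F.avg sd B x n = ∑ i, B (X.ac (!sd) (F.uu sd i) x) (N.ac sd (F.vv sd i) n) := by
  simp [avg, LinearMap.sum_apply]

lemma balanced_avg (B : X →ₗ[k] N →ₗ[k] V) : Balanced sd (F.avg sd B) := fun a x n => by
  have h := F.casimir sd (B.compl₁₂ ((X.acₗ (!sd)).flip x) ((N.acₗ sd).flip n)) a
  simp only [LinearMap.compl₁₂_apply, LinearMap.flip_apply, acₗ_apply, ac_mulSide] at h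
  rw [avg_apply, avg_apply, ← h]
  refine Finset.sum_congr rfl fun i _ => ?_
  rw [← ac_mulSide]
  cases sd <;> rfl

lemma balanced_not_avg {B : X →ₗ[k] N →ₗ[k] V} (hB : Balanced (!sd) B) :
    Balanced (!sd) (F.avg sd B) := fun a x n => by
  rw [avg_apply, avg_apply]
  refine Finset.sum_congr rfl fun i _ => ?_
  rw [X.ac_comm (!sd), hB, N.ac_comm sd]

/-- The second average keeps the half of the balancing relations obtained from the first, so every
bilinear map yields a map out of `X ⊗_{Aᵉ} N`. -/
lemma exists_double_average (B : X →ₗ[k] N →ₗ[k] V) :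
    ∃ G : EnvTensor X N →ₗ[k] V, ∀ x n, G (etmul x n) = F.avg true (F.avg false B) x n :=
  exists_envLift _ (F.balanced_avg true _) (F.balanced_not_avg true (F.balanced_avg false B))

/-- Linear maps, averaged, act on `X ⊗_{Aᵉ} -` if `X` is projective. -/
lemma exists_envTensor_map (hl : F.RelProjective true X) (hr : F.RelProjective false X) :
    ∃ E : ∀ (N N' : Bimodule k A), (N →ₗ[k] N') → (EnvTensor X N →ₗ[k] EnvTensor X N'),
      (∀ N, E N N LinearMap.id = LinearMap.id) ∧
      (∀ N N' φ ψ, E N N' (φ + ψ) = E N N' φ + E N N' ψ) ∧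
      (∀ (N N' N'' : Bimodule k A) (f : N' →ₗ[Env k A] N'') (φ : N →ₗ[k] N'),
        E N N'' (f.restrictScalars k ∘ₗ φ) = envMap LinearMap.id f ∘ₗ E N N' φ) ∧
      (∀ (N N' N'' : Bimodule k A) (f : N →ₗ[Env k A] N') (φ : N' →ₗ[k] N''),
        E N N'' (φ ∘ₗ f.restrictScalars k) = E N' N'' φ ∘ₗ envMap LinearMap.id f) := by
  obtain ⟨h, hh, h1⟩ := hl
  obtain ⟨g, hg, g1⟩ := hr
  choose E hE using fun (N N' : Bimodule k A) (φ : N →ₗ[k] N') =>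
    F.exists_double_average ((etmulₗ X N').compl₁₂ (g ∘ₗ h) φ)
  have hE' : ∀ N N' φ x n, E N N' φ (etmul x n) = ∑ i, ∑ j,
      etmul (g (h (X.ac true (F.uu false j) (X.ac false (F.uu true i) x))))
        (φ (N.ac false (F.vv false j) (N.ac true (F.vv true i) n))) := fun N N' φ x n => by
    simp only [hE, avg_apply, LinearMap.compl₁₂_apply, LinearMap.comp_apply, etmulₗ_apply]
    rfl
  refine ⟨E, fun N => envTensor_ext fun x n => ?_, fun N N' φ ψ => envTensor_ext fun x n => ?_,
    fun N N' N'' f φ => envTensor_ext fun x n => ?_, fun N N' N'' f φ => envTensor_ext fun x n => ?_⟩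
  · have h₁ : ∀ (x : X) (n : N) (a b : A), etmul x (N.ac false b (N.ac true a n)) =
        etmul (X.ac false a (X.ac true b x)) n := fun x n a b =>
      ((etmul_ac false b x _).symm).trans (etmul_ac true a (X.ac true b x) n).symm
    -- Moving the Casimir factors from `n` to `x` turns `E id` into this double trace; `g` is left
    -- linear, so the inner trace is `g` itself.
    have h₂ : F.tr false (F.tr true (g ∘ₗ h)) = LinearMap.id := by
      rw [← F.comp_tr true hg, h1, LinearMap.comp_id, g1]
    rw [hE', LinearMap.id_apply]
    simp only [LinearMap.id_apply, h₁]
    conv_rhs => rw [← LinearMap.id_apply (R := k) x, ← h₂]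
    simp only [tr_apply, map_sum, ← etmulₗ_apply, LinearMap.sum_apply]
    rfl
  · simp only [hE', LinearMap.add_apply]
    simp only [← etmulₗ_apply, map_add, Finset.sum_add_distrib]
  · simp only [hE', LinearMap.comp_apply, map_sum, envMap_etmul]
    rfl
  · simp only [hE', LinearMap.comp_apply, envMap_etmul, LinearMap.coe_restrictScalars, map_ac]
    rfl

end FrobeniusForm

lemma Bimodule.ShortExact.exists_splitting {M₁ M₂ M₃ : Bimodule k A} {f : M₁ →ₗ[Env k A] M₂}
    {g : M₂ →ₗ[Env k A] M₃} (h : ShortExact f g) : ∃ (ρ : M₂ →ₗ[k] M₁) (τ : M₃ →ₗ[k] M₂),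
      (∀ x, ρ (f x) = x) ∧ (∀ y, g (τ y) = y) ∧ ∀ x, f (ρ x) + τ (g x) = x := by
  obtain ⟨hf, hfg, hg⟩ := h
  obtain ⟨τ, hτ⟩ := exists_linear_lift (g.restrictScalars k) LinearMap.id hg
  obtain ⟨ρ, hρ⟩ := exists_linear_lift (f.restrictScalars k)
    (LinearMap.id - τ ∘ₗ g.restrictScalars k) (fun x => (hfg _).1 (by
      have := hτ (g x)
      simp only [LinearMap.coe_restrictScalars, LinearMap.id_apply] at this
      simp [this]))
  simp only [LinearMap.coe_restrictScalars, LinearMap.id_apply, LinearMap.sub_apply,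
    LinearMap.comp_apply] at hτ hρ
  refine ⟨ρ, τ, fun x => hf ?_, hτ, fun x => ?_⟩
  · rw [hρ, (hfg _).2 ⟨x, rfl⟩, map_zero, sub_zero]
  · rw [hρ, sub_add_cancel]

namespace CompleteResolution

variable [FiniteDimensional k A] (T : CompleteResolution k A) (F : FrobeniusForm k A)

/-- A short exact sequence splits over `k`, and the averaged functoriality `E` carries the splitting
to `T_i ⊗_{Aᵉ} -`. -/
lemma envTensor_exact {N₁ N₂ N₃ : Bimodule k A} {f : N₁ →ₗ[Env k A] N₂} {g : N₂ →ₗ[Env k A] N₃}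
    (F : FrobeniusForm k A) (h : ShortExact f g) (i : ℤ) :
    Function.Injective (envMap (LinearMap.id : T.X i →ₗ[Env k A] T.X i) f) ∧
    Function.Exact (envMap (LinearMap.id : T.X i →ₗ[Env k A] T.X i) f) (envMap LinearMap.id g) ∧
    Function.Surjective (envMap (LinearMap.id : T.X i →ₗ[Env k A] T.X i) g) := by
  obtain ⟨ρ, τ, h₁, h₂, h₃⟩ := h.exists_splitting
  obtain ⟨E, hid, hadd, hl, hr⟩ := F.exists_envTensor_map (T.relProjective F true i)
    (T.relProjective F false i)
  have e₁ : E _ _ ρ ∘ₗ envMap LinearMap.id f = LinearMap.id := by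
    rw [← hr, ← hid]
    exact congrArg _ (LinearMap.ext h₁)
  have e₂ : envMap LinearMap.id g ∘ₗ E _ _ τ = LinearMap.id := by
    rw [← hl, ← hid]
    exact congrArg _ (LinearMap.ext h₂)
  have e₃ : envMap LinearMap.id f ∘ₗ E _ _ ρ + E _ _ τ ∘ₗ envMap LinearMap.id g = LinearMap.id := by
    rw [← hr, ← hl, ← hadd, ← hid]
    exact congrArg _ (LinearMap.ext h₃)
  refine ⟨Function.LeftInverse.injective (LinearMap.congr_fun e₁), fun z => ⟨fun hz => ?_, ?_⟩,
    Function.RightInverse.surjective (LinearMap.congr_fun e₂)⟩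
  · refine ⟨E _ _ ρ z, ?_⟩
    have := LinearMap.congr_fun e₃ z
    simpa [hz] using this
  · rintro ⟨y, rfl⟩
    rw [envMap_comp]
    have h₀ : g ∘ₗ f = 0 := LinearMap.ext fun x => (h.2.1 _).2 ⟨x, rfl⟩
    rw [h₀]
    exact LinearMap.congr_fun (f := envMap (LinearMap.id ∘ₗ LinearMap.id) 0) (g := 0)
      (envTensor_ext fun x n => (etmulₗ _ _ x).map_zero) y

/-- Tate-Hochschild homology vanishes on relatively projective bimodules. -/
lemma homology_eq_zero {F : FrobeniusForm k A} {sd : Bool} {N : Bimodule k A}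
    (hN : F.RelProjective sd N) {s : ℤ} (ξ : T.Homology N s) : ξ = 0 := by
  obtain ⟨h, hh, h1⟩ := hN
  obtain ⟨σ, hσ, hσ'⟩ := T.exists_contraction F sd
  obtain ⟨z, rfl⟩ := T.exists_cycle ξ
  -- The contracting homotopy is `σ ⊗ h`, averaged over the Casimir element; the average balances
  -- one side, and linearity of `σ` and `h` the other.
  have key : ∀ i j (hij : i + 1 = j), ∃ G : EnvTensor (T.X i) N →ₗ[k] EnvTensor (T.X j) N,
      ∀ x n, G (etmul x n) = ∑ l, etmul (σ i j hij ((T.X i).ac (!sd) (F.uu sd l) x))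
        (h (N.ac sd (F.vv sd l) n)) := fun i j hij => by
    obtain ⟨G, hG⟩ := exists_envLift (F.avg sd ((etmulₗ (T.X j) N).compl₁₂ (σ i j hij) h))
      (F.balanced_avg sd _) (F.balanced_not_avg sd (fun a x n => by
        simp only [LinearMap.compl₁₂_apply, etmulₗ_apply]
        rw [hh, ← etmul_ac, Bool.not_not, hσ]))
    exact ⟨G, fun x n => by rw [hG, F.avg_apply]; rfl⟩
  choose G hG using key
  refine (T.homMk_eq_zero_iff rfl z).2 ⟨G s (s + 1) rfl z.1, ?_⟩
  have e : T.diff N (s + 1) s rfl ∘ₗ G s (s + 1) rfl + G (s - 1) s (sub_add_cancel s 1) ∘ₗ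
      T.diff N s (s - 1) (sub_add_cancel s 1) = LinearMap.id := envTensor_ext fun x n => by
    have h₁ : ∀ l, etmul (T.d (s + 1) s rfl (σ s (s + 1) rfl ((T.X s).ac (!sd) (F.uu sd l) x)))
        (h (N.ac sd (F.vv sd l) n)) + etmul (σ (s - 1) s (sub_add_cancel s 1)
        ((T.X (s - 1)).ac (!sd) (F.uu sd l) (T.d s (s - 1) (sub_add_cancel s 1) x)))
        (h (N.ac sd (F.vv sd l) n)) = etmul x (N.ac sd (F.uu sd l) (h (N.ac sd (F.vv sd l) n))) :=
      fun l => by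
        rw [← map_ac, ← etmul_ac]
        exact ((etmulₗ _ _).map_add₂ _ _ _).symm.trans
          (congrArg (fun y => etmul y (h (N.ac sd (F.vv sd l) n))) (hσ' _ _ _ _ _ _))
    simp only [LinearMap.add_apply, LinearMap.comp_apply, diff, envMap_etmul, hG, map_sum,
      LinearMap.id_apply]
    rw [← Finset.sum_add_distrib]
    simp only [h₁]
    conv_rhs => rw [← LinearMap.id_apply (R := k) n, ← h1, F.tr_apply, ← etmulₗ_apply, map_sum]
    rfl
  have := LinearMap.congr_fun e z.1
  rwa [LinearMap.add_apply, LinearMap.comp_apply, LinearMap.comp_apply,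
    (T.mem_cycles _ z.1).1 z.2, map_zero, add_zero] at this

/-- Tate-Hochschild cohomology vanishes on relatively projective bimodules. -/
lemma cohomology_eq_zero {F : FrobeniusForm k A} {sd : Bool} {M : Bimodule k A}
    (hM : F.RelProjective sd M) {r : ℤ} (γ : T.Cohomology M r) : γ = 0 := by
  obtain ⟨σ, hσ, hσ'⟩ := T.exists_contraction F (!sd)
  obtain ⟨u, rfl⟩ := T.exists_cocycle γ
  exact (T.cohMk_eq_zero_iff (sub_add_cancel r 1) u).2 (F.exists_extension sd hM
    (T.d (r + 1) r rfl) _ (hσ _ _ _) (hσ' _ _ _ _ _) u.1 ((T.mem_cocycles rfl u.1).1 u.2))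

end CompleteResolution

end TateHochschild

/-! ### Degree zero -/

namespace TateHochschild

open Bimodule

variable {k : Type v} {A : Type u} [Field k] [Ring A] [Algebra k A]

namespace CompleteResolution

variable (T : CompleteResolution k A) {M N : Bimodule k A}

lemma augHom_etmul (x : T.X 0) (n : N) : T.augHom N (etmul x n) =
    N.commutators.mkQ (N.ac true (ofRegular (T.ε x)) n) := rfl

/-- Right exactness of `- ⊗_{Aᵉ} N` on the augmented resolution. -/
lemma exists_boundary_of_augHom_eq_zero {z : EnvTensor (T.X 0) N} (hz : T.augHom N z = 0) {i : ℤ}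
    (h : 0 + 1 = i) : ∃ w, T.diff N i 0 h w = z := by
  obtain rfl : i = 1 := by omega
  obtain ⟨x₀, hx₀⟩ := T.ε_surjective (toRegular 1)
  let R := LinearMap.range (T.diff N 1 0 h)
  have hR : ∀ (x y : T.X 0) (n : N), T.ε x = T.ε y → R.mkQ (etmul x n) = R.mkQ (etmul y n) :=
    fun x y n hxy => by
      obtain ⟨w, hw⟩ := (T.ε_exact (x - y)).1 (by rw [map_sub, hxy, sub_self])
      refine (Submodule.Quotient.eq R).2 ⟨etmul w n, ?_⟩
      change etmul (T.d 1 0 h w) n = _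
      rw [hw]
      exact (etmulₗ _ N).map_sub₂ x y n
  have hε : ∀ sd a, ofRegular (T.ε ((T.X 0).ac sd a x₀)) = a := fun sd a => by
    rw [map_ac, hx₀, ofRegular_ac]
    cases sd
    · exact one_mul a
    · exact mul_one a
  -- Modulo boundaries, `n ↦ x₀ ⊗ n` kills commutators, because `a x₀` and `x₀ a` have the same
  -- augmentation. The induced map, composed with `augHom`, is the projection onto the cokernel of
  -- the differential.
  have hcomm : N.commutators ≤ LinearMap.ker (R.mkQ ∘ₗ etmulₗ _ N x₀) := commutators_le fun a n => by
    have h₁ := etmul_ac true a x₀ n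
    have h₂ := etmul_ac false a x₀ n
    have h₃ := hR ((T.X 0).ac true a x₀) ((T.X 0).ac false a x₀) n ((hε true a).trans (hε false a).symm)
    rw [LinearMap.mem_ker, map_sub, LinearMap.comp_apply, LinearMap.comp_apply, etmulₗ_apply,
      etmulₗ_apply, ← h₁, ← h₂, sub_eq_zero]
    exact h₃.symm
  have key : N.commutators.liftQ (R.mkQ ∘ₗ etmulₗ _ N x₀) hcomm ∘ₗ T.augHom N = R.mkQ :=
    envTensor_ext fun x n => by
      rw [LinearMap.comp_apply, augHom_etmul, Submodule.mkQ_apply, Submodule.liftQ_apply,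
        LinearMap.comp_apply, etmulₗ_apply, ← etmul_ac]
      exact hR _ _ n (hε false _)
  have h₁ := LinearMap.congr_fun key z
  rw [LinearMap.comp_apply, hz, map_zero] at h₁
  exact (Submodule.Quotient.mk_eq_zero R).1 h₁.symm

/-- A degree zero cocycle kills the image of `T_1`, which is `ker ε` and contains `x - ε(x) x₀`. -/
lemma apply_eq_ac {x₀ : T.X 0} (hx₀ : T.ε x₀ = toRegular 1) (sd : Bool) {u : T.X 0 →ₗ[Env k A] M}
    (hu : u ∈ T.cocycles M 0) (x : T.X 0) : u x = M.ac sd (ofRegular (T.ε x)) (u x₀) := by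
  have hud : u ∘ₗ T.d 1 0 (zero_add 1) = 0 := (T.mem_cocycles (zero_add 1) u).1 hu
  obtain ⟨w, hw⟩ := (T.ε_exact (x - (T.X 0).ac sd (ofRegular (T.ε x)) x₀)).1 (by
    rw [map_sub, map_ac, hx₀, sub_eq_zero]
    refine Eq.symm ((ofRegular_ac sd (ofRegular (T.ε x)) (toRegular 1)).trans ?_)
    cases sd
    · exact one_mul _
    · exact mul_one _)
  have h₁ : u (T.d 1 0 (zero_add 1) w) = 0 := LinearMap.congr_fun hud w
  rw [hw, map_sub, map_ac, sub_eq_zero] at h₁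
  exact h₁

section

variable {T}

/-- The augmentation of `∑ x' ⊗ (u(x'') ⊗ n)` is `∑ ε(x') ε(x'') m ⊗ n = ε(x) m ⊗ n`, and invariance
of `m` turns this into `m ⊗ ε(x) n`. -/
lemma DiagonalApproximation.augHom_capRaw (Δ : T.DiagonalApproximation) {m : M}
    (hm : m ∈ M.invariants) {u : T.X 0 →ₗ[Env k A] M}
    (hu : ∀ x, u x = M.ac true (ofRegular (T.ε x)) m) (z : EnvTensor (T.X 0) N) {n : N}
    (hz : T.augHom N z = Submodule.Quotient.mk n) :
    T.augHom (tensor M N) (Δ.capRaw N (add_zero 0) u z) = Submodule.Quotient.mk (tmul m n) := by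
  have h₁ : ∀ (n : N) (w : tensor (T.X 0) (T.X 0)),
      T.augHom (tensor M N) (envAssoc (T.X 0) M N (etmul (tensorMap LinearMap.id u w) n)) =
      (tensor M N).commutators.mkQ (tmul (M.ac true (T.augAug w) m) n) := fun n =>
    tensor_congr (T.augHom (tensor M N) ∘ₗ envAssoc (T.X 0) M N ∘ₗ
        (etmulₗ _ N).flip n ∘ₗ (tensorMap LinearMap.id u).restrictScalars k)
      ((tensor M N).commutators.mkQ ∘ₗ (tmulₗ M N).flip n ∘ₗ (M.acₗ true).flip m ∘ₗ T.augAug)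
      (fun x y => by
        change T.augHom (tensor M N) (etmul x (tmul (u y) n)) = (tensor M N).commutators.mkQ
          (tmul (M.ac true (ofRegular (T.ε x) * ofRegular (T.ε y)) m) n)
        rw [augHom_etmul, tensor_ac_true, hu, ← M.ac_mulSide true]
        rfl)
  have hΦ : N.commutators ≤ LinearMap.ker ((tensor M N).commutators.mkQ ∘ₗ tmulₗ M N m) :=
    fun n hn => (Submodule.Quotient.mk_eq_zero _).2 (tmul_mem_commutators hm hn)
  have key : T.augHom (tensor M N) ∘ₗ Δ.capRaw N (add_zero 0) u =
      N.commutators.liftQ _ hΦ ∘ₗ T.augHom N := envTensor_ext fun x n => by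
    refine (h₁ n (Δ.app 0 0 0 (add_zero 0) x)).trans ?_
    rw [Δ.aug, LinearMap.comp_apply, augHom_etmul, Submodule.mkQ_apply, Submodule.mkQ_apply,
      Submodule.liftQ_apply, LinearMap.comp_apply, tmulₗ_apply, tmul_ac, mem_invariants.1 hm]
    rfl
  refine (LinearMap.congr_fun key z).trans ?_
  rw [LinearMap.comp_apply, hz, Submodule.liftQ_apply]
  rfl

end

variable [FiniteDimensional k A] (F : FrobeniusForm k A)

lemma exists_isZeroCoh (γ : T.Cohomology M 0) :
    ∃ m : M.invariants, T.IsZeroCoh F γ (Submodule.Quotient.mk m) := by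
  obtain ⟨u, rfl⟩ := T.exists_cocycle γ
  obtain ⟨x₀, hx₀⟩ := T.ε_surjective (toRegular 1)
  refine ⟨⟨u.1 x₀, mem_invariants.2 fun a => ?_⟩, u, _, rfl, rfl, T.apply_eq_ac hx₀ true u.2⟩
  rw [← map_ac, T.apply_eq_ac hx₀ false u.2 ((T.X 0).ac true a x₀), map_ac, hx₀, ofRegular_ac]
  exact congrArg (fun b => M.ac false b (u.1 x₀)) (mul_one a)

/-- The Casimir identity gives `∑ v_i a n u_i = ∑ v_i n a u_i`. -/
lemma commutators_le_ker_twistedNorm : N.commutators ≤ LinearMap.ker (F.twistedNorm N) :=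
  commutators_le fun a n => by
    have h := F.casimir false (LinearMap.mk₂ k (fun x y => N.ac true x (N.ac false y n))
      (fun x y z => by simp [ac_add]) (fun c x y => by simp [ac_smul])
      (fun x y z => by simp [ac_add]) (fun c x y => by simp [ac_smul])) a
    simp only [LinearMap.mk₂_apply] at h
    rw [LinearMap.mem_ker, map_sub, F.twistedNorm_apply, F.twistedNorm_apply, sub_eq_zero]
    refine Eq.trans (Finset.sum_congr rfl fun i _ => ?_)
      (h.trans (Finset.sum_congr rfl fun i _ => ?_))
    · rw [← ac_true_false, ← N.ac_mulSide true]
      rfl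
    · refine congrArg _ ?_
      rw [← N.ac_mulSide false]
      rfl

/-- The augmentation sends cycles to the kernel of the twisted norm map. -/
lemma twistedNorm_eq_zero {z : EnvTensor (T.X 0) N} (hz : z ∈ T.cycles N 0) {n : N}
    (hn : T.augHom N z = Submodule.Quotient.mk n) : F.twistedNorm N n = 0 := by
  -- The form `x ↦ λ(ε(x))` factors through `d` into `T_{-1}`. Averaging `(x, n) ↦ l(x) n` on both
  -- sides gives `G` with `G(dx ⊗ n)` equal to the twisted norm of `ε(x) n`; hence the norm vanishes
  -- on augmentations of cycles.
  obtain ⟨l, hl⟩ := exists_linear_extension ((T.d 0 (0 - 1) (sub_add_cancel 0 1)).restrictScalars k)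
    (F.lam ∘ₗ ofRegular ∘ₗ T.ε.restrictScalars k) (fun x hx => by
      have h₁ : T.ε x = 0 := (T.d_eq_zero_iff x).1 hx
      rw [LinearMap.comp_apply, LinearMap.comp_apply, LinearMap.coe_restrictScalars, h₁, map_zero,
        map_zero])
  obtain ⟨G, hG⟩ := F.exists_double_average ((LinearMap.lsmul k N).comp l)
  have key : (N.commutators.liftQ (F.twistedNorm N) (commutators_le_ker_twistedNorm F)) ∘ₗ
      T.augHom N = G ∘ₗ T.diff N 0 (0 - 1) (sub_add_cancel 0 1) := envTensor_ext fun x n => by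
    rw [LinearMap.comp_apply, LinearMap.comp_apply, augHom_etmul, Submodule.mkQ_apply,
      Submodule.liftQ_apply, diff, envMap_etmul, hG, F.twistedNorm_apply, F.avg_apply]
    simp only [F.avg_apply]
    rw [Finset.sum_comm]
    refine Finset.sum_congr rfl fun j _ => ?_
    have h₁ : ∀ i, l ((T.X (0 - 1)).ac (!false) (F.uu false j) ((T.X (0 - 1)).ac (!true) (F.uu true i)
        (T.d 0 (0 - 1) (sub_add_cancel 0 1) x))) =
        F.lam (mulSide true (F.dualBasis j * ofRegular (T.ε x)) (F.uu true i)) := fun i => by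
      rw [← map_ac, ← map_ac]
      refine (hl _).trans ?_
      rw [LinearMap.comp_apply, LinearMap.comp_apply, LinearMap.coe_restrictScalars, map_ac, map_ac,
        ofRegular_ac, ofRegular_ac]
      exact congrArg F.lam (mul_assoc _ _ _).symm
    have h₂ := F.sum_lam_smul_vv true (F.dualBasis j * ofRegular (T.ε x))
    have h₃ : ∀ i, ((LinearMap.lsmul k N).comp l) ((T.X (0 - 1)).ac (!false) (F.uu false j)
        ((T.X (0 - 1)).ac (!true) (F.uu true i) (T.d 0 (0 - 1) (sub_add_cancel 0 1) x)))
        (N.ac false (F.vv false j) (N.ac true (F.vv true i) n)) =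
        N.acₗ true (F.lam (mulSide true (F.dualBasis j * ofRegular (T.ε x)) (F.uu true i)) •
          F.vv true i) (N.ac false (FrobeniusForm.basis k A j) n) := fun i => by
      rw [LinearMap.comp_apply, h₁, LinearMap.lsmul_apply, map_smul, LinearMap.smul_apply,
        ← ac_true_false]
      rfl
    refine Eq.trans ?_ (Finset.sum_congr rfl fun i _ => h₃ i).symm
    rw [← LinearMap.sum_apply, ← map_sum, h₂, ← ac_true_false, ← N.ac_mulSide true]
    rfl
  have h₁ := LinearMap.congr_fun key z
  rw [LinearMap.comp_apply, LinearMap.comp_apply, hn, (T.mem_cycles _ z).1 hz, map_zero] at h₁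
  exact h₁

lemma exists_isZeroHom (ξ : T.Homology N 0) : ∃ n : LinearMap.ker (F.twistedNorm N),
    T.IsZeroHom F ξ (Submodule.Quotient.mk n) := by
  obtain ⟨z, rfl⟩ := T.exists_cycle ξ
  obtain ⟨n, hn⟩ := Submodule.mkQ_surjective _ (T.augHom N z.1)
  exact ⟨⟨n, T.twistedNorm_eq_zero F z.2 hn.symm⟩, z, _, rfl, rfl, hn.symm⟩

variable {T F}

/-- Injectivity of the identification in degree zero: cycles with equal augmentation differ by a
boundary. -/
lemma IsZeroHom.unique {ξ ξ' : T.Homology N 0} {q : F.NormKerMod N} (h : T.IsZeroHom F ξ q)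
    (h' : T.IsZeroHom F ξ' q) : ξ = ξ' := by
  obtain ⟨z, n, rfl, rfl, hz⟩ := h
  obtain ⟨z', n', rfl, hn, hz'⟩ := h'
  have hmem : n'.1 - n.1 ∈ N.commutators :=
    (Submodule.Quotient.eq (N.commutators.submoduleOf (LinearMap.ker (F.twistedNorm N)))).1 hn
  refine (T.homMk_eq_iff (zero_add 1) z z').2 (T.exists_boundary_of_augHom_eq_zero ?_ _)
  rw [map_sub, hz, hz', sub_eq_zero]
  exact ((Submodule.Quotient.eq N.commutators).2 hmem).symm

/-- The representatives `m'`, `n'` attached to the cocycle and the cycle may differ from `m`, `n` by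
a norm and by commutators, so `m' ⊗ n' - m ⊗ n` must be shown to be a sum of commutators. -/
lemma DiagonalApproximation.Induces.qI {Δ : T.DiagonalApproximation} {c : T.Pairing}
    (hc : Δ.Induces c) (F : FrobeniusForm k A) : T.QI F c := by
  rintro M N γ ξ m n ⟨u, m', rfl, hm, hu⟩ ⟨z, n', rfl, hn, hz⟩
  have hmem : ∀ (m : M.invariants) (n : LinearMap.ker (F.twistedNorm N)),
      tmul m.1 n.1 ∈ LinearMap.ker (F.twistedNorm (tensor M N)) := fun m n => by
    rw [LinearMap.mem_ker, F.twistedNorm_tmul m.2, LinearMap.mem_ker.1 n.2, ← tmulₗ_apply, map_zero]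
  obtain ⟨h, e⟩ := hc M N 0 0 u z
  refine ⟨hmem m n, ⟨_, h⟩, ⟨tmul m'.1 n'.1, hmem m' n'⟩, e.symm, ?_, ?_⟩
  · refine (Submodule.Quotient.eq _).2 ?_
    obtain ⟨m₀, hm₀⟩ := (Submodule.Quotient.eq _).1 hm
    have hn₀ : n'.1 - n.1 ∈ N.commutators :=
      (Submodule.Quotient.eq (N.commutators.submoduleOf (LinearMap.ker (F.twistedNorm N)))).1 hn
    change tmul m'.1 n'.1 - tmul m.1 n.1 ∈ (tensor M N).commutators
    have h₁ : tmul m'.1 n'.1 - tmul m.1 n.1 =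
        tmul (m'.1 - m.1) n'.1 + tmul m.1 (n'.1 - n.1) := by
      simp only [← tmulₗ_apply, map_sub, LinearMap.sub_apply]
      abel
    have h₂ : m'.1 - m.1 = F.norm M m₀ := hm₀.symm
    rw [h₁, h₂]
    exact Submodule.add_mem _ (F.norm_tmul_mem_commutators m₀ n'.2) (tmul_mem_commutators m.2 hn₀)
  · have h₁ : Δ.capChain N 0 u.1 z.1 = Δ.capRaw N (add_zero 0) u.1 z.1 := by
      refine Eq.trans ?_ (one_smul k _)
      rw [Δ.capChain_eq]
      congr 1
      simp
    exact (congrArg _ h₁).trans (Δ.augHom_capRaw m'.2 hu z.1 hz)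

end CompleteResolution

end TateHochschild

/-! ### Uniqueness and naturality of the cap product -/

namespace TateHochschild

open Bimodule

variable {k : Type v} {A : Type u} [Field k] [Ring A] [Algebra k A]

namespace Bimodule

variable {M₁ M₂ M₃ : Bimodule k A} {f : M₁ →ₗ[Env k A] M₂} {g : M₂ →ₗ[Env k A] M₃}

lemma ShortExact.comp_eq_zero (h : ShortExact f g) : g ∘ₗ f = 0 :=
  LinearMap.ext fun x => (h.2.1 _).2 ⟨x, rfl⟩

lemma ShortExact.exists_factor (h : ShortExact f g) {P : Bimodule k A} {u : P →ₗ[Env k A] M₂}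
    (hu : g ∘ₗ u = 0) : ∃ u₁ : P →ₗ[Env k A] M₁, f ∘ₗ u₁ = u := by
  let e := LinearEquiv.ofInjective f h.1
  refine ⟨e.symm.toLinearMap ∘ₗ u.codRestrict (LinearMap.range f)
    (fun x => (h.2.1 _).1 (LinearMap.congr_fun hu x)), LinearMap.ext fun x => ?_⟩
  exact congrArg Subtype.val (e.apply_symm_apply (u.codRestrict (LinearMap.range f)
    (fun x => (h.2.1 _).1 (LinearMap.congr_fun hu x)) x))

lemma ShortExact.of_splitting (hfg : g ∘ₗ f = 0) (ρ : M₂ →ₗ[k] M₁) (τ : M₃ →ₗ[k] M₂)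
    (h₁ : ∀ x, ρ (f x) = x) (h₂ : ∀ y, g (τ y) = y) (h₃ : ∀ x, f (ρ x) + τ (g x) = x) :
    ShortExact f g := by
  refine ⟨Function.LeftInverse.injective h₁, fun x => ⟨fun hx => ⟨ρ x, ?_⟩, ?_⟩,
    Function.RightInverse.surjective h₂⟩
  · have := h₃ x
    rwa [hx, map_zero, add_zero] at this
  · rintro ⟨y, rfl⟩
    exact LinearMap.congr_fun hfg y

/-- A one-sided retraction of the first map yields a one-sided section of the second one. -/
lemma ShortExact.exists_sideLinear_section {sd : Bool} (h : ShortExact f g) {q : M₂ →ₗ[k] M₁}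
    (hq : SideLinear sd q) (hqf : ∀ x, q (f x) = x) : ∃ τ : M₃ →ₗ[k] M₂, SideLinear sd τ ∧
      (∀ y, g (τ y) = y) ∧ ∀ x, f (q x) + τ (g x) = x := by
  obtain ⟨τ, hτ⟩ := exists_linear_extension (g.restrictScalars k)
    (LinearMap.id - f.restrictScalars k ∘ₗ q) (fun x hx => by
      obtain ⟨y, rfl⟩ := (h.2.1 x).1 hx
      rw [LinearMap.sub_apply, LinearMap.id_apply, LinearMap.comp_apply, hqf]
      exact sub_self _)
  replace hτ : ∀ x, τ (g x) = x - f (q x) := hτ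
  refine ⟨τ, fun a y => ?_, fun y => ?_, fun x => by rw [hτ, add_sub_cancel]⟩
  · obtain ⟨x, rfl⟩ := h.2.2 y
    rw [← map_ac, hτ, hτ, map_sub, hq, map_ac]
  · obtain ⟨x, rfl⟩ := h.2.2 y
    rw [hτ, map_sub, (h.2.1 _).2 ⟨q x, rfl⟩, sub_zero]

/-- A sequence that splits over right modules stays split after `- ⊗_A N`. -/
lemma ShortExact.tensor_right (h : ShortExact f g) {q : M₂ →ₗ[k] M₁} (hq : SideLinear false q)
    (hqf : ∀ x, q (f x) = x) (N : Bimodule k A) :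
    ShortExact (tensorMap f (LinearMap.id : N →ₗ[Env k A] N)) (tensorMap g LinearMap.id) := by
  obtain ⟨τ, hτ, h₂, h₃⟩ := h.exists_sideLinear_section hq hqf
  refine .of_splitting (LinearMap.ext fun z => ?_) (tmap q LinearMap.id hq .id)
    (tmap τ LinearMap.id hτ .id)
    (tensor_congr (tmap q LinearMap.id hq .id ∘ₗ (tensorMap f LinearMap.id).restrictScalars k)
      LinearMap.id fun x n => congrArg (fun y => tmul y n) (hqf x))
    (tensor_congr ((tensorMap g LinearMap.id).restrictScalars k ∘ₗ tmap τ LinearMap.id hτ .id)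
      LinearMap.id fun x n => congrArg (fun y => tmul y n) (h₂ x))
    (tensor_congr ((tensorMap f LinearMap.id).restrictScalars k ∘ₗ tmap q LinearMap.id hq .id +
      tmap τ LinearMap.id hτ .id ∘ₗ (tensorMap g LinearMap.id).restrictScalars k)
      LinearMap.id fun x n => ((tmulₗ M₂ N).map_add₂ _ _ n).symm.trans
        (congrArg (fun y => tmul y n) (h₃ x)))
  rw [LinearMap.comp_apply, tensorMap_comp, h.comp_eq_zero, tensorMap_zero_left]
  rfl

lemma ShortExact.tensor_left (h : ShortExact f g) {q : M₂ →ₗ[k] M₁} (hq : SideLinear true q)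
    (hqf : ∀ x, q (f x) = x) (M : Bimodule k A) :
    ShortExact (tensorMap (LinearMap.id : M →ₗ[Env k A] M) f) (tensorMap LinearMap.id g) := by
  obtain ⟨τ, hτ, h₂, h₃⟩ := h.exists_sideLinear_section hq hqf
  refine .of_splitting (LinearMap.ext fun z => ?_) (tmap LinearMap.id q .id hq)
    (tmap LinearMap.id τ .id hτ)
    (tensor_congr (tmap LinearMap.id q .id hq ∘ₗ (tensorMap LinearMap.id f).restrictScalars k)
      LinearMap.id fun m x => congrArg (fun y => tmul m y) (hqf x))
    (tensor_congr ((tensorMap LinearMap.id g).restrictScalars k ∘ₗ tmap LinearMap.id τ .id hτ)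
      LinearMap.id fun m x => congrArg (fun y => tmul m y) (h₂ x))
    (tensor_congr ((tensorMap LinearMap.id f).restrictScalars k ∘ₗ tmap LinearMap.id q .id hq +
      tmap LinearMap.id τ .id hτ ∘ₗ (tensorMap LinearMap.id g).restrictScalars k)
      LinearMap.id fun m x => (map_add (tmulₗ M M₂ m) _ _).symm.trans
        (congrArg (fun y => tmul m y) (h₃ x)))
  rw [LinearMap.comp_apply, tensorMap_comp, h.comp_eq_zero, tensorMap_zero_right]
  rfl

end Bimodule

namespace FrobeniusForm

variable [FiniteDimensional k A] (F : FrobeniusForm k A) (sd : Bool) (M : Bimodule k A)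

/-- Dimension shifting upwards. -/
lemma exists_shortExact_from : ∃ (I Q : Bimodule k A) (f : M →ₗ[Env k A] I) (g : I →ₗ[Env k A] Q)
    (q : I →ₗ[k] M), F.RelProjective sd I ∧ ShortExact f g ∧ SideLinear (!sd) q ∧
      ∀ m, q (f m) = m := by
  obtain ⟨I, -, j, -, q, hI, -, hq, -, hqj, -, -⟩ := F.exists_relProjective sd M
  obtain ⟨Q, g, hg, hjg, -⟩ := exists_cokernel j
  exact ⟨I, Q, j, g, q, hI, ⟨Function.LeftInverse.injective hqj, hjg, hg⟩, hq, hqj⟩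

/-- Dimension shifting downwards. -/
lemma exists_shortExact_onto : ∃ (K I : Bimodule k A) (f : K →ₗ[Env k A] I) (g : I →ₗ[Env k A] M)
    (q : I →ₗ[k] K), F.RelProjective sd I ∧ ShortExact f g ∧ SideLinear (!sd) q ∧
      ∀ m, q (f m) = m := by
  obtain ⟨I, p, -, s, -, hI, hs, -, hps, -, -, -⟩ := F.exists_relProjective sd M
  obtain ⟨K, i, hi, hip, -⟩ := exists_kernel p
  obtain ⟨q, hq⟩ := exists_linear_lift (i.restrictScalars k)
    (LinearMap.id - s ∘ₗ p.restrictScalars k) (fun x => (hip _).1 (by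
      change p (x - s (p x)) = 0
      rw [map_sub, hps, sub_self]))
  replace hq : ∀ x, i (q x) = x - s (p x) := hq
  refine ⟨K, I, i, p, q, hI, ⟨hi, hip, fun m => ⟨s m, hps m⟩⟩, fun a x => hi ?_, fun m => hi ?_⟩
  · rw [map_ac, hq, hq, map_sub, map_ac, hs]
  · rw [hq, (hip _).2 ⟨m, rfl⟩, map_zero, sub_zero]

end FrobeniusForm

/-! ### Connecting homomorphisms and dimension shifting -/

namespace CompleteResolution

variable {T T' : CompleteResolution k A} {N₁ N₂ N₃ : Bimodule k A}
  {f : N₁ →ₗ[Env k A] N₂} {g : N₂ →ₗ[Env k A] N₃}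

lemma envMap_diff (f : N₁ →ₗ[Env k A] N₂) {i j : ℤ} (h : j + 1 = i) (z : EnvTensor (T.X i) N₁) :
    envMap LinearMap.id f (T.diff N₁ i j h z) = T.diff N₂ i j h (envMap LinearMap.id f z) := by
  rw [diff, diff, envMap_comp, envMap_comp]
  rfl

lemma IsHomConnecting.sub {i j : ℤ} {h : j + 1 = i} {ξ ξ' : T.Homology N₃ i}
    {η η' : T.Homology N₁ j} (H : T.IsHomConnecting f g i j h ξ η)
    (H' : T.IsHomConnecting f g i j h ξ' η') : T.IsHomConnecting f g i j h (ξ - ξ') (η - η') := by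
  obtain ⟨z₃, z₂, z₁, rfl, rfl, h₃, h₁⟩ := H
  obtain ⟨z₃', z₂', z₁', rfl, rfl, h₃', h₁'⟩ := H'
  refine ⟨z₃ - z₃', z₂ - z₂', z₁ - z₁', map_sub _ _ _, map_sub _ _ _, ?_, ?_⟩
  · rw [map_sub, h₃, h₃']
    rfl
  · rw [map_sub, ← h₁, ← h₁', ← map_sub]
    rfl

/-- The piece of the long exact sequence in which vanishing for the middle term makes `∂`
surjective. -/
lemma exists_isHomConnecting_of_left {i j : ℤ} (h : j + 1 = i)
    (hN : ∀ ζ : T.Homology N₂ j, ζ = 0) (hfg : ShortExact f g) (η : T.Homology N₁ j) :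
    ∃ ξ, T.IsHomConnecting f g i j h ξ η := by
  obtain ⟨z₁, rfl⟩ := T.exists_cycle η
  have hz : envMap LinearMap.id f z₁.1 ∈ T.cycles N₂ j := by
    rw [T.mem_cycles (sub_add_cancel j 1), ← envMap_diff, (T.mem_cycles _ z₁.1).1 z₁.2, map_zero]
  obtain ⟨z₂, hz₂⟩ := (T.homMk_eq_zero_iff h ⟨_, hz⟩).1 (hN _)
  replace hz₂ : T.diff N₂ i j h z₂ = envMap LinearMap.id f z₁.1 := hz₂
  refine ⟨T.homMk N₃ i ⟨envMap LinearMap.id g z₂, ?_⟩, _, z₂, z₁, rfl, rfl, rfl, hz₂.symm⟩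
  rw [T.mem_cycles h, ← envMap_diff, hz₂, envMap_comp, hfg.comp_eq_zero]
  exact LinearMap.congr_fun (f := envMap (LinearMap.id ∘ₗ LinearMap.id) 0) (g := 0)
    (envTensor_ext fun x n => (etmulₗ _ _ x).map_zero) z₁.1

lemma exists_isCohConnecting_of_right {r : ℤ} (hM : ∀ ζ : T.Cohomology N₂ (r + 1), ζ = 0)
    (hfg : ShortExact f g) (γ' : T.Cohomology N₁ (r + 1)) : ∃ γ, T.IsCohConnecting f g r γ γ' := by
  obtain ⟨u₁, rfl⟩ := T.exists_cocycle γ'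
  have hu : f ∘ₗ u₁.1 ∈ T.cocycles N₂ (r + 1) := by
    rw [T.mem_cocycles rfl, LinearMap.comp_assoc, (T.mem_cocycles rfl u₁.1).1 u₁.2,
      LinearMap.comp_zero]
  obtain ⟨w, hw⟩ := (T.cohMk_eq_zero_iff rfl ⟨_, hu⟩).1 (hM _)
  replace hw : w ∘ₗ T.d (r + 1) r rfl = f ∘ₗ u₁.1 := hw
  have hgw : (g ∘ₗ w) ∘ₗ T.d (r + 1) r rfl = 0 := by
    rw [LinearMap.comp_assoc, hw, ← LinearMap.comp_assoc, hfg.comp_eq_zero, LinearMap.zero_comp]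
  -- The primitive `w` is for plain composition with `d`; dividing by `c` compensates the sign in
  -- `codiff`.
  let c : k := (-1 : k) ^ (r + 1)
  have hc : c ≠ 0 := neg_one_zpow_ne_zero _
  have hgw' : g ∘ₗ (c⁻¹ • w) ∈ T.cocycles N₃ r := by
    rw [T.mem_cocycles rfl, hom_comp_smul, LinearMap.smul_comp, hgw, smul_zero]
  refine ⟨T.cohMk N₃ r ⟨g ∘ₗ (c⁻¹ • w), hgw'⟩, _, c⁻¹ • w, u₁, rfl, rfl, rfl, ?_⟩
  change _ = c • ((c⁻¹ • w) ∘ₗ T.d (r + 1) r rfl)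
  rw [LinearMap.smul_comp, smul_smul, mul_inv_cancel₀ hc, one_smul, hw]

lemma exists_isCohConnecting {r : ℤ} (hfg : ShortExact f g) (γ : T.Cohomology N₃ r) :
    ∃ γ', T.IsCohConnecting f g r γ γ' := by
  obtain ⟨u₃, rfl⟩ := T.exists_cocycle γ
  have := T.projective r
  obtain ⟨u₂, hu₂⟩ := Module.projective_lifting_property g u₃.1 hfg.2.2
  obtain ⟨u₁, hu₁⟩ := hfg.exists_factor (u := T.codiff N₂ r (r + 1) rfl u₂) (by
    change g ∘ₗ (((-1 : k) ^ (r + 1)) • (u₂ ∘ₗ T.d (r + 1) r rfl)) = 0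
    rw [hom_comp_smul, ← LinearMap.comp_assoc, hu₂, (T.mem_cocycles rfl u₃.1).1 u₃.2, smul_zero])
  refine ⟨T.cohMk N₁ (r + 1) ⟨u₁, ?_⟩, u₃, u₂, _, rfl, rfl, hu₂, hu₁⟩
  rw [T.mem_cocycles rfl]
  refine LinearMap.ext fun x => hfg.1 ?_
  have h₁ := LinearMap.congr_fun hu₁ (T.d (r + 1 + 1) (r + 1) rfl x)
  refine h₁.trans (Eq.trans ?_ (map_zero f).symm)
  change ((-1 : k) ^ (r + 1)) • u₂ (T.d (r + 1) r rfl (T.d (r + 1 + 1) (r + 1) rfl x)) = 0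
  rw [T.d_d, map_zero, smul_zero]

section

variable [FiniteDimensional k A]

/-- Since `T_i ⊗_{Aᵉ} -` is exact, the relation `∂ ξ = η` is single-valued; by linearity only `ξ =
0` has to be treated. -/
lemma IsHomConnecting.unique (F : FrobeniusForm k A) {i j : ℤ} {h : j + 1 = i}
    (hfg : ShortExact f g) {ξ : T.Homology N₃ i}
    {η η' : T.Homology N₁ j} (H : T.IsHomConnecting f g i j h ξ η)
    (H' : T.IsHomConnecting f g i j h ξ η') : η = η' := by
  have H₀ := H.sub H'
  rw [sub_self] at H₀
  obtain ⟨z₃, z₂, z₁, e₃, e₁, h₃, h₁⟩ := H₀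
  rw [← sub_eq_zero, ← e₁]
  obtain ⟨w₃, hw₃⟩ := (T.homMk_eq_zero_iff rfl z₃).1 e₃
  obtain ⟨w₂, rfl⟩ := (T.envTensor_exact F hfg (i + 1)).2.2 w₃
  obtain ⟨y, hy⟩ := ((T.envTensor_exact F hfg i).2.1 (z₂ - T.diff N₂ (i + 1) i rfl w₂)).1 (by
    rw [map_sub, h₃, envMap_diff, hw₃, sub_self])
  refine (T.homMk_eq_zero_iff h z₁).2 ⟨y, (T.envTensor_exact F hfg j).1 ?_⟩
  rw [h₁, envMap_diff, hy, map_sub, T.diff_diff, sub_zero]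

/-- Vanishing for the middle term makes `∂` injective. -/
lemma IsHomConnecting.injective (F : FrobeniusForm k A) {i j : ℤ} {h : j + 1 = i}
    (hfg : ShortExact f g) (hN : ∀ ζ : T.Homology N₂ i, ζ = 0) {ξ ξ' : T.Homology N₃ i} {η : T.Homology N₁ j}
    (H : T.IsHomConnecting f g i j h ξ η) (H' : T.IsHomConnecting f g i j h ξ' η) : ξ = ξ' := by
  have H₀ := H.sub H'
  rw [sub_self] at H₀
  obtain ⟨z₃, z₂, z₁, e₃, e₁, h₃, h₁⟩ := H₀
  rw [← sub_eq_zero, ← e₃]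
  obtain ⟨y, hy⟩ := (T.homMk_eq_zero_iff h z₁).1 e₁
  have hz : z₂ - envMap LinearMap.id f y ∈ T.cycles N₂ i := by
    rw [T.mem_cycles h, map_sub, ← envMap_diff, hy, h₁, sub_self]
  obtain ⟨w, hw⟩ := (T.homMk_eq_zero_iff rfl ⟨_, hz⟩).1 (hN _)
  refine (T.homMk_eq_zero_iff rfl z₃).2 ⟨envMap LinearMap.id g w, ?_⟩
  rw [← envMap_diff, hw, map_sub, h₃, ((T.envTensor_exact F hfg i).2.1 _).2 ⟨y, rfl⟩, sub_zero]

lemma exists_isHomConnecting (F : FrobeniusForm k A) {i j : ℤ} (h : j + 1 = i)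
    (hfg : ShortExact f g) (ξ : T.Homology N₃ i) : ∃ η, T.IsHomConnecting f g i j h ξ η := by
  obtain ⟨z₃, rfl⟩ := T.exists_cycle ξ
  obtain ⟨z₂, hz₂⟩ := (T.envTensor_exact F hfg i).2.2 z₃.1
  obtain ⟨z₁, hz₁⟩ := ((T.envTensor_exact F hfg j).2.1 (T.diff N₂ i j h z₂)).1 (by
    rw [envMap_diff, hz₂, (T.mem_cycles h z₃.1).1 z₃.2])
  refine ⟨T.homMk N₁ j ⟨z₁, ?_⟩, z₃, z₂, _, rfl, rfl, hz₂, hz₁⟩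
  rw [T.mem_cycles (sub_add_cancel j 1)]
  refine (T.envTensor_exact F hfg (j - 1)).1 ?_
  rw [envMap_diff, hz₁, T.diff_diff, map_zero]

variable {F : FrobeniusForm k A}

/-- The cap product is determined by its properties, by dimension shifting. -/
theorem IsCapProduct.unique {c c' : T.Pairing} (hc : T.IsCapProduct F c)
    (hc' : T.IsCapProduct F c') : c = c' := by
  let P : ℤ → ℤ → Prop := fun r s => ∀ (M N : Bimodule k A) (γ : T.Cohomology M r)
    (ξ : T.Homology N s), c M N r s γ ξ = c' M N r s γ ξ
  have h₀ : P 0 0 := fun M N γ ξ => by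
    obtain ⟨m, hm⟩ := T.exists_isZeroCoh F γ
    obtain ⟨n, hn⟩ := T.exists_isZeroHom F ξ
    obtain ⟨h, H⟩ := hc.qI M N γ ξ m n hm hn
    obtain ⟨h', H'⟩ := hc'.qI M N γ ξ m n hm hn
    exact H.unique H'
  -- Every class in degree `r + 1` is `∂ γ`, as the middle term has no cohomology, and QII₁
  -- determines its products from those of `γ`. The sequence splits over right modules, so `- ⊗_A N`
  -- keeps it exact.
  have r_up : ∀ r s, P r s → P (r + 1) s := fun r s h M N γ' ξ => by
    obtain ⟨I, Q, f, g, q, hI, hfg, hq, hqf⟩ := F.exists_shortExact_from true M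
    obtain ⟨γ, hγ⟩ := exists_isCohConnecting_of_right (T.cohomology_eq_zero hI) hfg γ'
    have hN := hfg.tensor_right hq hqf N
    have H := hc.qII₁ _ _ _ N f g hfg hN r s γ γ' ξ hγ
    rw [h Q N γ ξ] at H
    exact H.unique F hN (hc'.qII₁ _ _ _ N f g hfg hN r s γ γ' ξ hγ)
  -- Conversely the product is recovered from its image under `∂`, which is injective because `I ⊗_A
  -- N` has no homology.
  have r_down : ∀ r s, P (r + 1) s → P r s := fun r s h M N γ ξ => by
    obtain ⟨K, I, f, g, q, hI, hfg, hq, hqf⟩ := F.exists_shortExact_onto true M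
    obtain ⟨γ', hγ⟩ := exists_isCohConnecting hfg γ
    have hN := hfg.tensor_right hq hqf N
    have H := hc.qII₁ _ _ _ N f g hfg hN r s γ γ' ξ hγ
    rw [h K N γ' ξ] at H
    exact H.injective F hN (T.homology_eq_zero (hI.tensor_true N))
      (hc'.qII₁ _ _ _ N f g hfg hN r s γ γ' ξ hγ)
  -- In the second variable the sequences split over left modules, as required for `M ⊗_A -`; the
  -- sign in QII₂ is invertible.
  have s_down : ∀ r s, P r s → P r (s - 1) := fun r s h M N γ ξ' => by
    obtain ⟨I, Q, f, g, q, hI, hfg, hq, hqf⟩ := F.exists_shortExact_from false N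
    obtain ⟨ξ, hξ⟩ := exists_isHomConnecting_of_left (sub_add_cancel s 1) (T.homology_eq_zero hI)
      hfg ξ'
    have hM := hfg.tensor_left hq hqf M
    have H := hc.qII₂ M _ _ _ f g hfg hM r s γ ξ ξ' hξ
    rw [h M Q γ ξ] at H
    exact smul_right_injective _ (neg_one_zpow_ne_zero r)
      (H.unique F hM (hc'.qII₂ M _ _ _ f g hfg hM r s γ ξ ξ' hξ))
  have s_up : ∀ r s, P r (s - 1) → P r s := fun r s h M N γ ξ => by
    obtain ⟨K, I, f, g, q, hI, hfg, hq, hqf⟩ := F.exists_shortExact_onto false N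
    obtain ⟨ξ', hξ⟩ := exists_isHomConnecting F (sub_add_cancel s 1) hfg ξ
    have hM := hfg.tensor_left hq hqf M
    have H := hc.qII₂ M _ _ _ f g hfg hM r s γ ξ ξ' hξ
    rw [h M K γ ξ'] at H
    exact H.injective F hM (T.homology_eq_zero (hI.tensor_false M))
      (hc'.qII₂ M _ _ _ f g hfg hM r s γ ξ ξ' hξ)
  have hr : ∀ r, P r 0 := fun r => by
    induction r using Int.induction_on with
    | zero => exact h₀
    | succ r ih => exact r_up _ _ ih
    | pred r ih => exact r_down _ _ (by rwa [sub_add_cancel])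
  have hrs : ∀ r s, P r s := fun r s => by
    induction s using Int.induction_on with
    | zero => exact hr r
    | succ s ih => exact s_up _ _ (by rwa [add_sub_cancel_right])
    | pred s ih => exact s_down _ _ ih
  funext M N r s
  exact LinearMap.ext₂ (hrs r s M N)

lemma DiagonalApproximation.Induces.isCapProduct {Δ : T.DiagonalApproximation} {c : T.Pairing}
    (hc : Δ.Induces c) (F : FrobeniusForm k A) : T.IsCapProduct F c :=
  ⟨hc.qI F, hc.qII₁, hc.qII₂⟩

/-- The product induced by `Δ` satisfies the axioms, so uniqueness identifies any cap product with
it. -/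
lemma DiagonalApproximation.isCapProduct_iff (Δ : T.DiagonalApproximation) (F : FrobeniusForm k A)
    (c : T.Pairing) : T.IsCapProduct F c ↔ Δ.Induces c := by
  refine ⟨fun h => ?_, fun h => h.isCapProduct F⟩
  obtain ⟨c', hc'⟩ := Δ.exists_induces
  rwa [h.unique (hc'.isCapProduct F)]

end

/-! ### Transport along comparison maps -/

namespace AugMap

variable (φ : AugMap T T')

lemma augHom_envMap (N : Bimodule k A) (z : EnvTensor (T.X 0) N) :
    T'.augHom N (envMap (φ.app 0) LinearMap.id z) = T.augHom N z :=
  LinearMap.congr_fun (f := T'.augHom N ∘ₗ envMap (φ.app 0) LinearMap.id) (g := T.augHom N)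
    (envTensor_ext fun x n => congrArg (fun y => N.commutators.mkQ (N.ac true (ofRegular y) n))
      (LinearMap.congr_fun φ.aug x)) z

lemma isCohConnecting_cohMap {r : ℤ} {γ : T'.Cohomology N₃ r} {γ' : T'.Cohomology N₁ (r + 1)}
    (h : T'.IsCohConnecting f g r γ γ') :
    T.IsCohConnecting f g r (φ.cohMap N₃ r γ) (φ.cohMap N₁ (r + 1) γ') := by
  obtain ⟨u₃, u₂, u₁, rfl, rfl, h₃, h₁⟩ := h
  refine ⟨⟨_, φ.comp_mem_cocycles u₃⟩, u₂ ∘ₗ φ.app r, ⟨_, φ.comp_mem_cocycles u₁⟩,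
    (φ.cohMap_cohMk u₃).symm, (φ.cohMap_cohMk u₁).symm, ?_, ?_⟩
  · rw [← LinearMap.comp_assoc, h₃]
  · rw [← LinearMap.comp_assoc, h₁]
    change (((-1 : k) ^ (r + 1)) • (u₂ ∘ₗ T'.d (r + 1) r rfl)) ∘ₗ φ.app (r + 1) =
      ((-1 : k) ^ (r + 1)) • ((u₂ ∘ₗ φ.app r) ∘ₗ T.d (r + 1) r rfl)
    rw [LinearMap.smul_comp, LinearMap.comp_assoc, LinearMap.comp_assoc, φ.comm]

lemma isHomConnecting_homMap {i j : ℤ} {h : j + 1 = i} {ξ : T.Homology N₃ i} {ξ' : T.Homology N₁ j}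
    (H : T.IsHomConnecting f g i j h ξ ξ') :
    T'.IsHomConnecting f g i j h (φ.homMap N₃ i ξ) (φ.homMap N₁ j ξ') := by
  obtain ⟨z₃, z₂, z₁, rfl, rfl, h₃, h₁⟩ := H
  refine ⟨⟨_, φ.envMap_mem_cycles z₃⟩, envMap (φ.app i) LinearMap.id z₂,
    ⟨_, φ.envMap_mem_cycles z₁⟩, (φ.homMap_homMk z₃).symm, (φ.homMap_homMk z₁).symm, ?_, ?_⟩
  · change _ = envMap (φ.app i) LinearMap.id z₃.1
    rw [← h₃, envMap_comp, envMap_comp]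
    rfl
  · rw [φ.diff_envMap, ← h₁, envMap_comp, envMap_comp]
    rfl

variable [FiniteDimensional k A] {F : FrobeniusForm k A}

lemma isZeroCoh_cohMap {M : Bimodule k A} {γ : T'.Cohomology M 0} {q : F.InvModNorm M}
    (h : T'.IsZeroCoh F γ q) : T.IsZeroCoh F (φ.cohMap M 0 γ) q := by
  obtain ⟨u, m, rfl, rfl, hu⟩ := h
  refine ⟨⟨_, φ.comp_mem_cocycles u⟩, m, (φ.cohMap_cohMk u).symm, rfl, fun x => ?_⟩
  exact (hu (φ.app 0 x)).trans (congrArg (fun y => M.left (ofRegular y) m.1)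
    (LinearMap.congr_fun φ.aug x))

lemma isZeroHom_homMap {N : Bimodule k A} {ξ : T.Homology N 0} {q : F.NormKerMod N}
    (h : T.IsZeroHom F ξ q) : T'.IsZeroHom F (φ.homMap N 0 ξ) q := by
  obtain ⟨z, n, rfl, rfl, hz⟩ := h
  exact ⟨⟨_, φ.envMap_mem_cycles z⟩, n, (φ.homMap_homMk z).symm, rfl,
    (φ.augHom_envMap N z.1).trans hz⟩

/-- The cap product is natural in the complete resolution. -/
theorem homMap_cap {c : T.Pairing} {c' : T'.Pairing} (hc : T.IsCapProduct F c)
    (hc' : T'.IsCapProduct F c') {M N : Bimodule k A} {r s : ℤ} (γ : T'.Cohomology M r)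
    (ξ : T.Homology N s) : φ.homMap (tensor M N) (s - r) (c M N r s (φ.cohMap M r γ) ξ) =
      c' M N r s γ (φ.homMap N s ξ) := by
  obtain ⟨ψ, -, -, -, hψ⟩ := φ.exists_inverse F
  -- The product of `T` is transported to `T'` by `φ_*(φ^* γ ⌢ ψ_* ξ)`. It satisfies the axioms
  -- there, so it is the product of `T'`; evaluating it at `φ_* ξ` and using `ψ_* φ_* = 1` gives the
  -- claim.
  let b : T'.Pairing := fun M N r s => ((c M N r s).compl₁₂ (φ.cohMap M r) (ψ.homMap N s)).compr₂
    (φ.homMap (tensor M N) (s - r))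
  have hb : T'.IsCapProduct F b := by
    refine ⟨fun M N γ ξ m n hm hn => ?_, fun M₁ M₂ M₃ N f g hfg hN r s γ γ' ξ h => ?_,
      fun M N₁ N₂ N₃ f g hfg hM r s γ ξ ξ' h => ?_⟩
    · obtain ⟨h, H⟩ := hc.qI M N _ _ m n (φ.isZeroCoh_cohMap hm) (ψ.isZeroHom_homMap hn)
      exact ⟨h, φ.isZeroHom_homMap H⟩
    · exact φ.isHomConnecting_homMap
        (hc.qII₁ M₁ M₂ M₃ N f g hfg hN r s _ _ _ (φ.isCohConnecting_cohMap h))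
    · have H := φ.isHomConnecting_homMap
        (hc.qII₂ M N₁ N₂ N₃ f g hfg hM r s (φ.cohMap M r γ) _ _ (ψ.isHomConnecting_homMap h))
      rwa [map_smul] at H
  rw [← hb.unique hc']
  change _ = φ.homMap (tensor M N) (s - r) (c M N r s (φ.cohMap M r γ) (ψ.homMap N s _))
  rw [hψ]

end AugMap

end CompleteResolution

end TateHochschild

open TateHochschild in
theorem theorem3p11 {k : Type v} {A : Type u} [Field k] [Ring A] [Algebra k A]
    [FiniteDimensional k A] (F : FrobeniusForm k A) :
    -- complete resolutions and diagonal approximations exist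
    Nonempty (CompleteResolution k A) ∧
    (∀ T : CompleteResolution k A, Nonempty T.DiagonalApproximation) ∧
    -- there is exactly one cap product
    (∀ T : CompleteResolution k A, ∃! c : T.Pairing, T.IsCapProduct F c) ∧
    -- it is the one induced by any diagonal approximation
    (∀ (T : CompleteResolution k A) (Δ : T.DiagonalApproximation) (c : T.Pairing),
      T.IsCapProduct F c ↔ Δ.Induces c) ∧
    -- and it does not depend on the complete resolution
    (∀ T T' : CompleteResolution k A,
      Nonempty (T.AugMap T') ∧
      (∀ φ ψ : T.AugMap T', φ.cohMap = ψ.cohMap ∧ φ.homMap = ψ.homMap) ∧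
      ∀ φ : T.AugMap T',
        (∀ M r, Function.Bijective (φ.cohMap M r)) ∧
        (∀ N s, Function.Bijective (φ.homMap N s)) ∧
        ∀ (c : T.Pairing) (c' : T'.Pairing), T.IsCapProduct F c → T'.IsCapProduct F c' →
          ∀ (M N : Bimodule k A) (r s : ℤ) (γ : T'.Cohomology M r) (ξ : T.Homology N s),
            φ.homMap (M.tensor N) (s - r) (c M N r s (φ.cohMap M r γ) ξ) =
              c' M N r s γ (φ.homMap N s ξ)) := by
  refine ⟨F.nonempty_completeResolution, fun T => T.nonempty_diagonalApproximation F,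
    fun T => ?_, fun T Δ c => Δ.isCapProduct_iff F c, fun T T' => ⟨T.nonempty_augMap T' F,
      fun φ ψ => ⟨?_, ?_⟩, fun φ => ?_⟩⟩
  · obtain ⟨Δ⟩ := T.nonempty_diagonalApproximation F
    obtain ⟨c, hc⟩ := Δ.exists_induces
    exact ⟨c, hc.isCapProduct F, fun c' hc' => hc'.unique (hc.isCapProduct F)⟩
  · exact CompleteResolution.AugMap.cohMap_eq F φ ψ
  · exact CompleteResolution.AugMap.homMap_eq F φ ψ
  · obtain ⟨ψ, h₁, h₂, h₃, h₄⟩ := φ.exists_inverse F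
    exact ⟨fun M r => ⟨Function.LeftInverse.injective (h₂ M r),
        Function.RightInverse.surjective (h₁ M r)⟩,
      fun N s => ⟨Function.LeftInverse.injective (h₄ N s),
        Function.RightInverse.surjective (h₃ N s)⟩,
      fun c c' hc hc' M N r s γ ξ => φ.homMap_cap hc hc' γ ξ⟩
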